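/- Let $A\in\mathbb R^{n\times n}$, $B\in\mathbb R^{n\times m}$, $C\in\mathbb R^{q\times n}$, $Q\ge 0$, $R>0$, $W\ge 0$, $U>0$ (symmetric), and consider the controlled system $$x_{k+1}=Ax_k+Bu_k+w_k,\qquad y_k=Cx_k+v_k,$$ where $x_0\sim\mathcal N(\bar x_0,\Sigma_0)$ with $\Sigma_0\ge 0$, $w_k\sim\mathcal N(0,Q)$, $v_k\sim\mathcal N(0,R)$, and $x_0,w_0,w_1,\dots,v_0,v_1,\dots$ are mutually independent. Assume that $(A,B)$ is controllable, $(A,\sqrt Q)$ is stabilizable and $(C,A)$ is detectable. Let $T\ge 1$ be an integer such that $(C,A^T)$ is detectable. A transmission schedule is a sequence $\gamma_k\in\{0,1\}$, and $\tilde Y_k=\{\gamma_1y_1,\dots,\gamma_ky_k\}$ is the data received by the server. An input process $u$ is admissible if each $u_k$ is a measurable function of $\gamma_1y_1,\dots,\gamma_ky_k,u_0,\dots,u_{k-1}$. Write $\hat x_k=\mathbf E[x_k\mid\tilde Y_k]$ and $P_k=\mathbf E[(x_k-\hat x_k)(x_k-\hat x_k)'\mid\tilde Y_k]$. The $T$-periodic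 schedule has $\gamma_k=1$ exactly for $k=lT+1$, $l\ge 0$, with error covariances denoted $P_k^{pri}$; the ordinary schedule has $\gamma_k=1$ for all $k$, with error covariances denoted $P_k$. For a given schedule, the optimal average cost is the infimum over admissible $u$ of $$\limsup_{N\to\infty}\frac1N\,\mathbf E\Big[\sum_{k=0}^{N-1}(x_k'Wx_k+u_k'Uu_k)\Big];$$ it is denoted $\mathcal O^*$ for the $T$-periodic schedule and $\mathcal J^*$ for the ordinary one. Let $J_{0:N}$ be the infimum over admissible $u$, under the $T$-periodic schedule, of $\mathbf E[\sum_{k=0}^{N-1}(x_k'Wx_k+u_k'Uu_k)+x_N'Wx_N]$. Put $$h(X)=AXA'+Q,\quad \tilde g(X)=X-XC'(CXC'+R)^{-1}CX,\quad g=\tilde g\circ h .$$ Then: 1. The recursion $S_N=W$, $S_k=A'S_{k+1}A+W-A'S_{k+1}B(B'S_{k+1}B+U)^{-1}B'S_{k+1}A$ has a limit $S=\lim_{N\to\infty}S_0\ge 0$, which solves $S=A'SA+W-A'SB(B'SB+U)^{-1}B'SA$; and there is a unique positive semidefinite $\tilde P$ with $\tilde P=g(h^{T-1}(\tilde P))$.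 2. Let $\Phi=A'SB(U+B'SB)^{-1}B'SA$. All $J_{0:N}$ and $\mathcal O^*$ are finite, and $$\mathcal O^*=\lim_{N\to\infty}\frac1N J_{0:N}=\operatorname{tr}(SQ)+\operatorname{tr}\Big(\Phi\,\frac1T\sum_{i=0}^{T-1}h^i(\tilde P)\Big).$$ Moreover $J_{0:N}$ is attained by an admissible input with $u_k=L_k\hat x_k$ almost surely for $0\le k<N$, where $L_k=-(B'S_{k+1}B+U)^{-1}B'S_{k+1}A$, and $\mathcal O^*$ is attained, with the $\limsup$ being a limit, by an admissible input with $u_k=L\hat x_k$ almost surely for all $k$, where $L=-(B'SB+U)^{-1}B'SA$. 3. There is a deterministic matrix $\mathcal Q_{privacy}$ such that, for any admissible square-integrable inputs under the two schedules, almost surely $$\mathcal Q_{privacy}=\lim_{N\to\infty}\frac1N\sum_{k=0}^{N-1}(P_k^{pri}-P_k).$$ Moreover $\mathcal J^*$ is finite, and the control-performance loss is $$\mathcal O^*-\mathcal J^*=\operatorname{tr}(\Phi\,\mathcal Q_{privacy}).$$ -/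

import Mathlib

open MeasureTheory ProbabilityTheory Filter Topology Matrix
open scoped ENNReal

noncomputable section

namespace LQG

/-! ### Linear systems notions -/

/-- All (complex) eigenvalues of the real square matrix `M` lie in the open unit disc,
i.e. its spectral radius is `< 1`. -/
def SchurStable {n : ℕ} (M : Matrix (Fin n) (Fin n) ℝ) : Prop :=
  ∀ z ∈ spectrum ℂ (M.map (algebraMap ℝ ℂ)), ‖z‖ < 1

/-- The pair `(A, B)` is stabilizable. -/
def Stabilizable {n p : ℕ} (A : Matrix (Fin n) (Fin n) ℝ) (B : Matrix (Fin n) (Fin p) ℝ) : Prop :=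
  ∃ F : Matrix (Fin p) (Fin n) ℝ, SchurStable (A + B * F)

/-- The pair `(C, A)` is detectable. -/
def Detectable {n q : ℕ} (C : Matrix (Fin q) (Fin n) ℝ) (A : Matrix (Fin n) (Fin n) ℝ) : Prop :=
  ∃ K : Matrix (Fin n) (Fin q) ℝ, SchurStable (A + K * C)

/-- The controllability matrix `[B, AB, …, A^(n-1) B]`. -/
def controllabilityMatrix {n m : ℕ} (A : Matrix (Fin n) (Fin n) ℝ) (B : Matrix (Fin n) (Fin m) ℝ) :
    Matrix (Fin n) (Fin n × Fin m) ℝ :=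
  Matrix.of fun i p => (A ^ (p.1 : ℕ) * B) i p.2

/-- The pair `(A, B)` is controllable. -/
def Controllable {n m : ℕ} (A : Matrix (Fin n) (Fin n) ℝ) (B : Matrix (Fin n) (Fin m) ℝ) : Prop :=
  (controllabilityMatrix A B).rank = n

open scoped MatrixOrder in
/-- The positive semidefinite square root of a positive semidefinite matrix. -/
def psdSqrt {n : ℕ} (Q : Matrix (Fin n) (Fin n) ℝ) : Matrix (Fin n) (Fin n) ℝ := CFC.sqrt Q

/-! ### The plant -/

/-- The data of a linear quadratic control problem: the matrices of the state equation
`x (k+1) = A x k + B u k + w k` and of the measurement equation `y k = C x k + v k`, the noise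
covariances `Q`, `R`, the weights `W`, `U`, the random initial state `x0` and the noise
sequences `w`, `v`. -/
structure System (n m q : ℕ) (Ω : Type*) where
  A : Matrix (Fin n) (Fin n) ℝ
  B : Matrix (Fin n) (Fin m) ℝ
  C : Matrix (Fin q) (Fin n) ℝ
  Q : Matrix (Fin n) (Fin n) ℝ
  R : Matrix (Fin q) (Fin q) ℝ
  W : Matrix (Fin n) (Fin n) ℝ
  U : Matrix (Fin m) (Fin m) ℝ
  x0 : Ω → Fin n → ℝ
  w : ℕ → Ω → Fin n → ℝ
  v : ℕ → Ω → Fin q → ℝ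

namespace System

variable {n m q : ℕ} {Ω : Type*}

/-- The operator `h(X) = A X A' + Q`. -/
def h (s : System n m q Ω) (X : Matrix (Fin n) (Fin n) ℝ) : Matrix (Fin n) (Fin n) ℝ :=
  s.A * X * s.Aᵀ + s.Q

/-- The operator `g̃(X) = X - X C' (C X C' + R)⁻¹ C X`. -/
def gTilde (s : System n m q Ω) (X : Matrix (Fin n) (Fin n) ℝ) : Matrix (Fin n) (Fin n) ℝ :=
  X - X * s.Cᵀ * (s.C * X * s.Cᵀ + s.R)⁻¹ * s.C * X

/-- The operator `g = g̃ ∘ h`. -/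
def g (s : System n m q Ω) (X : Matrix (Fin n) (Fin n) ℝ) : Matrix (Fin n) (Fin n) ℝ :=
  s.gTilde (s.h X)

/-- `Φ = A' S B (U + B' S B)⁻¹ B' S A`. -/
def Phi (s : System n m q Ω) (S : Matrix (Fin n) (Fin n) ℝ) : Matrix (Fin n) (Fin n) ℝ :=
  s.Aᵀ * S * s.B * (s.U + s.Bᵀ * S * s.B)⁻¹ * s.Bᵀ * S * s.A

/-- One backward step of the control Riccati recursion,
`S ↦ A' S A + W - A' S B (B' S B + U)⁻¹ B' S A`. -/
def riccati (s : System n m q Ω) (S : Matrix (Fin n) (Fin n) ℝ) : Matrix (Fin n) (Fin n) ℝ :=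
  s.Aᵀ * S * s.A + s.W - s.Aᵀ * S * s.B * (s.Bᵀ * S * s.B + s.U)⁻¹ * s.Bᵀ * S * s.A

/-- The matrix `S_{N-j}` of the backward Riccati recursion with terminal value `S_N = W`. -/
def riccatiIter (s : System n m q Ω) (j : ℕ) : Matrix (Fin n) (Fin n) ℝ := s.riccati^[j] s.W

/-- The feedback gain `L = -(B' S B + U)⁻¹ B' S A`. -/
def gain (s : System n m q Ω) (S : Matrix (Fin n) (Fin n) ℝ) : Matrix (Fin m) (Fin n) ℝ :=
  -((s.Bᵀ * S * s.B + s.U)⁻¹ * s.Bᵀ * S * s.A)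

/-- The state trajectory produced by the input process `u`. -/
def state (s : System n m q Ω) (u : ℕ → Ω → Fin m → ℝ) : ℕ → Ω → Fin n → ℝ
  | 0 => s.x0
  | k + 1 => fun ω => s.A *ᵥ s.state u k ω + s.B *ᵥ u k ω + s.w k ω

/-- The measurements `y k = C x k + v k`. -/
def output (s : System n m q Ω) (u : ℕ → Ω → Fin m → ℝ) (k : ℕ) (ω : Ω) : Fin q → ℝ :=
  s.C *ᵥ s.state u k ω + s.v k ω

end System

/-! ### Transmission schedules and admissible inputs -/

/-- `γ k = 1` when the measurement `y k` is sent to the server and `γ k = 0` otherwise; here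
`y 1, y (T+1), y (2T+1), …` are sent. -/
def periodicSchedule (T : ℕ) (k : ℕ) : ℝ :=
  open scoped Classical in if ∃ l : ℕ, k = l * T + 1 then 1 else 0

/-- The schedule of the ordinary system: every measurement is sent. -/
def fullSchedule : ℕ → ℝ := fun _ => 1

namespace System

variable {n m q : ℕ} {Ω : Type*}

/-- The σ-algebra generated by the received data `γ 1 • y 1, …, γ k • y k`. -/
abbrev receivedSigma (s : System n m q Ω) (γ : ℕ → ℝ) (u : ℕ → Ω → Fin m → ℝ) (k : ℕ) :
    MeasurableSpace Ω :=
  ⨆ j ∈ Finset.Icc 1 k, MeasurableSpace.comap (fun ω => γ j • s.output u j ω) inferInstance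

/-- The σ-algebra of the information set
`{γ 1 • y 1, …, γ k • y k, u 0, …, u (k-1)}` of the server at time `k`. -/
abbrev infoSigma (s : System n m q Ω) (γ : ℕ → ℝ) (u : ℕ → Ω → Fin m → ℝ) (k : ℕ) :
    MeasurableSpace Ω :=
  s.receivedSigma γ u k ⊔ ⨆ j ∈ Finset.range k, MeasurableSpace.comap (u j) inferInstance

/-- An input process is admissible if each `u k` is a function of the information available
to the server at time `k`. -/
def Admissible (s : System n m q Ω) (γ : ℕ → ℝ) (u : ℕ → Ω → Fin m → ℝ) : Prop :=
  ∀ k, Measurable[s.infoSigma γ u k] (u k)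

/-! ### Costs

The costs are nonnegative and are taken in `[0, ∞]`, so that no integrability of the inputs has to
be imposed. -/

/-- The stage cost `x k' W x k + u k' U u k`. -/
def stageCost (s : System n m q Ω) (u : ℕ → Ω → Fin m → ℝ) (k : ℕ) (ω : Ω) : ℝ :=
  s.state u k ω ⬝ᵥ (s.W *ᵥ s.state u k ω) + u k ω ⬝ᵥ (s.U *ᵥ u k ω)

variable [MeasurableSpace Ω]

/-- `E[∑_{k<N} (x k' W x k + u k' U u k)]`. -/
def runningCost (s : System n m q Ω) (μ : Measure Ω) (u : ℕ → Ω → Fin m → ℝ) (N : ℕ) : ℝ≥0∞ :=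
  ∫⁻ ω, ENNReal.ofReal (∑ k ∈ Finset.range N, s.stageCost u k ω) ∂μ

/-- `E[∑_{k<N} (x k' W x k + u k' U u k) + x N' W x N]`. -/
def horizonCost (s : System n m q Ω) (μ : Measure Ω) (u : ℕ → Ω → Fin m → ℝ) (N : ℕ) : ℝ≥0∞ :=
  ∫⁻ ω, ENNReal.ofReal (∑ k ∈ Finset.range N, s.stageCost u k ω
    + s.state u N ω ⬝ᵥ (s.W *ᵥ s.state u N ω)) ∂μ

/-- The infinite-horizon average cost of an input process. -/
def averageCost (s : System n m q Ω) (μ : Measure Ω) (u : ℕ → Ω → Fin m → ℝ) : ℝ≥0∞ :=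
  limsup (fun N : ℕ => s.runningCost μ u N / N) atTop

/-- The optimal finite-horizon cost over all admissible inputs. -/
def optimalHorizonCost (s : System n m q Ω) (μ : Measure Ω) (γ : ℕ → ℝ) (N : ℕ) : ℝ≥0∞ :=
  ⨅ (u : ℕ → Ω → Fin m → ℝ) (_ : s.Admissible γ u), s.horizonCost μ u N

/-- The optimal infinite-horizon average cost over all admissible inputs. -/
def optimalAverageCost (s : System n m q Ω) (μ : Measure Ω) (γ : ℕ → ℝ) : ℝ≥0∞ :=
  ⨅ (u : ℕ → Ω → Fin m → ℝ) (_ : s.Admissible γ u), s.averageCost μ u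

/-! ### Estimates and error covariances -/

/-- The server's estimate `E[x k | γ 1 • y 1, …, γ k • y k]`. -/
def estimate (s : System n m q Ω) (μ : Measure Ω) (γ : ℕ → ℝ) (u : ℕ → Ω → Fin m → ℝ) (k : ℕ) :
    Ω → Fin n → ℝ :=
  μ[s.state u k | s.receivedSigma γ u k]

/-- The conditional error covariance
`E[(x k - x̂ k) (x k - x̂ k)' | γ 1 • y 1, …, γ k • y k]` of the estimate. -/
def errorCov (s : System n m q Ω) (μ : Measure Ω) (γ : ℕ → ℝ) (u : ℕ → Ω → Fin m → ℝ) (k : ℕ)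
    (ω : Ω) : Matrix (Fin n) (Fin n) ℝ :=
  Matrix.of fun i j =>
    (μ[fun ω' => (s.state u k ω' i - s.estimate μ γ u k ω' i)
        * (s.state u k ω' j - s.estimate μ γ u k ω' j) | s.receivedSigma γ u k]) ω

/-- The standing assumptions on the random data: the initial state is Gaussian with mean `xbar0`
and covariance `Sigma0`, the noises are centred Gaussian white noises with covariances `Q` and `R`,
and the initial state and all noise variables are mutually independent. -/
structure GaussianData (s : System n m q Ω) (μ : Measure Ω) (xbar0 : Fin n → ℝ)
    (Sigma0 : Matrix (Fin n) (Fin n) ℝ) : Prop where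
  measurable_x0 : Measurable s.x0
  measurable_w : ∀ k, Measurable (s.w k)
  measurable_v : ∀ k, Measurable (s.v k)
  law_x0 : HasLaw (fun ω => WithLp.toLp 2 (s.x0 ω))
    (multivariateGaussian (WithLp.toLp 2 xbar0) Sigma0) μ
  law_w : ∀ k, HasLaw (fun ω => WithLp.toLp 2 (s.w k ω)) (multivariateGaussian 0 s.Q) μ
  law_v : ∀ k, HasLaw (fun ω => WithLp.toLp 2 (s.v k ω)) (multivariateGaussian 0 s.R) μ
  indep : iIndep (Sum.elim (fun _ : Unit => MeasurableSpace.comap s.x0 inferInstance)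
    (Sum.elim (fun k : ℕ => MeasurableSpace.comap (s.w k) inferInstance)
      (fun k : ℕ => MeasurableSpace.comap (s.v k) inferInstance))) μ

end System

end LQG

end

noncomputable section

namespace LQG


/-! ### Quadratic forms -/

section Quadratic

variable {n p : ℕ}

/-! The proof combines a separation principle, an exact cost identity and the convergence of Riccati
iterations.

Separation. The state is the uncontrolled state plus a part driven by the inputs. An admissible
input is, by induction on time, a function of the data the uncontrolled system would have delivered
(`admissible_iff`), so the driven part is known to the server and controlled and uncontrolled data
generate the same σ-algebras (`receivedSigma_eq`). The estimation error therefore does not depend on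
the input. By induction along the Kalman filter it is a centred Gaussian vector, independent of the
received data, with deterministic covariance `filterCov` (`filterError_spec`). For square-integrable
inputs, this identifies the conditional mean and shows that the conditional error covariance is
almost surely deterministic.

Cost identity. Completing the square at each stage and taking expectations (`integral_step`,
`integral_cost`) writes the cost as an initial term, plus the sum of `tr (S_{k+1} Q) + tr (Φ_{k+1}
P_k)`, plus a nonnegative excess that vanishes exactly under feedback of the estimate with the
Riccati gain, since the weight `B' X B + U` is positive definite. With the backward recursion this
solves the finite-horizon problem. With the constant solution `S` it bounds the stationary law from
above; the nonnegative terminal term is simply dropped, so no stability of the closed loop is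
needed. Finite-horizon values bound every average cost from below, and after division by the horizon
the two bounds have the same limit. Inputs that are not square integrable cost infinity because `U >
0`.

Convergence. Control and filtering use the same map `dare`, the minimum over `u` of a one-step cost.
Its iterates from `0` increase and are bounded if every state has a trajectory of finite cost; any
other positive semidefinite start has the same limit if vanishing cost and disturbance force the
state to vanish (`tendsto_dare_iterate`). Controllability supplies finite cost on the control side.
Over one period of the schedule, `h^T ∘ g̃` is `dare` for the pair dual to `(C, A^T)`; detectability
of that pair and stabilizability of `(A, √Q)` supply the two conditions. The error covariances are
thus asymptotically periodic and have Cesàro means. The ordinary schedule is the case `T = 1`, and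
in the difference of the two optimal costs `tr (S Q)` cancels. -/

theorem dotProduct_mulVec_comm_of_symm {X : Matrix (Fin n) (Fin n) ℝ} (hX : Xᵀ = X)
    (x y : Fin n → ℝ) : x ⬝ᵥ (X *ᵥ y) = y ⬝ᵥ (X *ᵥ x) := by
  rw [dotProduct_mulVec, ← mulVec_transpose, hX, dotProduct_comm]

theorem dotProduct_transpose_mulVec' (M : Matrix (Fin n) (Fin p) ℝ) (x : Fin p → ℝ)
    (y : Fin n → ℝ) : x ⬝ᵥ (Mᵀ *ᵥ y) = (M *ᵥ x) ⬝ᵥ y := by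
  rw [dotProduct_mulVec, vecMul_transpose]

theorem PosSemidef.transpose_eq {X : Matrix (Fin n) (Fin n) ℝ} (hX : X.PosSemidef) : Xᵀ = X := by
  simpa using hX.isHermitian.eq

theorem PosSemidef.quad_nonneg {X : Matrix (Fin n) (Fin n) ℝ} (hX : X.PosSemidef)
    (x : Fin n → ℝ) : 0 ≤ x ⬝ᵥ (X *ᵥ x) := by
  simpa using hX.dotProduct_mulVec_nonneg x

theorem posSemidef_of_quad_nonneg {X : Matrix (Fin n) (Fin n) ℝ} (hX : Xᵀ = X)
    (h : ∀ x : Fin n → ℝ, 0 ≤ x ⬝ᵥ (X *ᵥ x)) : X.PosSemidef :=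
  .of_dotProduct_mulVec_nonneg (by simpa [IsHermitian] using hX) (by simpa using h)

theorem quad_add {X : Matrix (Fin n) (Fin n) ℝ} (hX : Xᵀ = X) (x y : Fin n → ℝ) :
    (x + y) ⬝ᵥ (X *ᵥ (x + y)) = x ⬝ᵥ (X *ᵥ x) + 2 * (x ⬝ᵥ (X *ᵥ y)) + y ⬝ᵥ (X *ᵥ y) := by
  rw [mulVec_add, add_dotProduct, dotProduct_add, dotProduct_add,
    dotProduct_mulVec_comm_of_symm hX y x]
  ring

theorem entry_eq_polarization {X : Matrix (Fin n) (Fin n) ℝ} (hX : Xᵀ = X) (i j : Fin n) :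
    X i j = ((Pi.single i 1 + Pi.single j 1) ⬝ᵥ (X *ᵥ (Pi.single i 1 + Pi.single j 1))
      - Pi.single i 1 ⬝ᵥ (X *ᵥ Pi.single i 1) - Pi.single j 1 ⬝ᵥ (X *ᵥ Pi.single j 1)) / 2 := by
  rw [quad_add hX]
  simp only [single_one_dotProduct, mulVec_single_one, col_apply]
  ring

theorem tendsto_of_tendsto_quad {X : ℕ → Matrix (Fin n) (Fin n) ℝ} {S : Matrix (Fin n) (Fin n) ℝ}
    (hX : ∀ k, (X k)ᵀ = X k) (hS : Sᵀ = S)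
    (h : ∀ x : Fin n → ℝ, Tendsto (fun k => x ⬝ᵥ (X k *ᵥ x)) atTop (𝓝 (x ⬝ᵥ (S *ᵥ x)))) :
    Tendsto X atTop (𝓝 S) := by
  refine tendsto_pi_nhds.2 fun i => tendsto_pi_nhds.2 fun j => ?_
  simp_rw [fun k => entry_eq_polarization (hX k) i j]
  rw [entry_eq_polarization hS i j]
  exact (((h _).sub (h _)).sub (h _)).div_const _

/-- Each quadratic form value is a bounded monotone real sequence, and polarization recovers every
matrix entry from finitely many such values. -/
theorem exists_tendsto_of_quad_monotone {X : ℕ → Matrix (Fin n) (Fin n) ℝ}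
    (hX : ∀ k, (X k).PosSemidef)
    (hmono : ∀ x : Fin n → ℝ, Monotone fun k => x ⬝ᵥ (X k *ᵥ x))
    (hbdd : ∀ x : Fin n → ℝ, ∃ c, ∀ k, x ⬝ᵥ (X k *ᵥ x) ≤ c) :
    ∃ S : Matrix (Fin n) (Fin n) ℝ, S.PosSemidef ∧ Tendsto X atTop (𝓝 S) := by
  have hlim : ∀ x : Fin n → ℝ, ∃ l, Tendsto (fun k => x ⬝ᵥ (X k *ᵥ x)) atTop (𝓝 l) := by
    intro x
    obtain ⟨c, hc⟩ := hbdd x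
    exact ⟨_, tendsto_atTop_ciSup (hmono x) ⟨c, by rintro _ ⟨k, rfl⟩; exact hc k⟩⟩
  choose l hl using hlim
  let S : Matrix (Fin n) (Fin n) ℝ := Matrix.of fun i j =>
    (l (Pi.single i 1 + Pi.single j 1) - l (Pi.single i 1) - l (Pi.single j 1)) / 2
  have hS : Tendsto X atTop (𝓝 S) := by
    refine tendsto_pi_nhds.2 fun i => tendsto_pi_nhds.2 fun j => ?_
    simp_rw [fun k => entry_eq_polarization (PosSemidef.transpose_eq (hX k)) i j]
    exact (((hl _).sub (hl _)).sub (hl _)).div_const _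
  refine ⟨S, posSemidef_of_quad_nonneg ?_ ?_, hS⟩
  · ext i j
    simp only [S, transpose_apply, of_apply]
    rw [add_comm (Pi.single j 1 : Fin n → ℝ)]
    ring
  · intro x
    have hc : Continuous fun Y : Matrix (Fin n) (Fin n) ℝ => x ⬝ᵥ (Y *ᵥ x) := by fun_prop
    exact ge_of_tendsto' ((hc.tendsto S).comp hS) fun k => PosSemidef.quad_nonneg (hX k) x

theorem tendsto_zero_of_tendsto_dotProduct_self {x : ℕ → Fin n → ℝ}
    (h : Tendsto (fun k => x k ⬝ᵥ x k) atTop (𝓝 0)) : Tendsto x atTop (𝓝 0) := by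
  refine tendsto_pi_nhds.2 fun i => ?_
  have h2 : Tendsto (fun k => (x k i) ^ 2) atTop (𝓝 0) := by
    refine squeeze_zero (fun k => sq_nonneg _) (fun k => ?_) h
    rw [dotProduct, pow_two]
    exact Finset.single_le_sum (f := fun i => x k i * x k i)
      (fun j _ => mul_self_nonneg _) (Finset.mem_univ i)
  rw [Pi.zero_apply, tendsto_zero_iff_abs_tendsto_zero]
  have := h2.sqrt
  simpa [Real.sqrt_sq_eq_abs, Function.comp_def] using this

end Quadratic

/-! ### The Riccati map -/

section Dare

variable {n m : ℕ}

/-- The discrete-time algebraic Riccati map. -/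
def dare (A : Matrix (Fin n) (Fin n) ℝ) (B : Matrix (Fin n) (Fin m) ℝ)
    (W : Matrix (Fin n) (Fin n) ℝ) (U : Matrix (Fin m) (Fin m) ℝ)
    (X : Matrix (Fin n) (Fin n) ℝ) : Matrix (Fin n) (Fin n) ℝ :=
  Aᵀ * X * A + W - Aᵀ * X * B * (Bᵀ * X * B + U)⁻¹ * Bᵀ * X * A

/-- The minimizing gain of the Riccati map. -/
def dareGain (A : Matrix (Fin n) (Fin n) ℝ) (B : Matrix (Fin n) (Fin m) ℝ)
    (U : Matrix (Fin m) (Fin m) ℝ) (X : Matrix (Fin n) (Fin n) ℝ) : Matrix (Fin m) (Fin n) ℝ :=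
  -((Bᵀ * X * B + U)⁻¹ * Bᵀ * X * A)

variable {A : Matrix (Fin n) (Fin n) ℝ} {B : Matrix (Fin n) (Fin m) ℝ}
  {W : Matrix (Fin n) (Fin n) ℝ} {U : Matrix (Fin m) (Fin m) ℝ}

theorem posDef_congr_add (B : Matrix (Fin n) (Fin m) ℝ) (hU : U.PosDef)
    {X : Matrix (Fin n) (Fin n) ℝ} (hX : X.PosSemidef) : (Bᵀ * X * B + U).PosDef := by
  have := hX.conjTranspose_mul_mul_same B
  rw [conjTranspose_eq_transpose_of_trivial] at this
  exact Matrix.PosDef.posSemidef_add this hU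

/-- As a function of `u` the left side is quadratic with Hessian `2M`, `M = BᵀXB + U`, and linear
part given by `b = BᵀXAx`; the minimizer is `-M⁻¹b`. Both the variational description of `dare` and
the excess cost of a suboptimal input come from this identity. -/
theorem complete_square (A : Matrix (Fin n) (Fin n) ℝ) (B : Matrix (Fin n) (Fin m) ℝ)
    (W : Matrix (Fin n) (Fin n) ℝ) (hU : U.PosDef) {X : Matrix (Fin n) (Fin n) ℝ}
    (hX : X.PosSemidef) (x : Fin n → ℝ) (u : Fin m → ℝ) :
    (A *ᵥ x + B *ᵥ u) ⬝ᵥ (X *ᵥ (A *ᵥ x + B *ᵥ u)) + x ⬝ᵥ (W *ᵥ x) + u ⬝ᵥ (U *ᵥ u) =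
      x ⬝ᵥ (dare A B W U X *ᵥ x) + (u - dareGain A B U X *ᵥ x) ⬝ᵥ
        ((Bᵀ * X * B + U) *ᵥ (u - dareGain A B U X *ᵥ x)) := by
  set M := Bᵀ * X * B + U with hM
  have hMp : M.PosDef := posDef_congr_add B hU hX
  have hMs : Mᵀ = M := PosSemidef.transpose_eq hMp.posSemidef
  have hXs := PosSemidef.transpose_eq hX
  have hMi : M * M⁻¹ = 1 := mul_nonsing_inv _ ((isUnit_iff_isUnit_det _).1 hMp.isUnit)
  set b := Bᵀ *ᵥ (X *ᵥ (A *ᵥ x)) with hb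
  have hg : u - dareGain A B U X *ᵥ x = u + M⁻¹ *ᵥ b := by
    simp [dareGain, hb, hM, neg_mulVec, Matrix.mul_assoc]
  have hd : x ⬝ᵥ (dare A B W U X *ᵥ x) =
      (A *ᵥ x) ⬝ᵥ (X *ᵥ (A *ᵥ x)) + x ⬝ᵥ (W *ᵥ x) - b ⬝ᵥ (M⁻¹ *ᵥ b) := by
    have h1 : dare A B W U X *ᵥ x = Aᵀ *ᵥ (X *ᵥ (A *ᵥ x)) + W *ᵥ x
        - Aᵀ *ᵥ (X *ᵥ (B *ᵥ (M⁻¹ *ᵥ b))) := by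
      simp [dare, hb, hM, sub_mulVec, add_mulVec, Matrix.mul_assoc]
    rw [h1, dotProduct_sub, dotProduct_add, dotProduct_transpose_mulVec',
      dotProduct_transpose_mulVec', dotProduct_mulVec_comm_of_symm hXs (A *ᵥ x) (B *ᵥ _),
      ← dotProduct_transpose_mulVec' B, ← hb, dotProduct_comm _ b]
  rw [hg, hd, quad_add hXs, quad_add hMs]
  have h2 : M *ᵥ (M⁻¹ *ᵥ b) = b := by rw [mulVec_mulVec, hMi, one_mulVec]
  have h3 : (A *ᵥ x) ⬝ᵥ (X *ᵥ (B *ᵥ u)) = u ⬝ᵥ b := by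
    rw [dotProduct_mulVec_comm_of_symm hXs, ← dotProduct_transpose_mulVec']
  have h4 : u ⬝ᵥ (M *ᵥ u) = (B *ᵥ u) ⬝ᵥ (X *ᵥ (B *ᵥ u)) + u ⬝ᵥ (U *ᵥ u) := by
    rw [hM, add_mulVec, dotProduct_add, ← dotProduct_transpose_mulVec']
    simp [Matrix.mul_assoc]
  rw [h2, h3, h4, dotProduct_comm (M⁻¹ *ᵥ b) b]
  ring

theorem quad_dare_le (A : Matrix (Fin n) (Fin n) ℝ) (B : Matrix (Fin n) (Fin m) ℝ)
    (W : Matrix (Fin n) (Fin n) ℝ) (hU : U.PosDef) {X : Matrix (Fin n) (Fin n) ℝ}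
    (hX : X.PosSemidef) (x : Fin n → ℝ) (u : Fin m → ℝ) :
    x ⬝ᵥ (dare A B W U X *ᵥ x) ≤
      (A *ᵥ x + B *ᵥ u) ⬝ᵥ (X *ᵥ (A *ᵥ x + B *ᵥ u)) + x ⬝ᵥ (W *ᵥ x) + u ⬝ᵥ (U *ᵥ u) := by
  rw [complete_square A B W hU hX]
  exact le_add_of_nonneg_right (PosSemidef.quad_nonneg (posDef_congr_add B hU hX).posSemidef _)

theorem quad_dare_eq (A : Matrix (Fin n) (Fin n) ℝ) (B : Matrix (Fin n) (Fin m) ℝ)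
    (W : Matrix (Fin n) (Fin n) ℝ) (hU : U.PosDef) {X : Matrix (Fin n) (Fin n) ℝ}
    (hX : X.PosSemidef) (x : Fin n → ℝ) :
    (A *ᵥ x + B *ᵥ (dareGain A B U X *ᵥ x)) ⬝ᵥ (X *ᵥ (A *ᵥ x + B *ᵥ (dareGain A B U X *ᵥ x)))
      + x ⬝ᵥ (W *ᵥ x) + (dareGain A B U X *ᵥ x) ⬝ᵥ (U *ᵥ (dareGain A B U X *ᵥ x)) =
      x ⬝ᵥ (dare A B W U X *ᵥ x) := by
  rw [complete_square A B W hU hX]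
  simp

/-- The form of `dare X` is the one-step cost at the minimizing input, a sum of three nonnegative
terms. -/
theorem dare_posSemidef (A : Matrix (Fin n) (Fin n) ℝ) (B : Matrix (Fin n) (Fin m) ℝ)
    (hW : W.PosSemidef) (hU : U.PosDef) {X : Matrix (Fin n) (Fin n) ℝ}
    (hX : X.PosSemidef) : (dare A B W U X).PosSemidef := by
  have hXs := PosSemidef.transpose_eq hX
  have hWs := PosSemidef.transpose_eq hW
  have hMs := PosSemidef.transpose_eq (posDef_congr_add B hU hX).posSemidef
  refine posSemidef_of_quad_nonneg ?_ fun x => ?_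
  · simp only [dare, transpose_sub, transpose_add, transpose_mul, transpose_transpose, hXs, hWs,
      transpose_nonsing_inv, Matrix.mul_assoc, PosSemidef.transpose_eq hU.posSemidef]
  · rw [← quad_dare_eq A B W hU hX]
    have h1 := PosSemidef.quad_nonneg hX (A *ᵥ x + B *ᵥ (dareGain A B U X *ᵥ x))
    have h2 := PosSemidef.quad_nonneg hW x
    have h3 := PosSemidef.quad_nonneg hU.posSemidef (dareGain A B U X *ᵥ x)
    positivity

theorem dare_iterate_posSemidef (A : Matrix (Fin n) (Fin n) ℝ) (B : Matrix (Fin n) (Fin m) ℝ)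
    (hW : W.PosSemidef) (hU : U.PosDef) {X : Matrix (Fin n) (Fin n) ℝ}
    (hX : X.PosSemidef) (k : ℕ) : ((dare A B W U)^[k] X).PosSemidef := by
  induction k with
  | zero => exact hX
  | succ k ih => rw [Function.iterate_succ_apply']; exact dare_posSemidef A B hW hU ih

/-- A minimum of costs that increase with `X`: the minimizer for `Y` is used as a competitor for
`X`. -/
theorem quad_dare_mono (A : Matrix (Fin n) (Fin n) ℝ) (B : Matrix (Fin n) (Fin m) ℝ)
    (W : Matrix (Fin n) (Fin n) ℝ) (hU : U.PosDef) {X Y : Matrix (Fin n) (Fin n) ℝ}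
    (hX : X.PosSemidef) (hY : Y.PosSemidef)
    (h : ∀ x : Fin n → ℝ, x ⬝ᵥ (X *ᵥ x) ≤ x ⬝ᵥ (Y *ᵥ x)) (x : Fin n → ℝ) :
    x ⬝ᵥ (dare A B W U X *ᵥ x) ≤ x ⬝ᵥ (dare A B W U Y *ᵥ x) := by
  rw [← quad_dare_eq A B W hU hY]
  have h1 := quad_dare_le A B W hU hX x (dareGain A B U Y *ᵥ x)
  have h2 := h (A *ᵥ x + B *ᵥ (dareGain A B U Y *ᵥ x))
  linarith

theorem quad_dare_iterate_mono (A : Matrix (Fin n) (Fin n) ℝ) (B : Matrix (Fin n) (Fin m) ℝ)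
    (hW : W.PosSemidef) (hU : U.PosDef) {X Y : Matrix (Fin n) (Fin n) ℝ}
    (hX : X.PosSemidef) (hY : Y.PosSemidef)
    (h : ∀ x : Fin n → ℝ, x ⬝ᵥ (X *ᵥ x) ≤ x ⬝ᵥ (Y *ᵥ x)) (k : ℕ) (x : Fin n → ℝ) :
    x ⬝ᵥ ((dare A B W U)^[k] X *ᵥ x) ≤ x ⬝ᵥ ((dare A B W U)^[k] Y *ᵥ x) := by
  induction k generalizing x with
  | zero => exact h x
  | succ k ih =>
    rw [Function.iterate_succ_apply', Function.iterate_succ_apply']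
    exact quad_dare_mono A B W hU (dare_iterate_posSemidef A B hW hU hX k)
      (dare_iterate_posSemidef A B hW hU hY k) ih x

/-- Dynamic programming: the `k`-th iterate is the optimal `k`-stage cost with terminal weight `X`,
so every trajectory bounds it from above. The induction peels off the first stage and shifts the
trajectory. -/
theorem quad_dare_iterate_le (hW : W.PosSemidef) (hU : U.PosDef) {X : Matrix (Fin n) (Fin n) ℝ}
    (hX : X.PosSemidef) (k : ℕ) {x : ℕ → Fin n → ℝ} {u : ℕ → Fin m → ℝ}
    (hx : ∀ j, x (j + 1) = A *ᵥ x j + B *ᵥ u j) :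
    x 0 ⬝ᵥ ((dare A B W U)^[k] X *ᵥ x 0) ≤
      ∑ j ∈ Finset.range k, (x j ⬝ᵥ (W *ᵥ x j) + u j ⬝ᵥ (U *ᵥ u j)) + x k ⬝ᵥ (X *ᵥ x k) := by
  induction k generalizing x u with
  | zero => simp
  | succ k ih =>
    rw [Function.iterate_succ_apply', Finset.sum_range_succ']
    have h1 := quad_dare_le A B W hU (dare_iterate_posSemidef A B hW hU hX k) (x 0) (u 0)
    have h2 := ih (x := fun j => x (j + 1)) (u := fun j => u (j + 1)) fun j => hx (j + 1)
    simp only [zero_add] at h2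
    rw [← hx 0] at h1
    linarith

theorem tendsto_matrix_inv {ι : Type*} {l : Filter ι} {M : ι → Matrix (Fin m) (Fin m) ℝ}
    {N : Matrix (Fin m) (Fin m) ℝ} (hN : IsUnit N) (h : Tendsto M l (𝓝 N)) :
    Tendsto (fun i => (M i)⁻¹) l (𝓝 N⁻¹) := by
  simp only [Matrix.inv_def, Ring.inverse_eq_inv']
  have hd : Tendsto (fun i => (M i).det) l (𝓝 N.det) :=
    ((continuous_id.matrix_det).tendsto N).comp h
  have ha : Tendsto (fun i => (M i).adjugate) l (𝓝 N.adjugate) :=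
    ((continuous_id.matrix_adjugate).tendsto N).comp h
  exact (hd.inv₀ (((isUnit_iff_isUnit_det _).1 hN).ne_zero)).smul ha

theorem tendsto_matrix_mul {ι : Type*} {l : Filter ι} {a b c : ℕ}
    {M : ι → Matrix (Fin a) (Fin b) ℝ} {N : ι → Matrix (Fin b) (Fin c) ℝ}
    {M' : Matrix (Fin a) (Fin b) ℝ} {N' : Matrix (Fin b) (Fin c) ℝ}
    (hM : Tendsto M l (𝓝 M')) (hN : Tendsto N l (𝓝 N')) :
    Tendsto (fun i => M i * N i) l (𝓝 (M' * N')) :=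
  ((continuous_fst.matrix_mul continuous_snd).tendsto (M', N')).comp (hM.prodMk_nhds hN)

theorem tendsto_dare (A : Matrix (Fin n) (Fin n) ℝ) (B : Matrix (Fin n) (Fin m) ℝ)
    (W : Matrix (Fin n) (Fin n) ℝ) (hU : U.PosDef) {X : ℕ → Matrix (Fin n) (Fin n) ℝ}
    {S : Matrix (Fin n) (Fin n) ℝ} (hS : S.PosSemidef) (h : Tendsto X atTop (𝓝 S)) :
    Tendsto (fun k => dare A B W U (X k)) atTop (𝓝 (dare A B W U S)) := by
  have hc {a b : ℕ} (M : Matrix (Fin a) (Fin b) ℝ) : Tendsto (fun _ : ℕ => M) atTop (𝓝 M) :=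
    tendsto_const_nhds
  have hM : Tendsto (fun k => (Bᵀ * X k * B + U)⁻¹) atTop (𝓝 (Bᵀ * S * B + U)⁻¹) :=
    tendsto_matrix_inv (posDef_congr_add B hU hS).isUnit
      ((tendsto_matrix_mul (tendsto_matrix_mul (hc _) h) (hc _)).add_const U)
  have h1 := tendsto_matrix_mul (hc Aᵀ) h
  exact ((tendsto_matrix_mul h1 (hc A)).add_const W).sub
    (tendsto_matrix_mul (tendsto_matrix_mul (tendsto_matrix_mul (tendsto_matrix_mul
      (tendsto_matrix_mul h1 (hc B)) hM) (hc Bᵀ)) h) (hc A))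

end Dare


/-! ### Schur stable matrices -/

section Schur

variable {n : ℕ}

section Norm

attribute [local instance] Matrix.linftyOpNormedRing Matrix.linftyOpNormedAlgebra

/-- Gelfand's formula over `ℂ` gives geometric decay of the powers at any rate above the spectral
radius. -/
theorem SchurStable.exists_norm_pow_le {M : Matrix (Fin n) (Fin n) ℝ} (hM : SchurStable M) :
    ∃ c r : ℝ, 0 ≤ c ∧ 0 < r ∧ r < 1 ∧
      ∀ (k : ℕ) (v : Fin n → ℝ), ‖(M ^ k) *ᵥ v‖ ≤ c * r ^ k * ‖v‖ := by
  rcases Nat.eq_zero_or_pos n with rfl | hn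
  · refine ⟨0, 1 / 2, le_rfl, by norm_num, by norm_num, fun k v => ?_⟩
    simp [Subsingleton.elim ((M ^ k) *ᵥ v) 0]
  have : Nonempty (Fin n) := ⟨⟨0, hn⟩⟩
  have : CompleteSpace (Matrix (Fin n) (Fin n) ℂ) := FiniteDimensional.complete ℂ _
  set a : Matrix (Fin n) (Fin n) ℂ := M.map (algebraMap ℝ ℂ) with ha
  have hρ : spectralRadius ℂ a < (1 : NNReal) :=
    spectrum.spectralRadius_lt_of_forall_lt a fun z hz => hM z hz
  obtain ⟨r, hr1, hr2⟩ := ENNReal.lt_iff_exists_nnreal_btwn.1 hρ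
  have hr0 : 0 < r := by
    have := (zero_le (a := spectralRadius ℂ a)).trans_lt hr1
    exact_mod_cast this
  have hev : ∀ᶠ k : ℕ in atTop, ‖a ^ k‖ ≤ (r : ℝ) ^ k := by
    filter_upwards [(spectrum.pow_nnnorm_pow_one_div_tendsto_nhds_spectralRadius a).eventually_lt_const
      hr1, eventually_gt_atTop 0] with k hk hk0
    have h1 : ((‖a ^ k‖₊ : ℝ≥0∞) ^ (1 / k : ℝ)) ^ (k : ℝ) ≤ (r : ℝ≥0∞) ^ (k : ℝ) :=
      ENNReal.rpow_le_rpow hk.le (by positivity)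
    rw [← ENNReal.rpow_mul, one_div_mul_cancel (by positivity), ENNReal.rpow_one,
      ENNReal.rpow_natCast] at h1
    exact_mod_cast h1
  -- The decay estimate holds only for large powers; the finitely many others are absorbed in the
  -- constant `c`.
  have hO : (fun k : ℕ => a ^ k) =O[atTop] fun k : ℕ => (r : ℝ) ^ k :=
    Asymptotics.IsBigO.of_bound 1 (by
      filter_upwards [hev] with k hk
      simpa using hk)
  obtain ⟨c, hc0, hc⟩ := Asymptotics.bound_of_isBigO_nat_atTop hO
  refine ⟨c, r, hc0.le, hr0, by exact_mod_cast hr2, fun k v => ?_⟩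
  have h1 := hc (x := k) (by positivity)
  -- The row-sum norm depends only on absolute values of entries, so complexification preserves it.
  have h2 : ‖a ^ k‖ = ‖M ^ k‖ := by
    rw [ha, ← RingHom.mapMatrix_apply, ← map_pow, RingHom.mapMatrix_apply]
    simp [linfty_opNorm_def]
  rw [h2] at h1
  calc ‖(M ^ k) *ᵥ v‖ ≤ ‖M ^ k‖ * ‖v‖ := linfty_opNorm_mulVec _ _
    _ ≤ c * r ^ k * ‖v‖ := by
      gcongr
      simpa using h1

end Norm

theorem SchurStable.transpose {M : Matrix (Fin n) (Fin n) ℝ} (hM : SchurStable M) :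
    SchurStable Mᵀ := by
  intro z hz
  refine hM z ?_
  rw [spectrum.mem_iff] at hz ⊢
  rw [← Matrix.isUnit_transpose]
  convert hz using 2
  rw [transpose_sub, transpose_map]
  congr 1
  simp [Algebra.algebraMap_eq_smul_one]

theorem eq_pow_mulVec_add_sum {M : Matrix (Fin n) (Fin n) ℝ} {x d : ℕ → Fin n → ℝ}
    (hx : ∀ k, x (k + 1) = M *ᵥ x k + d k) (k : ℕ) :
    x k = (M ^ k) *ᵥ x 0 + ∑ j ∈ Finset.range k, (M ^ j) *ᵥ d (k - 1 - j) := by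
  induction k with
  | zero => simp
  | succ k ih =>
    rw [hx, ih, Finset.sum_range_succ', mulVec_add, mulVec_mulVec, ← pow_succ', mulVec_sum]
    simp only [mulVec_mulVec, ← pow_succ', pow_zero, one_mulVec, add_assoc]
    have h (j : ℕ) : k - 1 - j = k - (j + 1) := by omega
    simp only [Nat.sub_zero, Nat.add_sub_cancel]
    congr 2
    exact Finset.sum_congr rfl fun j _ => by rw [h]

/-- Variation of constants: the initial term decays geometrically, and the convolution of a summable
kernel with a null sequence tends to zero by dominated convergence for series. -/
theorem SchurStable.tendsto_zero {M : Matrix (Fin n) (Fin n) ℝ} (hM : SchurStable M)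
    {x d : ℕ → Fin n → ℝ} (hx : ∀ k, x (k + 1) = M *ᵥ x k + d k)
    (hd : Tendsto d atTop (𝓝 0)) : Tendsto x atTop (𝓝 0) := by
  obtain ⟨c, r, hc, hr0, hr1, hM⟩ := hM.exists_norm_pow_le
  obtain ⟨D, hD⟩ := hd.norm.bddAbove_range
  have hD' : ∀ k, ‖d k‖ ≤ D := fun k => hD ⟨k, rfl⟩
  have hpow : Tendsto (fun k : ℕ => c * r ^ k) atTop (𝓝 0) := by
    simpa using (tendsto_pow_atTop_nhds_zero_of_lt_one hr0.le hr1).const_mul c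
  have h1 : Tendsto (fun k => (M ^ k) *ᵥ x 0) atTop (𝓝 0) :=
    squeeze_zero_norm (fun k => hM k _) (by simpa using hpow.mul_const ‖x 0‖)
  have h2 : Tendsto (fun k => ∑' j, (if j < k then (M ^ j) *ᵥ d (k - 1 - j) else 0)) atTop
      (𝓝 (∑' _ : ℕ, (0 : Fin n → ℝ))) := by
    refine tendsto_tsum_of_dominated_convergence (bound := fun j => c * r ^ j * D) ?_ ?_ ?_
    · exact ((summable_geometric_of_lt_one hr0.le hr1).mul_left c).mul_right D
    · intro j
      have h3 : Tendsto (fun k => (M ^ j) *ᵥ d (k - 1 - j)) atTop (𝓝 0) := by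
        have h4 : Tendsto (fun k => d (k - 1 - j)) atTop (𝓝 0) :=
          hd.comp ((tendsto_sub_atTop_nat j).comp (tendsto_sub_atTop_nat 1))
        have h5 : Continuous fun v : Fin n → ℝ => (M ^ j) *ᵥ v := by fun_prop
        exact (h5.tendsto' 0 0 (by simp)).comp h4
      refine h3.congr' ?_
      filter_upwards [eventually_gt_atTop j] with k hk
      rw [if_pos hk]
    · refine Eventually.of_forall fun k j => ?_
      have hD0 : 0 ≤ D := (norm_nonneg _).trans (hD' 0)
      split_ifs
      · exact (hM j _).trans (by gcongr; exact hD' _)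
      · rw [norm_zero]; positivity
  rw [tsum_zero] at h2
  have h3 := h1.add h2
  rw [add_zero] at h3
  refine h3.congr fun k => ?_
  rw [eq_pow_mulVec_add_sum hx k]
  congr 1
  rw [tsum_eq_sum (s := Finset.range k) fun j hj => if_neg (by simpa using hj)]
  exact Finset.sum_congr rfl fun j hj => if_pos (by simpa using hj)

end Schur

/-! ### Convergence of the Riccati iteration -/

section Convergence

variable {n m : ℕ} {A : Matrix (Fin n) (Fin n) ℝ} {B : Matrix (Fin n) (Fin m) ℝ}
  {W : Matrix (Fin n) (Fin n) ℝ} {U : Matrix (Fin m) (Fin m) ℝ}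

/-- Every initial state has a controlled trajectory whose accumulated cost stays bounded. -/
def FiniteCost (A : Matrix (Fin n) (Fin n) ℝ) (B : Matrix (Fin n) (Fin m) ℝ)
    (W : Matrix (Fin n) (Fin n) ℝ) (U : Matrix (Fin m) (Fin m) ℝ) : Prop :=
  ∀ z : Fin n → ℝ, ∃ (x : ℕ → Fin n → ℝ) (u : ℕ → Fin m → ℝ) (c : ℝ), x 0 = z ∧
    (∀ k, x (k + 1) = A *ᵥ x k + B *ᵥ u k) ∧
    ∀ k, ∑ j ∈ Finset.range k, (x j ⬝ᵥ (W *ᵥ x j) + u j ⬝ᵥ (U *ᵥ u j)) ≤ c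

/-- Trajectories with vanishing disturbance and vanishing state cost vanish asymptotically. -/
def AsymptoticallyDetectable (A W : Matrix (Fin n) (Fin n) ℝ) : Prop :=
  ∀ x d : ℕ → Fin n → ℝ, (∀ k, x (k + 1) = A *ᵥ x k + d k) → Tendsto d atTop (𝓝 0) →
    Tendsto (fun k => x k ⬝ᵥ (W *ᵥ x k)) atTop (𝓝 0) → Tendsto x atTop (𝓝 0)

/-- Since `0 ≤ dare 0`, monotonicity of `dare` makes the orbit of `0` increasing; finite-cost
trajectories bound it, and continuity makes the limit a fixed point. -/
theorem exists_tendsto_dare_iterate_zero (hW : W.PosSemidef) (hU : U.PosDef)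
    (h : FiniteCost A B W U) :
    ∃ S : Matrix (Fin n) (Fin n) ℝ, S.PosSemidef ∧
      Tendsto (fun k => (dare A B W U)^[k] 0) atTop (𝓝 S) ∧ S = dare A B W U S ∧
      ∀ k (x : Fin n → ℝ), x ⬝ᵥ ((dare A B W U)^[k] 0 *ᵥ x) ≤ x ⬝ᵥ (S *ᵥ x) := by
  have h0 : (0 : Matrix (Fin n) (Fin n) ℝ).PosSemidef := .zero
  have hmono : ∀ x : Fin n → ℝ, Monotone fun k => x ⬝ᵥ ((dare A B W U)^[k] 0 *ᵥ x) := by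
    refine fun x => monotone_nat_of_le_succ fun k => ?_
    rw [Function.iterate_succ_apply]
    refine quad_dare_iterate_mono A B hW hU h0 (dare_posSemidef A B hW hU h0) (fun y => ?_) k x
    simpa using PosSemidef.quad_nonneg (dare_posSemidef A B hW hU h0) y
  obtain ⟨S, hS, hlim⟩ := exists_tendsto_of_quad_monotone
    (dare_iterate_posSemidef A B hW hU h0) hmono (fun z => by
      obtain ⟨x, u, c, hx0, hx, hc⟩ := h z
      refine ⟨c, fun k => ?_⟩
      have := quad_dare_iterate_le hW hU h0 k hx
      rw [hx0] at this
      simpa using this.trans (by simpa using hc k))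
  refine ⟨S, hS, hlim, ?_, fun k x => ?_⟩
  · refine tendsto_nhds_unique ((tendsto_add_atTop_iff_nat 1).2 hlim) ?_
    simp_rw [Function.iterate_succ_apply']
    exact tendsto_dare A B W hU hS hlim
  · have hc : Continuous fun Y : Matrix (Fin n) (Fin n) ℝ => x ⬝ᵥ (Y *ᵥ x) := by fun_prop
    exact (hmono x).ge_of_tendsto ((hc.tendsto S).comp hlim) k

theorem exists_pos_mul_le_quad (hU : U.PosDef) :
    ∃ c : ℝ, 0 < c ∧ ∀ u : Fin m → ℝ, c * (u ⬝ᵥ u) ≤ u ⬝ᵥ (U *ᵥ u) := by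
  have hcont : Continuous fun u : Fin m → ℝ => u ⬝ᵥ (U *ᵥ u) := by fun_prop
  rcases (Metric.sphere (0 : Fin m → ℝ) 1).eq_empty_or_nonempty with he | hne
  · refine ⟨1, one_pos, fun u => ?_⟩
    have hu : u = 0 := by
      by_contra hu
      have : ‖u‖⁻¹ • u ∈ Metric.sphere (0 : Fin m → ℝ) 1 := by
        simp [norm_smul, inv_mul_cancel₀ (norm_ne_zero_iff.2 hu)]
      simp [he] at this
    simp [hu]
  obtain ⟨v, hv, hmin⟩ := (isCompact_sphere (0 : Fin m → ℝ) 1).exists_isMinOn hne hcont.continuousOn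
  have hv0 : v ≠ 0 := by
    rintro rfl
    simp at hv
  have hpos : 0 < v ⬝ᵥ (U *ᵥ v) := by simpa using hU.dotProduct_mulVec_pos hv0
  -- The minimum is over the sup-norm sphere. The factor `m + 1` compares the Euclidean square with
  -- the square of the sup norm and is positive without a case distinction.
  refine ⟨v ⬝ᵥ (U *ᵥ v) / (m + 1), by positivity, fun u => ?_⟩
  by_cases hu : u = 0
  · simp [hu]
  have hn : 0 < ‖u‖ := norm_pos_iff.2 hu
  have hm := hmin (a := ‖u‖⁻¹ • u) (by simp [norm_smul, inv_mul_cancel₀ hn.ne'])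
  simp only [Set.mem_ofPred_eq, mulVec_smul, smul_dotProduct, dotProduct_smul, smul_eq_mul] at hm
  have h1 : u ⬝ᵥ u ≤ (m + 1) * ‖u‖ ^ 2 := by
    calc u ⬝ᵥ u ≤ ∑ _i : Fin m, ‖u‖ ^ 2 := Finset.sum_le_sum fun i _ => by
          rw [← pow_two, ← sq_abs]
          exact pow_le_pow_left₀ (abs_nonneg _) (norm_le_pi_norm u i) 2
      _ ≤ _ := by simp; nlinarith [sq_nonneg ‖u‖]
  have h2 : v ⬝ᵥ (U *ᵥ v) * ‖u‖ ^ 2 ≤ u ⬝ᵥ (U *ᵥ u) := by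
    have := mul_le_mul_of_nonneg_right hm (sq_nonneg ‖u‖)
    refine this.trans_eq ?_
    field_simp
  calc v ⬝ᵥ (U *ᵥ v) / (m + 1) * (u ⬝ᵥ u) ≤ v ⬝ᵥ (U *ᵥ v) / (m + 1) * ((m + 1) * ‖u‖ ^ 2) := by
        gcongr
    _ = v ⬝ᵥ (U *ᵥ v) * ‖u‖ ^ 2 := by field_simp
    _ ≤ _ := h2

theorem tendsto_zero_of_tendsto_quad (hU : U.PosDef) {u : ℕ → Fin m → ℝ}
    (h : Tendsto (fun k => u k ⬝ᵥ (U *ᵥ u k)) atTop (𝓝 0)) : Tendsto u atTop (𝓝 0) := by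
  obtain ⟨c, hc, hcu⟩ := exists_pos_mul_le_quad hU
  refine tendsto_zero_of_tendsto_dotProduct_self
    (squeeze_zero (fun k => Finset.sum_nonneg fun i _ => mul_self_nonneg _) (fun k => ?_)
      (by simpa using h.const_mul c⁻¹))
  rw [le_inv_mul_iff₀ hc]
  exact hcu _

/-- The orbit of `X` is squeezed between the orbit of `0` and the cost of playing, with terminal
weight `X`, the feedback that is optimal for `S`. The latter is `z'Sz` up to terminal terms, which
vanish once the closed-loop state tends to zero. -/
theorem tendsto_dare_iterate (hW : W.PosSemidef) (hU : U.PosDef)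
    (hdet : AsymptoticallyDetectable A W) {S : Matrix (Fin n) (Fin n) ℝ} (hS : S.PosSemidef)
    (hlim : Tendsto (fun k => (dare A B W U)^[k] 0) atTop (𝓝 S)) (hfix : S = dare A B W U S)
    {X : Matrix (Fin n) (Fin n) ℝ} (hX : X.PosSemidef) :
    Tendsto (fun k => (dare A B W U)^[k] X) atTop (𝓝 S) := by
  have h0 : (0 : Matrix (Fin n) (Fin n) ℝ).PosSemidef := .zero
  refine tendsto_of_tendsto_quad
    (fun k => PosSemidef.transpose_eq (dare_iterate_posSemidef A B hW hU hX k))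
    (PosSemidef.transpose_eq hS) fun z => ?_
  set L := dareGain A B U S
  let x : ℕ → Fin n → ℝ := fun k => ((A + B * L) ^ k) *ᵥ z
  have hx : ∀ k, x (k + 1) = A *ᵥ x k + B *ᵥ (L *ᵥ x k) := fun k => by
    simp only [x, pow_succ', ← mulVec_mulVec, add_mulVec]
  -- Because `S` is a fixed point, the stage cost along the closed loop telescopes. Hence stage
  -- costs tend to zero, so do the inputs since `U > 0`, and detectability with disturbance `B u`
  -- then gives the state.
  have hstep : ∀ k, x k ⬝ᵥ (W *ᵥ x k) + (L *ᵥ x k) ⬝ᵥ (U *ᵥ (L *ᵥ x k)) =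
      x k ⬝ᵥ (S *ᵥ x k) - x (k + 1) ⬝ᵥ (S *ᵥ x (k + 1)) := fun k => by
    have := quad_dare_eq A B W hU hS (x k)
    rw [← hfix, ← hx k] at this
    linarith
  have hWn := fun k => PosSemidef.quad_nonneg hW (x k)
  have hUn := fun k => PosSemidef.quad_nonneg hU.posSemidef (L *ᵥ x k)
  have hanti : Antitone fun k => x k ⬝ᵥ (S *ᵥ x k) :=
    antitone_nat_of_succ_le fun k => by linarith [hstep k, hWn k, hUn k]
  have hconv := tendsto_atTop_ciInf hanti
    ⟨0, by rintro _ ⟨k, rfl⟩; exact PosSemidef.quad_nonneg hS (x k)⟩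
  have hdiff : Tendsto (fun k => x k ⬝ᵥ (W *ᵥ x k) + (L *ᵥ x k) ⬝ᵥ (U *ᵥ (L *ᵥ x k))) atTop
      (𝓝 0) := by
    simp_rw [hstep]
    simpa using hconv.sub ((tendsto_add_atTop_iff_nat 1).2 hconv)
  have hu : Tendsto (fun k => L *ᵥ x k) atTop (𝓝 0) := tendsto_zero_of_tendsto_quad hU
    (squeeze_zero hUn (fun k => le_add_of_nonneg_left (hWn k)) hdiff)
  have hx0 : Tendsto x atTop (𝓝 0) := by
    refine hdet x (fun k => B *ᵥ (L *ᵥ x k)) hx ?_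
      (squeeze_zero hWn (fun k => le_add_of_nonneg_right (hUn k)) hdiff)
    have hc : Continuous fun v : Fin m → ℝ => B *ᵥ v := by fun_prop
    exact (hc.tendsto' 0 0 (by simp)).comp hu
  have hq : ∀ Y : Matrix (Fin n) (Fin n) ℝ, Tendsto (fun k => x k ⬝ᵥ (Y *ᵥ x k)) atTop (𝓝 0) :=
    fun Y => by
      have hc : Continuous fun v : Fin n → ℝ => v ⬝ᵥ (Y *ᵥ v) := by fun_prop
      exact (hc.tendsto' 0 0 (by simp)).comp hx0
  have hz : x 0 = z := by simp [x]
  have hcz : Continuous fun Y : Matrix (Fin n) (Fin n) ℝ => z ⬝ᵥ (Y *ᵥ z) := by fun_prop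
  refine tendsto_of_tendsto_of_tendsto_of_le_of_le ((hcz.tendsto S).comp hlim)
    (h := fun k => z ⬝ᵥ (S *ᵥ z) - x k ⬝ᵥ (S *ᵥ x k) + x k ⬝ᵥ (X *ᵥ x k)) ?_ (fun k => ?_)
    (fun k => ?_)
  · simpa using (tendsto_const_nhds.sub (hq S)).add (hq X)
  · exact quad_dare_iterate_mono A B hW hU h0 hX
      (fun y => by simpa using PosSemidef.quad_nonneg hX y) k z
  · have := quad_dare_iterate_le hW hU hX k hx
    simp_rw [hstep] at this
    rwa [Finset.sum_range_sub', hz] at this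

end Convergence

/-! ### Verification of the convergence conditions -/

section Conditions

variable {n m : ℕ} {A : Matrix (Fin n) (Fin n) ℝ} {B : Matrix (Fin n) (Fin m) ℝ}

/-- Every state can be steered to the origin in `n` steps and kept there with zero input. -/
theorem Controllable.finiteCost (h : Controllable A B) (W : Matrix (Fin n) (Fin n) ℝ)
    (U : Matrix (Fin m) (Fin m) ℝ) : FiniteCost A B W U := by
  intro z
  have hsurj : Function.Surjective (controllabilityMatrix A B).mulVec := by
    have h1 : LinearMap.range (controllabilityMatrix A B).mulVecLin = ⊤ := by
      apply Submodule.eq_top_of_finrank_eq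
      rw [← Matrix.rank, h]
      simp
    exact LinearMap.range_eq_top.1 h1
  obtain ⟨c, hc⟩ := hsurj (-((A ^ n) *ᵥ z))
  -- The block `A^j B` of the controllability matrix multiplies the input applied at time `n - 1 -
  -- j`, so the coefficients are read in reverse order.
  let u : ℕ → Fin m → ℝ := fun k => if hk : k < n then fun j => c (⟨n - 1 - k, by omega⟩, j) else 0
  let x : ℕ → Fin n → ℝ := fun k => Nat.rec z (fun k y => A *ᵥ y + B *ᵥ u k) k
  have hx : ∀ k, x (k + 1) = A *ᵥ x k + B *ᵥ u k := fun k => rfl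
  have hn : x n = 0 := by
    rw [eq_pow_mulVec_add_sum hx n]
    have h2 : (controllabilityMatrix A B) *ᵥ c =
        ∑ j ∈ Finset.range n, (A ^ j) *ᵥ (B *ᵥ u (n - 1 - j)) := by
      rw [Finset.sum_range]
      ext i
      simp only [mulVec, dotProduct, Fintype.sum_prod_type, Finset.sum_apply]
      refine Finset.sum_congr rfl fun k _ => ?_
      have h3 : (A ^ (k : ℕ)) *ᵥ (B *ᵥ u (n - 1 - k)) = (A ^ (k : ℕ) * B) *ᵥ u (n - 1 - k) := by
        rw [mulVec_mulVec]
      have h4 := congrFun h3 i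
      simp only [mulVec, dotProduct] at h4
      rw [h4]
      refine Finset.sum_congr rfl fun j _ => ?_
      have hk : n - 1 - (k : ℕ) < n := by omega
      simp only [controllabilityMatrix, of_apply, u, dif_pos hk]
      congr 3
      ext
      simp
      omega
    rw [← h2, hc]
    simp [x]
  have hzero : ∀ k, n ≤ k → x k = 0 := by
    intro k hk
    induction k, hk using Nat.le_induction with
    | base => exact hn
    | succ k hk ih => rw [hx, ih]; simp [u, hk.not_gt]
  -- Absolute values make the bound valid for partial sums too, as no sign of `W` or `U` is assumed
  -- here.
  refine ⟨x, u, ∑ j ∈ Finset.range n, |x j ⬝ᵥ (W *ᵥ x j) + u j ⬝ᵥ (U *ᵥ u j)|, rfl, hx, fun k => ?_⟩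
  refine (Finset.sum_le_sum fun j _ => le_abs_self _).trans ?_
  rcases le_total k n with hk | hk
  · exact Finset.sum_le_sum_of_subset_of_nonneg (Finset.range_mono hk) fun _ _ _ => abs_nonneg _
  · refine (Finset.sum_subset (Finset.range_mono hk) fun j _ hj => ?_).ge
    have hj : n ≤ j := by simpa using hj
    simp [hzero j hj, u, hj.not_gt]

theorem abs_quad_le (X : Matrix (Fin n) (Fin n) ℝ) (x : Fin n → ℝ) :
    |x ⬝ᵥ (X *ᵥ x)| ≤ (∑ i, ∑ j, |X i j|) * ‖x‖ ^ 2 := by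
  simp only [mulVec, dotProduct, Finset.mul_sum, Finset.sum_mul]
  refine (Finset.abs_sum_le_sum_abs _ _).trans (Finset.sum_le_sum fun i _ => ?_)
  refine (Finset.abs_sum_le_sum_abs _ _).trans (Finset.sum_le_sum fun j _ => ?_)
  rw [abs_mul, abs_mul]
  calc |x i| * (|X i j| * |x j|) ≤ ‖x‖ * (|X i j| * ‖x‖) := by
        gcongr <;> exact norm_le_pi_norm x _
    _ = _ := by ring

/-- Under the feedback `L` the state decays geometrically, so its quadratic cost is dominated by a
convergent geometric series. -/
theorem SchurStable.finiteCost {L : Matrix (Fin m) (Fin n) ℝ} (h : SchurStable (A + B * L))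
    (W : Matrix (Fin n) (Fin n) ℝ) (U : Matrix (Fin m) (Fin m) ℝ) : FiniteCost A B W U := by
  intro z
  obtain ⟨c, r, hc, hr0, hr1, hM⟩ := h.exists_norm_pow_le
  set Y := W + Lᵀ * U * L
  set K := ∑ i, ∑ j, |Y i j|
  let x : ℕ → Fin n → ℝ := fun k => ((A + B * L) ^ k) *ᵥ z
  have hK : 0 ≤ K := Finset.sum_nonneg fun i _ => Finset.sum_nonneg fun j _ => abs_nonneg _
  have hr2 : r ^ 2 < 1 := by nlinarith
  have hsum : Summable fun k : ℕ => K * (c * ‖z‖) ^ 2 * (r ^ 2) ^ k :=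
    (summable_geometric_of_lt_one (by positivity) hr2).mul_left _
  refine ⟨x, fun k => L *ᵥ x k, ∑' k : ℕ, K * (c * ‖z‖) ^ 2 * (r ^ 2) ^ k, by simp [x],
    fun k => by simp only [x, pow_succ', ← mulVec_mulVec, add_mulVec], fun k => ?_⟩
  refine le_trans (Finset.sum_le_sum fun j _ => ?_)
    (hsum.sum_le_tsum (Finset.range k) fun j _ => by positivity)
  have h1 : x j ⬝ᵥ (W *ᵥ x j) + (L *ᵥ x j) ⬝ᵥ (U *ᵥ (L *ᵥ x j)) = x j ⬝ᵥ (Y *ᵥ x j) := by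
    rw [add_mulVec, dotProduct_add, ← dotProduct_transpose_mulVec' L]
    simp only [mulVec_mulVec, Matrix.mul_assoc]
  rw [h1]
  refine (le_abs_self _).trans ((abs_quad_le _ _).trans ?_)
  calc K * ‖x j‖ ^ 2 ≤ K * (c * r ^ j * ‖z‖) ^ 2 := by gcongr; exact hM j z
    _ = _ := by ring

theorem Detectable.finiteCost {q : ℕ} {C : Matrix (Fin q) (Fin n) ℝ} (h : Detectable C A)
    (W : Matrix (Fin n) (Fin n) ℝ) (U : Matrix (Fin q) (Fin q) ℝ) : FiniteCost Aᵀ Cᵀ W U := by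
  obtain ⟨K, hK⟩ := h
  refine SchurStable.finiteCost (L := Kᵀ) ?_ W U
  simpa [transpose_add, transpose_mul] using hK.transpose

open scoped MatrixOrder in
theorem psdSqrt_transpose_mul_self {Q : Matrix (Fin n) (Fin n) ℝ} (hQ : Q.PosSemidef) :
    (psdSqrt Q)ᵀ * psdSqrt Q = Q := by
  have h1 : (psdSqrt Q)ᵀ = psdSqrt Q :=
    PosSemidef.transpose_eq (nonneg_iff_posSemidef.1 (CFC.sqrt_nonneg Q))
  rw [h1]
  exact CFC.sqrt_mul_sqrt_self Q (nonneg_iff_posSemidef.2 hQ)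

/-- The covariance accumulated by the noise in `k` steps. -/
def noiseGramian (A Q : Matrix (Fin n) (Fin n) ℝ) (k : ℕ) : Matrix (Fin n) (Fin n) ℝ :=
  ∑ i ∈ Finset.range k, A ^ i * Q * (A ^ i)ᵀ

theorem quad_noiseGramian (A Q : Matrix (Fin n) (Fin n) ℝ) (k : ℕ) (x : Fin n → ℝ) :
    x ⬝ᵥ (noiseGramian A Q k *ᵥ x) =
      ∑ i ∈ Finset.range k, ((Aᵀ ^ i) *ᵥ x) ⬝ᵥ (Q *ᵥ ((Aᵀ ^ i) *ᵥ x)) := by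
  rw [noiseGramian, sum_mulVec, dotProduct_sum]
  refine Finset.sum_congr rfl fun i _ => ?_
  rw [← dotProduct_transpose_mulVec']
  simp [Matrix.mul_assoc, transpose_pow]

theorem noiseGramian_posSemidef (A : Matrix (Fin n) (Fin n) ℝ) {Q : Matrix (Fin n) (Fin n) ℝ}
    (hQ : Q.PosSemidef) (k : ℕ) : (noiseGramian A Q k).PosSemidef := by
  refine Matrix.posSemidef_sum _ fun i _ => ?_
  simpa using hQ.mul_mul_conjTranspose_same (A ^ i)

/-- A `T`-step trajectory of `(A^T)ᵀ` is interpolated by a one-step trajectory of `Aᵀ`. The Gramian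
cost of a block is the sum of the squared `√Q`-outputs of its intermediate states, so these outputs
vanish. Output injection with the stabilizing `F` then turns the dynamics into a Schur stable one
with vanishing input. Stabilizability of `(A, √Q)` thus serves every `T`. -/
theorem Stabilizable.asymptoticallyDetectable {Q : Matrix (Fin n) (Fin n) ℝ} (hQ : Q.PosSemidef)
    (h : Stabilizable A (psdSqrt Q)) {T : ℕ} (hT : 0 < T) :
    AsymptoticallyDetectable (A ^ T)ᵀ (noiseGramian A Q T) := by
  obtain ⟨F, hF⟩ := h
  intro x d hx hd hcost
  have hF' := hF.transpose
  rw [transpose_add, transpose_mul] at hF'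
  let z : ℕ → Fin n → ℝ := fun j => (Aᵀ ^ (j % T)) *ᵥ x (j / T)
  -- The disturbance of a block enters only at the step that closes it.
  let e : ℕ → Fin n → ℝ := fun j => if (j + 1) % T = 0 then d (j / T) else 0
  have hz : ∀ j, z (j + 1) = Aᵀ *ᵥ z j + e j := by
    intro j
    have hj := Nat.div_add_mod j T
    have hlt := Nat.mod_lt j hT
    by_cases hc : j % T + 1 = T
    · have h1 : j + 1 = (j / T + 1) * T := by
        rw [add_mul, one_mul, mul_comm]
        omega
      have h2 : (j + 1) % T = 0 := by rw [h1, Nat.mul_mod_left]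
      have h3 : (j + 1) / T = j / T + 1 := by rw [h1, Nat.mul_div_cancel _ hT]
      simp only [z, e, h2, h3, if_true, pow_zero, one_mulVec, hx]
      rw [mulVec_mulVec, ← pow_succ', hc, transpose_pow]
    · have h2 : (j + 1) % T = j % T + 1 := by
        rw [Nat.add_mod, Nat.mod_eq_of_lt (a := 1) (by omega), Nat.mod_eq_of_lt (by omega)]
      have h3 : (j + 1) / T = j / T := by
        rw [Nat.succ_div, if_neg]
        · simp
        · rw [Nat.dvd_iff_mod_eq_zero, h2]
          omega
      simp only [z, e, h2, h3]
      rw [if_neg (by omega), add_zero, mulVec_mulVec, pow_succ']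
  have hdiv : Tendsto (fun j : ℕ => j / T) atTop atTop := Nat.tendsto_div_const_atTop hT.ne'
  have he : Tendsto e atTop (𝓝 0) := by
    refine squeeze_zero_norm (fun j => ?_) (by simpa using (hd.comp hdiv).norm)
    simp only [e]
    split_ifs
    · exact le_rfl
    · simp
  have hsz : Tendsto (fun j => psdSqrt Q *ᵥ z j) atTop (𝓝 0) := by
    refine tendsto_zero_of_tendsto_dotProduct_self
      (squeeze_zero (fun k => Finset.sum_nonneg fun i _ => mul_self_nonneg _) (fun j => ?_)
        (hcost.comp hdiv))
    rw [← dotProduct_transpose_mulVec', mulVec_mulVec, psdSqrt_transpose_mul_self hQ]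
    simp only [Function.comp_apply]
    rw [quad_noiseGramian]
    exact Finset.single_le_sum (f := fun i => ((Aᵀ ^ i) *ᵥ x (j / T)) ⬝ᵥ
      (Q *ᵥ ((Aᵀ ^ i) *ᵥ x (j / T)))) (fun i _ => PosSemidef.quad_nonneg hQ _)
      (Finset.mem_range.2 (Nat.mod_lt j hT))
  have hs : (psdSqrt Q)ᵀ = psdSqrt Q := by
    open scoped MatrixOrder in
    exact PosSemidef.transpose_eq (nonneg_iff_posSemidef.1 (CFC.sqrt_nonneg Q))
  have hz0 : Tendsto z atTop (𝓝 0) := by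
    -- The term `Fᵀ √Q z` is added to the dynamics and subtracted from the disturbance, where it is
    -- negligible.
    refine hF'.tendsto_zero (d := fun j => e j - Fᵀ *ᵥ (psdSqrt Q *ᵥ z j)) (fun j => ?_) ?_
    · rw [hz, add_mulVec, hs, ← mulVec_mulVec (z j) Fᵀ]
      abel
    · have hc : Continuous fun v : Fin n → ℝ => Fᵀ *ᵥ v := by fun_prop
      simpa using he.sub ((hc.tendsto 0).comp hsz)
  have hmul : Tendsto (fun k : ℕ => k * T) atTop atTop :=
    tendsto_id.atTop_mul_const' hT
  refine (hz0.comp hmul).congr fun k => ?_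
  simp [z, Nat.mul_div_cancel _ hT]

end Conditions


/-! ### Cesàro means of asymptotically periodic sequences -/

section Cesaro

theorem sum_range_add_period {f : ℕ → ℝ} {T : ℕ} (hf : Function.Periodic f T) (N : ℕ) :
    ∑ k ∈ Finset.range (N + T), f k = ∑ k ∈ Finset.range N, f k + ∑ k ∈ Finset.range T, f k := by
  induction N with
  | zero => simp
  | succ N ih =>
    rw [show N + 1 + T = N + T + 1 by omega, Finset.sum_range_succ, ih, Finset.sum_range_succ, hf N]
    ring

/-- The partial sums minus `N` times the mean over a period form a periodic, hence bounded,
sequence. -/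
theorem cesaro_of_periodic {f : ℕ → ℝ} {T : ℕ} (hT : 0 < T) (hf : Function.Periodic f T) :
    Tendsto (fun N : ℕ => (N : ℝ)⁻¹ * ∑ k ∈ Finset.range N, f k) atTop
      (𝓝 ((T : ℝ)⁻¹ * ∑ k ∈ Finset.range T, f k)) := by
  set B := (T : ℝ)⁻¹ * ∑ k ∈ Finset.range T, f k with hB
  have hT0 : (T : ℝ) ≠ 0 := by positivity
  let s : ℕ → ℝ := fun N => ∑ k ∈ Finset.range N, f k - N * B
  have hs : Function.Periodic s T := fun N => by
    simp only [s, sum_range_add_period hf, hB]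
    push_cast
    field_simp
    ring
  have hbd : ∀ N, |s N| ≤ ∑ i ∈ Finset.range T, |s i| := fun N => by
    rw [← hs.map_mod_nat N]
    exact Finset.single_le_sum (f := fun i => |s i|) (fun _ _ => abs_nonneg _)
      (Finset.mem_range.2 (Nat.mod_lt N hT))
  have h0 : Tendsto (fun N : ℕ => (N : ℝ)⁻¹ * s N) atTop (𝓝 0) := by
    refine squeeze_zero_norm (a := fun N : ℕ => (N : ℝ)⁻¹ * ∑ i ∈ Finset.range T, |s i|)
      (fun N => ?_)
      (by simpa using (tendsto_inv_atTop_nhds_zero_nat (𝕜 := ℝ)).mul_const (∑ i ∈ Finset.range T, |s i|))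
    rw [norm_mul, Real.norm_eq_abs (s N), Real.norm_of_nonneg (by positivity)]
    exact mul_le_mul_of_nonneg_left (hbd N) (by positivity)
  have h1 := h0.add_const B
  rw [zero_add] at h1
  refine h1.congr' ?_
  filter_upwards [eventually_gt_atTop 0] with N hN
  simp only [s]
  field_simp
  ring

/-- Residues are counted from time 1, the first transmission. Modulo `T`, `k + (T - 1)` stands for
`k - 1` without truncated subtraction at `k = 0`. Finitely many residues make the convergence
uniform over them. -/
theorem tendsto_sub_periodic {a b : ℕ → ℝ} {T : ℕ} (hT : 0 < T)
    (h : ∀ i < T, Tendsto (fun l => a (l * T + 1 + i)) atTop (𝓝 (b i))) :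
    Tendsto (fun k => a k - b ((k + (T - 1)) % T)) atTop (𝓝 0) := by
  rw [← tendsto_add_atTop_iff_nat 1, Metric.tendsto_nhds]
  intro ε hε
  have h1 : ∀ᶠ l in atTop, ∀ i ∈ Finset.range T, dist (a (l * T + 1 + i)) (b i) < ε := by
    rw [Filter.eventually_all_finset]
    exact fun i hi => Metric.tendsto_nhds.1 (h i (Finset.mem_range.1 hi)) ε hε
  filter_upwards [(Nat.tendsto_div_const_atTop hT.ne').eventually h1] with k hk
  have h2 := hk (k % T) (Finset.mem_range.2 (Nat.mod_lt k hT))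
  rw [show k / T * T + 1 + k % T = k + 1 by linarith [Nat.div_add_mod' k T]] at h2
  rw [show k + 1 + (T - 1) = k + T by omega, Nat.add_mod_right]
  simpa [dist_eq_norm] using h2

theorem cesaro_of_tendsto_periodic {a b : ℕ → ℝ} {T : ℕ} (hT : 0 < T)
    (h : ∀ i < T, Tendsto (fun l => a (l * T + 1 + i)) atTop (𝓝 (b i))) :
    Tendsto (fun N : ℕ => (N : ℝ)⁻¹ * ∑ k ∈ Finset.range N, a k) atTop
      (𝓝 ((T : ℝ)⁻¹ * ∑ i ∈ Finset.range T, b i)) := by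
  have h1 := (tendsto_sub_periodic hT h).cesaro
  have h2 := cesaro_of_periodic (f := fun k => b ((k + (T - 1)) % T)) hT
    (fun k => by
      simp only
      rw [show k + T + (T - 1) = k + (T - 1) + T by omega, Nat.add_mod_right])
  have h3 : ∑ k ∈ Finset.range T, b ((k + (T - 1)) % T) = ∑ i ∈ Finset.range T, b i := by
    obtain ⟨t, rfl⟩ : ∃ t, T = t + 1 := ⟨T - 1, by omega⟩
    rw [Finset.sum_range_succ', Finset.sum_range_succ _ t]
    congr 1
    · refine Finset.sum_congr rfl fun k hk => ?_
      have hk := Finset.mem_range.1 hk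
      rw [show k + 1 + (t + 1 - 1) = k + (t + 1) by omega, Nat.add_mod_right,
        Nat.mod_eq_of_lt (by omega)]
    · rw [Nat.mod_eq_of_lt (by omega)]
      simp
  rw [h3] at h2
  refine (by simpa using h1.add h2 : Tendsto _ _ _).congr fun N => ?_
  ring

theorem bounded_of_tendsto_periodic {a b : ℕ → ℝ} {T : ℕ} (hT : 0 < T)
    (h : ∀ i < T, Tendsto (fun l => a (l * T + 1 + i)) atTop (𝓝 (b i))) :
    ∃ D, ∀ k, |a k| ≤ D := by
  obtain ⟨D, hD⟩ := (tendsto_sub_periodic hT h).norm.bddAbove_range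
  refine ⟨D + ∑ i ∈ Finset.range T, |b i|, fun k => ?_⟩
  have h1 : ‖a k - b ((k + (T - 1)) % T)‖ ≤ D := hD ⟨k, rfl⟩
  have h2 : |b ((k + (T - 1)) % T)| ≤ ∑ i ∈ Finset.range T, |b i| :=
    Finset.single_le_sum (f := fun i => |b i|) (fun _ _ => abs_nonneg _)
      (Finset.mem_range.2 (Nat.mod_lt _ hT))
  rw [Real.norm_eq_abs] at h1
  calc |a k| = |(a k - b ((k + (T - 1)) % T)) + b ((k + (T - 1)) % T)| := by simp
    _ ≤ _ := (abs_add_le _ _).trans (add_le_add h1 h2)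

end Cesaro

/-! ### The error covariance recursion -/

namespace System

variable {n m q : ℕ} {Ω : Type*}

/-- The Kalman filter error covariances for the transmission schedule `γ`. -/
def filterCov (s : System n m q Ω) (γ : ℕ → ℝ) (Sigma0 : Matrix (Fin n) (Fin n) ℝ) : ℕ → Matrix (Fin n) (Fin n) ℝ
  | 0 => Sigma0
  | k + 1 => open scoped Classical in
      if γ (k + 1) = 0 then s.h (s.filterCov γ Sigma0 k) else s.g (s.filterCov γ Sigma0 k)

/-- The measurement update is a Riccati step with identity dynamics and zero state weight, and so
inherits positivity and continuity from `dare`. -/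
theorem gTilde_eq_dare (s : System n m q Ω) (X : Matrix (Fin n) (Fin n) ℝ) :
    s.gTilde X = dare 1 s.Cᵀ 0 s.R X := by
  simp [gTilde, dare]

variable {s : System n m q Ω}

theorem h_posSemidef (hQ : s.Q.PosSemidef) {X : Matrix (Fin n) (Fin n) ℝ} (hX : X.PosSemidef) :
    (s.h X).PosSemidef := by
  refine Matrix.PosSemidef.add ?_ hQ
  simpa using hX.mul_mul_conjTranspose_same s.A

theorem h_iterate_posSemidef (hQ : s.Q.PosSemidef) {X : Matrix (Fin n) (Fin n) ℝ}
    (hX : X.PosSemidef) (k : ℕ) : (s.h^[k] X).PosSemidef := by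
  induction k with
  | zero => exact hX
  | succ k ih => rw [Function.iterate_succ_apply']; exact h_posSemidef hQ ih

theorem gTilde_posSemidef (hR : s.R.PosDef) {X : Matrix (Fin n) (Fin n) ℝ} (hX : X.PosSemidef) :
    (s.gTilde X).PosSemidef := by
  rw [gTilde_eq_dare]
  exact dare_posSemidef _ _ .zero hR hX

theorem g_posSemidef (hQ : s.Q.PosSemidef) (hR : s.R.PosDef) {X : Matrix (Fin n) (Fin n) ℝ}
    (hX : X.PosSemidef) : (s.g X).PosSemidef := gTilde_posSemidef hR (h_posSemidef hQ hX)

theorem filterCov_posSemidef (hQ : s.Q.PosSemidef) (hR : s.R.PosDef) (γ : ℕ → ℝ)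
    {Sigma0 : Matrix (Fin n) (Fin n) ℝ} (h0 : Sigma0.PosSemidef) (k : ℕ) :
    (s.filterCov γ Sigma0 k).PosSemidef := by
  induction k with
  | zero => exact h0
  | succ k ih =>
    rw [filterCov]
    split_ifs
    · exact h_posSemidef hQ ih
    · exact g_posSemidef hQ hR ih

theorem h_iterate_eq (k : ℕ) (X : Matrix (Fin n) (Fin n) ℝ) :
    s.h^[k] X = s.A ^ k * X * (s.A ^ k)ᵀ + noiseGramian s.A s.Q k := by
  induction k with
  | zero => simp [noiseGramian]
  | succ k ih =>
    rw [Function.iterate_succ_apply', ih, h, noiseGramian, noiseGramian, Finset.sum_range_succ']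
    simp only [Matrix.mul_add, Matrix.add_mul, Finset.mul_sum, Finset.sum_mul, pow_succ',
      transpose_mul, Matrix.mul_assoc, add_assoc, pow_zero, transpose_one, Matrix.one_mul,
      Matrix.mul_one]

/-- One correction followed by `T` predictions is a single Riccati step for the dual of `(C, A^T)`,
weighted by the noise accumulated over a period. This is where detectability of that pair becomes
the relevant hypothesis. -/
theorem h_iterate_gTilde (T : ℕ) (X : Matrix (Fin n) (Fin n) ℝ) :
    s.h^[T] (s.gTilde X) = dare (s.A ^ T)ᵀ s.Cᵀ (noiseGramian s.A s.Q T) s.R X := by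
  rw [h_iterate_eq, gTilde, dare]
  simp only [transpose_transpose, Matrix.mul_sub, Matrix.sub_mul, Matrix.mul_assoc]
  abel

theorem continuous_h_iterate (k : ℕ) : Continuous (s.h^[k]) := by
  refine Continuous.iterate ?_ k
  unfold h
  fun_prop

theorem tendsto_gTilde (hR : s.R.PosDef) {X : ℕ → Matrix (Fin n) (Fin n) ℝ}
    {Y : Matrix (Fin n) (Fin n) ℝ} (hY : Y.PosSemidef) (h : Tendsto X atTop (𝓝 Y)) :
    Tendsto (fun k => s.gTilde (X k)) atTop (𝓝 (s.gTilde Y)) := by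
  simp_rw [gTilde_eq_dare]
  exact tendsto_dare _ _ _ hR hY h

theorem periodicSchedule_succ_eq_zero_iff (T k : ℕ) :
    periodicSchedule T (k + 1) = 0 ↔ ¬ T ∣ k := by
  unfold periodicSchedule
  have : (∃ l : ℕ, k + 1 = l * T + 1) ↔ T ∣ k := by
    simp [dvd_def, mul_comm]
  simp only [this]
  simp

theorem filterCov_periodic_add {T : ℕ} (Sigma0 : Matrix (Fin n) (Fin n) ℝ)
    (l : ℕ) {i : ℕ} (hi : i < T) :
    s.filterCov (periodicSchedule T) Sigma0 (l * T + 1 + i) =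
      s.h^[i] (s.filterCov (periodicSchedule T) Sigma0 (l * T + 1)) := by
  induction i with
  | zero => simp
  | succ i ih =>
    rw [Function.iterate_succ_apply', ← ih (by omega), ← add_assoc, filterCov, if_pos]
    rw [periodicSchedule_succ_eq_zero_iff, add_assoc,
      ← Nat.dvd_add_iff_right (Dvd.intro_left l rfl)]
    exact fun h => absurd (Nat.le_of_dvd (by omega) h) (by omega)

theorem filterCov_periodic_succ {T : ℕ} (hT : 0 < T) (Sigma0 : Matrix (Fin n) (Fin n) ℝ)
    (l : ℕ) :
    s.filterCov (periodicSchedule T) Sigma0 ((l + 1) * T + 1) =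
      s.gTilde (s.h^[T] (s.filterCov (periodicSchedule T) Sigma0 (l * T + 1))) := by
  rw [filterCov, if_neg (by simp [periodicSchedule_succ_eq_zero_iff])]
  obtain ⟨t, rfl⟩ : ∃ t, T = t + 1 := ⟨T - 1, by omega⟩
  rw [g, Function.iterate_succ_apply', ← filterCov_periodic_add Sigma0 l (by omega)]
  congr 3
  ring

/-- The steady state of the error covariance recursion for the periodic schedule. -/
theorem exists_periodic_steadyState (hQ : s.Q.PosSemidef) (hR : s.R.PosDef)
    (hstab : Stabilizable s.A (psdSqrt s.Q)) {T : ℕ} (hT : 1 ≤ T)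
    (hdetT : Detectable s.C (s.A ^ T)) :
    ∃ P : Matrix (Fin n) (Fin n) ℝ, P.PosSemidef ∧ P = s.g (s.h^[T - 1] P) ∧
      (∀ X : Matrix (Fin n) (Fin n) ℝ, X.PosSemidef → X = s.g (s.h^[T - 1] X) → X = P) ∧
      ∀ Sigma0 : Matrix (Fin n) (Fin n) ℝ, Sigma0.PosSemidef → ∀ i < T,
        Tendsto (fun l => s.filterCov (periodicSchedule T) Sigma0 (l * T + 1 + i)) atTop
          (𝓝 (s.h^[i] P)) := by
  have hG := noiseGramian_posSemidef s.A hQ T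
  have hg : ∀ X, s.g (s.h^[T - 1] X) = s.gTilde (s.h^[T] X) := fun X => by
    rw [g, ← Function.iterate_succ_apply' s.h, Nat.succ_eq_add_one, Nat.sub_add_cancel hT]
  obtain ⟨S, hS, hlim, hfix, -⟩ := exists_tendsto_dare_iterate_zero hG hR
    (hdetT.finiteCost (noiseGramian s.A s.Q T) s.R)
  have hdet := hstab.asymptoticallyDetectable hQ (T := T) (by omega)
  have hconv : ∀ X : Matrix (Fin n) (Fin n) ℝ, X.PosSemidef → _ := fun X hX =>
    tendsto_dare_iterate hG hR hdet hS hlim hfix hX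
  -- `S` is the steady predicted covariance just before a transmission and `g̃ S` the one just after
  -- it. The map `g̃` carries fixed points of `h^T ∘ g̃` to fixed points of `g̃ ∘ h^T`.
  have hfix' : s.h^[T] (s.gTilde S) = S := by rw [h_iterate_gTilde, ← hfix]
  refine ⟨s.gTilde S, gTilde_posSemidef hR hS, by rw [hg, hfix'], fun X hX hXfix => ?_,
    fun Sigma0 h0 i hi => ?_⟩
  -- For another fixed point `X`, the matrix `h^T X` is fixed by the Riccati map; its constant orbit
  -- must converge to `S`.
  · rw [hg] at hXfix
    have h1 : dare (s.A ^ T)ᵀ s.Cᵀ (noiseGramian s.A s.Q T) s.R (s.h^[T] X) = s.h^[T] X := by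
      rw [← h_iterate_gTilde, ← hXfix]
    have h2 := hconv _ (h_iterate_posSemidef hQ hX T)
    simp_rw [Function.iterate_fixed h1] at h2
    rw [hXfix, tendsto_nhds_unique h2 tendsto_const_nhds]
  · set P := s.filterCov (periodicSchedule T) Sigma0
    have hP : ∀ k, (P k).PosSemidef := filterCov_posSemidef hQ hR _ h0
    have h1 : ∀ l, s.h^[T] (P (l * T + 1)) =
        (dare (s.A ^ T)ᵀ s.Cᵀ (noiseGramian s.A s.Q T) s.R)^[l] (s.h^[T] (P 1)) := by
      intro l
      induction l with
      | zero => simp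
      | succ l ih =>
        rw [Function.iterate_succ_apply', ← ih, ← h_iterate_gTilde,
          ← filterCov_periodic_succ (by omega)]
    have h2 : Tendsto (fun l => P (l * T + 1)) atTop (𝓝 (s.gTilde S)) := by
      rw [← tendsto_add_atTop_iff_nat 1]
      simp_rw [P, filterCov_periodic_succ hT Sigma0]
      refine tendsto_gTilde hR hS ?_
      simp_rw [show ∀ l, s.h^[T] (s.filterCov (periodicSchedule T) Sigma0 (l * T + 1)) = _ from h1]
      exact hconv _ (h_iterate_posSemidef hQ (hP 1) T)
    refine (((continuous_h_iterate i).tendsto _).comp h2).congr fun l => ?_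
    exact (filterCov_periodic_add Sigma0 l hi).symm

end System


/-! ### Independence of σ-algebras -/

section Indep

variable {Ω : Type*} {m1 m2 m3 : MeasurableSpace Ω} [mΩ : MeasurableSpace Ω] {μ : Measure Ω}
  [IsProbabilityMeasure μ]

/-- Intersections `b ∩ c` form a π-system generating `m2 ⊔ m3`; on it the measure of `a ∩ b ∩ c`
factors first as `(a ∩ b)` against `c`, then as `a` against `b`. -/
theorem indep_sup_right (h1 : m1 ≤ mΩ) (h2 : m2 ≤ mΩ) (h3 : m3 ≤ mΩ) (h12 : Indep m1 m2 μ)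
    (h123 : Indep (m1 ⊔ m2) m3 μ) : Indep m1 (m2 ⊔ m3) μ := by
  let p : Set (Set Ω) := {t | ∃ b c, MeasurableSet[m2] b ∧ MeasurableSet[m3] c ∧ b ∩ c = t}
  have hp : IsPiSystem p := by
    rintro _ ⟨b, c, hb, hc, rfl⟩ _ ⟨b', c', hb', hc', rfl⟩ _
    exact ⟨b ∩ b', c ∩ c', hb.inter hb', hc.inter hc', Set.inter_inter_inter_comm _ _ _ _⟩
  have hgen : m2 ⊔ m3 = MeasurableSpace.generateFrom p := by
    apply le_antisymm
    · refine sup_le (fun b hb => ?_) (fun c hc => ?_)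
      · exact MeasurableSpace.measurableSet_generateFrom ⟨b, Set.univ, hb, .univ, Set.inter_univ b⟩
      · exact MeasurableSpace.measurableSet_generateFrom ⟨Set.univ, c, .univ, hc, Set.univ_inter c⟩
    · refine MeasurableSpace.generateFrom_le ?_
      rintro _ ⟨b, c, hb, hc, rfl⟩
      exact MeasurableSet.inter ((le_sup_left : m2 ≤ m2 ⊔ m3) _ hb)
        ((le_sup_right : m3 ≤ m2 ⊔ m3) _ hc)
  refine IndepSets.indep (p1 := {s | MeasurableSet[m1] s}) (p2 := p) h1 (sup_le h2 h3)
    (@MeasurableSpace.isPiSystem_measurableSet _ m1) hp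
    (@MeasurableSpace.generateFrom_measurableSet _ m1).symm hgen ?_
  rw [IndepSets_iff]
  rintro a _ ha ⟨b, c, hb, hc, rfl⟩
  rw [Indep_iff] at h12 h123
  have hb' : MeasurableSet[m1 ⊔ m2] b := (le_sup_right : m2 ≤ m1 ⊔ m2) _ hb
  have ha' : MeasurableSet[m1 ⊔ m2] a := (le_sup_left : m1 ≤ m1 ⊔ m2) _ ha
  rw [← Set.inter_assoc, h123 _ _ (MeasurableSet.inter ha' hb') hc, h123 _ _ hb' hc,
    h12 _ _ ha hb, mul_assoc]

end Indep

/-! ### Second moments of random vectors -/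

section SecondMoment

variable {Ω : Type*} [MeasurableSpace Ω] {μ : Measure Ω} {a b c : ℕ}

/-- The matrix `E[X Y']`. -/
def secondMoment (μ : Measure Ω) (X : Ω → Fin a → ℝ) (Y : Ω → Fin b → ℝ) :
    Matrix (Fin a) (Fin b) ℝ := Matrix.of fun i j => ∫ ω, X ω i * Y ω j ∂μ

theorem integrable_mul_eval {X : Ω → Fin a → ℝ} {Y : Ω → Fin b → ℝ} (hX : MemLp X 2 μ)
    (hY : MemLp Y 2 μ) (i : Fin a) (j : Fin b) : Integrable (fun ω => X ω i * Y ω j) μ :=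
  (hX.eval i).integrable_mul (hY.eval j)

theorem MemLp.mulVec {X : Ω → Fin a → ℝ} {p : ℝ≥0∞} (hX : MemLp X p μ)
    (M : Matrix (Fin b) (Fin a) ℝ) : MemLp (fun ω => M *ᵥ X ω) p μ :=
  (LinearMap.toContinuousLinearMap M.mulVecLin).comp_memLp' hX

theorem secondMoment_transpose (X : Ω → Fin a → ℝ) (Y : Ω → Fin b → ℝ) :
    (secondMoment μ X Y)ᵀ = secondMoment μ Y X := by
  ext i j
  simp [secondMoment, mul_comm]

theorem secondMoment_add_left {X X' : Ω → Fin a → ℝ} {Y : Ω → Fin b → ℝ} (hX : MemLp X 2 μ)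
    (hX' : MemLp X' 2 μ) (hY : MemLp Y 2 μ) :
    secondMoment μ (fun ω => X ω + X' ω) Y = secondMoment μ X Y + secondMoment μ X' Y := by
  ext i j
  simp only [secondMoment, of_apply, Matrix.add_apply, Pi.add_apply, add_mul]
  exact integral_add (integrable_mul_eval hX hY i j) (integrable_mul_eval hX' hY i j)

theorem secondMoment_add_right {X : Ω → Fin a → ℝ} {Y Y' : Ω → Fin b → ℝ} (hX : MemLp X 2 μ)
    (hY : MemLp Y 2 μ) (hY' : MemLp Y' 2 μ) :
    secondMoment μ X (fun ω => Y ω + Y' ω) = secondMoment μ X Y + secondMoment μ X Y' := by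
  rw [← secondMoment_transpose, secondMoment_add_left hY hY' hX, transpose_add,
    secondMoment_transpose, secondMoment_transpose]

theorem secondMoment_mulVec_left {X : Ω → Fin a → ℝ} {Y : Ω → Fin b → ℝ} (hX : MemLp X 2 μ)
    (hY : MemLp Y 2 μ) (M : Matrix (Fin c) (Fin a) ℝ) :
    secondMoment μ (fun ω => M *ᵥ X ω) Y = M * secondMoment μ X Y := by
  ext i j
  simp only [secondMoment, of_apply, mulVec, dotProduct, Matrix.mul_apply, Finset.sum_mul,
    mul_assoc]
  rw [integral_finsetSum _ fun k _ => (integrable_mul_eval hX hY k j).const_mul _]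
  simp_rw [integral_const_mul]

theorem secondMoment_mulVec_right {X : Ω → Fin a → ℝ} {Y : Ω → Fin b → ℝ} (hX : MemLp X 2 μ)
    (hY : MemLp Y 2 μ) (M : Matrix (Fin c) (Fin b) ℝ) :
    secondMoment μ X (fun ω => M *ᵥ Y ω) = secondMoment μ X Y * Mᵀ := by
  rw [← secondMoment_transpose, secondMoment_mulVec_left hY hX, transpose_mul,
    secondMoment_transpose]

theorem integral_dotProduct_mulVec {X : Ω → Fin a → ℝ} {Y : Ω → Fin b → ℝ} (hX : MemLp X 2 μ)
    (hY : MemLp Y 2 μ) (M : Matrix (Fin a) (Fin b) ℝ) :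
    ∫ ω, X ω ⬝ᵥ (M *ᵥ Y ω) ∂μ = (M * secondMoment μ Y X).trace := by
  simp only [dotProduct, mulVec, Finset.mul_sum, Matrix.trace, diag_apply, Matrix.mul_apply,
    secondMoment, of_apply]
  have h (i : Fin a) (j : Fin b) : Integrable (fun ω => X ω i * (M i j * Y ω j)) μ := by
    refine ((integrable_mul_eval hX hY i j).const_mul (M i j)).congr (ae_of_all _ fun ω => ?_)
    simp only
    ring
  rw [integral_finsetSum _ fun i _ => integrable_finsetSum _ fun j _ => h i j]
  refine Finset.sum_congr rfl fun i _ => ?_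
  rw [integral_finsetSum _ fun j _ => h i j]
  refine Finset.sum_congr rfl fun j _ => ?_
  rw [← integral_const_mul]
  congr 1
  ext ω
  ring

theorem integrable_dotProduct_mulVec {X : Ω → Fin a → ℝ} {Y : Ω → Fin b → ℝ} (hX : MemLp X 2 μ)
    (hY : MemLp Y 2 μ) (M : Matrix (Fin a) (Fin b) ℝ) :
    Integrable (fun ω => X ω ⬝ᵥ (M *ᵥ Y ω)) μ := by
  simp only [dotProduct]
  exact integrable_finsetSum _ fun i _ => integrable_mul_eval hX (MemLp.mulVec hY M) i i

theorem secondMoment_eq_zero_of_indepFun [IsProbabilityMeasure μ] {X : Ω → Fin a → ℝ}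
    {Y : Ω → Fin b → ℝ} (hX : MemLp X 2 μ) (hY : MemLp Y 2 μ) (h : IndepFun X Y μ)
    (h0 : ∀ i, ∫ ω, X ω i ∂μ = 0) : secondMoment μ X Y = 0 := by
  ext i j
  have h1 : IndepFun (fun ω => X ω i) (fun ω => Y ω j) μ :=
    h.comp (measurable_pi_apply i) (measurable_pi_apply j)
  simp only [secondMoment, of_apply, Matrix.zero_apply]
  rw [h1.integral_fun_mul_eq_mul_integral (hX.eval i).aestronglyMeasurable
    (hY.eval j).aestronglyMeasurable, h0, zero_mul]

end SecondMoment

/-! ### Gaussian vectors -/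

section Gaussian

variable {Ω : Type*} [MeasurableSpace Ω] {μ : Measure Ω} [IsProbabilityMeasure μ] {a b : ℕ}

omit [IsProbabilityMeasure μ] in
theorem HasGaussianLaw.sub_const' {X : Ω → Fin a → ℝ} (hX : HasGaussianLaw X μ) (c : Fin a → ℝ) :
    HasGaussianLaw (fun ω => X ω - c) μ where
  isGaussian_map := by
    have := hX.isGaussian_map
    have h : μ.map (fun ω => X ω - c) = (μ.map X).map (fun x => x - c) := by
      rw [AEMeasurable.map_map_of_aemeasurable (by fun_prop) hX.aemeasurable]
      rfl
    rw [h]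
    infer_instance

theorem centered_of_hasLaw_multivariateGaussian {X : Ω → Fin a → ℝ} {x : Fin a → ℝ}
    {S : Matrix (Fin a) (Fin a) ℝ} (hS : S.PosSemidef)
    (h : HasLaw (fun ω => WithLp.toLp 2 (X ω)) (multivariateGaussian (WithLp.toLp 2 x) S) μ) :
    HasGaussianLaw (fun ω => X ω - x) μ ∧ (∀ i, ∫ ω, (X ω - x) i ∂μ = 0) ∧
      secondMoment μ (fun ω => X ω - x) (fun ω => X ω - x) = S := by
  have hX : HasGaussianLaw X μ :=
    h.hasGaussianLaw.map_fun (PiLp.continuousLinearEquiv 2 ℝ (fun _ : Fin a => ℝ)).toContinuousLinearMap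
  have hL := hX.memLp_two
  have hi (i : Fin a) : Integrable (fun ω => X ω i) μ := (hL.eval i).integrable one_le_two
  have hmean (i : Fin a) : ∫ ω, X ω i ∂μ = x i := by
    have h1 := h.integral_comp (f := fun y => y i) (by fun_prop)
    simp only [Function.comp_def] at h1
    rw [h1]
    have h2 := (EuclideanSpace.proj (𝕜 := ℝ) i).integral_comp_comm
      (μ := multivariateGaussian (WithLp.toLp 2 x) S) (φ := fun y => y) IsGaussian.integrable_fun_id
    rw [integral_id_multivariateGaussian] at h2
    simpa using h2
  refine ⟨HasGaussianLaw.sub_const' hX x, fun i => ?_, ?_⟩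
  · simp only [Pi.sub_apply]
    rw [integral_sub (hi i) (integrable_const _), hmean]
    simp
  · ext i j
    have h1 := h.covariance_fun_comp (f := fun y => y i) (g := fun y => y j) (by fun_prop) (by fun_prop)
    rw [covariance_eval_multivariateGaussian hS] at h1
    rw [← h1]
    simp [secondMoment, covariance, hmean]

/-- For a jointly Gaussian pair uncorrelated means independent; centring of `X` makes the mixed
second moment the covariance. -/
theorem indepFun_of_secondMoment_eq_zero {X : Ω → Fin a → ℝ} {Y : Ω → Fin b → ℝ}
    (h : HasGaussianLaw (fun ω => (X ω, Y ω)) μ) (hX : ∀ i, ∫ ω, X ω i ∂μ = 0)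
    (h0 : secondMoment μ X Y = 0) : IndepFun X Y μ := by
  refine HasGaussianLaw.indepFun_of_covariance_eval (X := fun i ω => X ω i)
    (Y := fun j ω => Y ω j) h fun i j => ?_
  rw [covariance_eq_sub (h.fst.memLp_two.eval i) (h.snd.memLp_two.eval j)]
  have h1 : ∫ ω, X ω i * Y ω j ∂μ = 0 := congrFun (congrFun h0 i) j
  simp [h1, hX]

end Gaussian


/-! ### One step of the Kalman filter -/

section KalmanStep

variable {Ω : Type*}

theorem comap_pair {β γ : Type*} [MeasurableSpace β] [MeasurableSpace γ] (X : Ω → β) (Y : Ω → γ) :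
    MeasurableSpace.comap (fun ω => (X ω, Y ω)) inferInstance =
      MeasurableSpace.comap X inferInstance ⊔ MeasurableSpace.comap Y inferInstance :=
  MeasurableSpace.comap_prodMk X Y

theorem measurable_mulVec {m : MeasurableSpace Ω} {a b : ℕ} {f : Ω → Fin a → ℝ} (hf : Measurable f)
    (M : Matrix (Fin b) (Fin a) ℝ) : Measurable fun ω => M *ᵥ f ω :=
  (by fun_prop : Continuous fun x : Fin a → ℝ => M *ᵥ x).measurable.comp hf

theorem integral_mulVec_eq_zero [MeasurableSpace Ω] {μ : Measure Ω} {a b : ℕ} {X : Ω → Fin a → ℝ}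
    (hX : Integrable X μ) (h0 : ∀ i, ∫ ω, X ω i ∂μ = 0) (M : Matrix (Fin b) (Fin a) ℝ) (i : Fin b) :
    ∫ ω, (M *ᵥ X ω) i ∂μ = 0 := by
  simp only [mulVec, dotProduct]
  rw [integral_finsetSum _ fun j _ => (hX.eval j).const_mul _]
  simp [integral_const_mul, h0]

variable {m𝒢 : MeasurableSpace Ω} [mΩ : MeasurableSpace Ω] {μ : Measure Ω} [IsProbabilityMeasure μ]
  {n q : ℕ}
  {A P Q : Matrix (Fin n) (Fin n) ℝ} {C : Matrix (Fin q) (Fin n) ℝ} {R : Matrix (Fin q) (Fin q) ℝ}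
  {e w : Ω → Fin n → ℝ} {v : Ω → Fin q → ℝ}

omit [IsProbabilityMeasure μ] in
theorem hasGaussianLaw_triple (ge : HasGaussianLaw e μ) (gw : HasGaussianLaw w μ) (gv : HasGaussianLaw v μ)
    (hwv : IndepFun w v μ)
    (hewv : Indep (MeasurableSpace.comap e inferInstance ⊔ m𝒢)
      (MeasurableSpace.comap w inferInstance ⊔ MeasurableSpace.comap v inferInstance) μ) :
    HasGaussianLaw (fun ω => (e ω, (w ω, v ω))) μ := by
  refine IndepFun.hasGaussianLaw ge (hwv.hasGaussianLaw gw gv) ?_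
  rw [IndepFun_iff_Indep, comap_pair]
  exact indep_of_indep_of_le_left hewv le_sup_left

/-- Regroups independence: the fresh noise joins the old error on one side, leaving the old data
alone on the other. -/
theorem indep_error_noise_received (hm : m𝒢 ≤ mΩ) (he : Measurable e) (hw : Measurable w)
    (hv : Measurable v) (hind : Indep (MeasurableSpace.comap e inferInstance) m𝒢 μ)
    (hewv : Indep (MeasurableSpace.comap e inferInstance ⊔ m𝒢)
      (MeasurableSpace.comap w inferInstance ⊔ MeasurableSpace.comap v inferInstance) μ) :
    Indep (MeasurableSpace.comap e inferInstance ⊔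
      (MeasurableSpace.comap w inferInstance ⊔ MeasurableSpace.comap v inferInstance)) m𝒢 μ := by
  rw [sup_comm _ m𝒢] at hewv
  rw [sup_comm]
  have := (indep_sup_right hm he.comap_le (sup_le hw.comap_le hv.comap_le) hind.symm hewv).symm
  rwa [sup_comm] at this

/-- The time update of the Kalman filter. -/
theorem kalman_predict (hm : m𝒢 ≤ mΩ) (he : Measurable e) (hw : Measurable w) (hv : Measurable v)
    (ge : HasGaussianLaw e μ) (gw : HasGaussianLaw w μ) (gv : HasGaussianLaw v μ)
    (e0 : ∀ i, ∫ ω, e ω i ∂μ = 0) (w0 : ∀ i, ∫ ω, w ω i ∂μ = 0)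
    (e2 : secondMoment μ e e = P) (w2 : secondMoment μ w w = Q)
    (hwv : IndepFun w v μ) (hind : Indep (MeasurableSpace.comap e inferInstance) m𝒢 μ)
    (hewv : Indep (MeasurableSpace.comap e inferInstance ⊔ m𝒢)
      (MeasurableSpace.comap w inferInstance ⊔ MeasurableSpace.comap v inferInstance) μ) :
    HasGaussianLaw (fun ω => A *ᵥ e ω + w ω) μ ∧ (∀ i, ∫ ω, (A *ᵥ e ω + w ω) i ∂μ = 0) ∧
      secondMoment μ (fun ω => A *ᵥ e ω + w ω) (fun ω => A *ᵥ e ω + w ω) = A * P * Aᵀ + Q ∧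
      Indep (MeasurableSpace.comap (fun ω => A *ᵥ e ω + w ω) inferInstance) m𝒢 μ := by
  have hew : IndepFun e w μ := by
    rw [IndepFun_iff_Indep]
    exact indep_of_indep_of_le hewv le_sup_left le_sup_left
  have le := ge.memLp_two
  have lw := gw.memLp_two
  have lAe := MemLp.mulVec le A
  have lp : MemLp (fun ω => A *ᵥ e ω + w ω) 2 μ := lAe.add lw
  refine ⟨?_, fun i => ?_, ?_, ?_⟩
  · let L : ((Fin n → ℝ) × ((Fin n → ℝ) × (Fin q → ℝ))) →ₗ[ℝ] (Fin n → ℝ) :=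
      A.mulVecLin ∘ₗ LinearMap.fst ℝ _ _ + LinearMap.fst ℝ _ _ ∘ₗ LinearMap.snd ℝ _ _
    exact (hasGaussianLaw_triple ge gw gv hwv hewv).map_fun L.toContinuousLinearMap
  · simp only [Pi.add_apply]
    rw [integral_add ((lAe.eval i).integrable one_le_two) ((lw.eval i).integrable one_le_two),
      w0, integral_mulVec_eq_zero ge.integrable e0, add_zero]
  · have h0 := secondMoment_eq_zero_of_indepFun le lw hew e0
    have h0' : secondMoment μ w e = 0 := by rw [← secondMoment_transpose, h0, transpose_zero]
    rw [secondMoment_add_left lAe lw lp, secondMoment_add_right lAe lAe lw,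
      secondMoment_add_right lw lAe lw, secondMoment_mulVec_left le lAe,
      secondMoment_mulVec_right le le, secondMoment_mulVec_left le lw,
      secondMoment_mulVec_right lw le, h0, h0', e2, w2]
    simp [Matrix.mul_assoc]
  · refine indep_of_indep_of_le_left (indep_error_noise_received hm he hw hv hind hewv) ?_
    have h1 : Measurable[MeasurableSpace.comap e inferInstance ⊔
        (MeasurableSpace.comap w inferInstance ⊔ MeasurableSpace.comap v inferInstance)]
        fun ω => A *ᵥ e ω + w ω := by
      refine Measurable.add (measurable_mulVec ?_ A) ?_
      · exact (comap_measurable e).mono le_sup_left le_rfl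
      · exact (comap_measurable w).mono (le_sup_left.trans le_sup_right) le_rfl
    exact h1.comap_le

/-- The measurement update of the Kalman filter. -/
theorem kalman_update (hR : R.PosDef) (hP : P.PosSemidef) (hQ : Q.PosSemidef)
    (hm : m𝒢 ≤ mΩ) (he : Measurable e) (hw : Measurable w) (hv : Measurable v)
    (ge : HasGaussianLaw e μ) (gw : HasGaussianLaw w μ) (gv : HasGaussianLaw v μ)
    (e0 : ∀ i, ∫ ω, e ω i ∂μ = 0) (w0 : ∀ i, ∫ ω, w ω i ∂μ = 0) (v0 : ∀ i, ∫ ω, v ω i ∂μ = 0)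
    (e2 : secondMoment μ e e = P) (w2 : secondMoment μ w w = Q) (v2 : secondMoment μ v v = R)
    (hwv : IndepFun w v μ) (hind : Indep (MeasurableSpace.comap e inferInstance) m𝒢 μ)
    (hewv : Indep (MeasurableSpace.comap e inferInstance ⊔ m𝒢)
      (MeasurableSpace.comap w inferInstance ⊔ MeasurableSpace.comap v inferInstance) μ)
    {X : Matrix (Fin n) (Fin n) ℝ} (hX : X = A * P * Aᵀ + Q)
    {K : Matrix (Fin n) (Fin q) ℝ} (hK : K = X * Cᵀ * (C * X * Cᵀ + R)⁻¹)
    {p e' : Ω → Fin n → ℝ} {ν : Ω → Fin q → ℝ} (hp : p = fun ω => A *ᵥ e ω + w ω)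
    (hν : ν = fun ω => C *ᵥ p ω + v ω) (he' : e' = fun ω => p ω + (-K) *ᵥ ν ω) :
    HasGaussianLaw e' μ ∧ (∀ i, ∫ ω, e' ω i ∂μ = 0) ∧
      secondMoment μ e' e' = X - X * Cᵀ * (C * X * Cᵀ + R)⁻¹ * C * X ∧
      Indep (MeasurableSpace.comap e' inferInstance)
        (MeasurableSpace.comap ν inferInstance ⊔ m𝒢) μ := by
  obtain ⟨gp, p0, p2, -⟩ := kalman_predict (A := A) hm he hw hv ge gw gv e0 w0 e2 w2 hwv hind hewv
  rw [← hp, ← hX] at p2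
  rw [← hp] at gp
  have p0 : ∀ i, ∫ ω, p ω i ∂μ = 0 := by rw [hp]; exact p0
  have htri := hasGaussianLaw_triple ge gw gv hwv hewv
  have hXp : X.PosSemidef := by
    rw [hX]
    refine Matrix.PosSemidef.add ?_ hQ
    simpa using hP.mul_mul_conjTranspose_same A
  -- The predicted error uses only `e` and `w`, and `v` is independent of that pair.
  have hpv : IndepFun p v μ := by
    have h1 : IndepFun (fun ω => (e ω, w ω)) v μ := by
      rw [IndepFun_iff_Indep, comap_pair]
      rw [IndepFun_iff_Indep] at hwv
      rw [sup_comm]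
      refine (indep_sup_right hv.comap_le hw.comap_le he.comap_le hwv.symm ?_).symm
      rw [sup_comm]
      exact (indep_of_indep_of_le_left hewv le_sup_left).symm
    have h2 : Measurable fun x : (Fin n → ℝ) × (Fin n → ℝ) => A *ᵥ x.1 + x.2 :=
      (by fun_prop : Continuous fun x : (Fin n → ℝ) × (Fin n → ℝ) => A *ᵥ x.1 + x.2).measurable
    rw [hp]
    exact h1.comp h2 measurable_id
  have lp := gp.memLp_two
  have lv := gv.memLp_two
  have lCp := MemLp.mulVec lp C
  have lν : MemLp ν 2 μ := by rw [hν]; exact lCp.add lv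
  have lKν := MemLp.mulVec lν (-K)
  have le' : MemLp e' 2 μ := by rw [he']; exact lp.add lKν
  have ν0 : ∀ i, ∫ ω, ν ω i ∂μ = 0 := fun i => by
    simp only [hν, Pi.add_apply]
    rw [integral_add ((lCp.eval i).integrable one_le_two) ((lv.eval i).integrable one_le_two),
      v0, integral_mulVec_eq_zero gp.integrable p0, add_zero]
  have pv0 := secondMoment_eq_zero_of_indepFun lp lv hpv p0
  have vp0 : secondMoment μ v p = 0 := by rw [← secondMoment_transpose, pv0, transpose_zero]
  have pν : secondMoment μ p ν = X * Cᵀ := by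
    rw [hν, secondMoment_add_right lp lCp lv, secondMoment_mulVec_right lp lp, p2, pv0, add_zero]
  have νp : secondMoment μ ν p = C * X := by
    rw [← secondMoment_transpose, pν, transpose_mul, transpose_transpose,
      PosSemidef.transpose_eq hXp]
  have vν : secondMoment μ v ν = R := by
    rw [hν, secondMoment_add_right lv lCp lv, secondMoment_mulVec_right lv lp, vp0, v2,
      Matrix.zero_mul, zero_add]
  have νν : secondMoment μ ν ν = C * X * Cᵀ + R := by
    conv_lhs => enter [2]; rw [hν]
    rw [secondMoment_add_left lCp lv lν, secondMoment_mulVec_left lp lν, pν, vν, Matrix.mul_assoc]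
  have hM : (C * X * Cᵀ + R).PosDef := by
    have := posDef_congr_add Cᵀ hR hXp
    rwa [transpose_transpose] at this
  have hMi : (C * X * Cᵀ + R)⁻¹ * (C * X * Cᵀ + R) = 1 :=
    nonsing_inv_mul _ ((isUnit_iff_isUnit_det _).1 hM.isUnit)
  -- The Kalman gain is exactly the one that makes the new error uncorrelated with the innovation.
  have e'ν : secondMoment μ e' ν = 0 := by
    rw [he', secondMoment_add_left lp lKν lν, secondMoment_mulVec_left lν lν, pν, νν, hK,
      Matrix.neg_mul, Matrix.mul_assoc _ _ (C * X * Cᵀ + R), hMi, Matrix.mul_one, add_neg_cancel]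
  have e'p : secondMoment μ e' p = X - X * Cᵀ * (C * X * Cᵀ + R)⁻¹ * C * X := by
    rw [he', secondMoment_add_left lp lKν lp, secondMoment_mulVec_left lν lp, p2, νp, hK,
      Matrix.neg_mul, sub_eq_add_neg]
    simp only [Matrix.mul_assoc]
  -- New error and innovation are linear images of the Gaussian triple `(e, w, v)`, so being
  -- uncorrelated will give independence.
  have hjoint : HasGaussianLaw (fun ω => (e' ω, ν ω)) μ := by
    let Lp : ((Fin n → ℝ) × ((Fin n → ℝ) × (Fin q → ℝ))) →ₗ[ℝ] (Fin n → ℝ) :=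
      A.mulVecLin ∘ₗ LinearMap.fst ℝ _ _ + LinearMap.fst ℝ _ _ ∘ₗ LinearMap.snd ℝ _ _
    let Lν : ((Fin n → ℝ) × ((Fin n → ℝ) × (Fin q → ℝ))) →ₗ[ℝ] (Fin q → ℝ) :=
      C.mulVecLin ∘ₗ Lp + LinearMap.snd ℝ _ _ ∘ₗ LinearMap.snd ℝ _ _
    let L := (Lp + (-K).mulVecLin ∘ₗ Lν).prod Lν
    rw [he', hν, hp]
    exact htri.map_fun L.toContinuousLinearMap
  have e'0 : ∀ i, ∫ ω, e' ω i ∂μ = 0 := fun i => by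
    simp only [he', Pi.add_apply]
    rw [integral_add ((lp.eval i).integrable one_le_two) ((lKν.eval i).integrable one_le_two),
      p0, integral_mulVec_eq_zero (lν.integrable one_le_two) ν0, add_zero]
  refine ⟨hjoint.fst, e'0, ?_, ?_⟩
  -- By orthogonality to the innovation, `E[e' e'ᵀ] = E[e' pᵀ]`.
  · conv_lhs => enter [3]; rw [he']
    rw [secondMoment_add_right le' lp lKν, secondMoment_mulVec_right le' lν, e'ν, e'p,
      Matrix.zero_mul, add_zero]
  · have mp : Measurable[MeasurableSpace.comap e inferInstance ⊔
        (MeasurableSpace.comap w inferInstance ⊔ MeasurableSpace.comap v inferInstance)] p := by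
      rw [hp]
      refine Measurable.add (measurable_mulVec ?_ A) ?_
      · exact (comap_measurable e).mono le_sup_left le_rfl
      · exact (comap_measurable w).mono (le_sup_left.trans le_sup_right) le_rfl
    have mν : Measurable[MeasurableSpace.comap e inferInstance ⊔
        (MeasurableSpace.comap w inferInstance ⊔ MeasurableSpace.comap v inferInstance)] ν := by
      rw [hν]
      refine Measurable.add (measurable_mulVec mp C) ?_
      exact (comap_measurable v).mono (le_sup_right.trans le_sup_right) le_rfl
    have me' : Measurable[MeasurableSpace.comap e inferInstance ⊔
        (MeasurableSpace.comap w inferInstance ⊔ MeasurableSpace.comap v inferInstance)] e' := by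
      rw [he']
      exact Measurable.add mp (measurable_mulVec mν _)
    have hle := sup_le he.comap_le (sup_le hw.comap_le hv.comap_le)
    refine indep_sup_right (me'.mono hle le_rfl).comap_le (mν.mono hle le_rfl).comap_le hm ?_ ?_
    · rw [← IndepFun_iff_Indep]
      exact indepFun_of_secondMoment_eq_zero hjoint e'0 e'ν
    · exact indep_of_indep_of_le_left (indep_error_noise_received hm he hw hv hind hewv)
        (sup_le me'.comap_le mν.comap_le)

end KalmanStep


theorem measurable_smul_const {Ω : Type*} {m : MeasurableSpace Ω} {a : ℕ} {f : Ω → Fin a → ℝ}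
    (hf : Measurable f) (c : ℝ) : Measurable fun ω => c • f ω := hf.const_smul c

namespace System

variable {n m q : ℕ} {Ω : Type*}

/-! ### The received data and the control-driven part of the state -/

/-- The part of the state trajectory driven by the input. -/
def forced (s : System n m q Ω) (u : ℕ → Ω → Fin m → ℝ) : ℕ → Ω → Fin n → ℝ
  | 0 => fun _ => 0
  | k + 1 => fun ω => s.A *ᵥ s.forced u k ω + s.B *ᵥ u k ω

theorem state_eq_add_forced (s : System n m q Ω) (u : ℕ → Ω → Fin m → ℝ) (k : ℕ) (ω : Ω) :
    s.state u k ω = s.state 0 k ω + s.forced u k ω := by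
  induction k with
  | zero => simp [state, forced]
  | succ k ih =>
    simp only [state, forced, ih, mulVec_add, Pi.zero_apply, mulVec_zero]
    abel

theorem receivedSigma_succ (s : System n m q Ω) (γ : ℕ → ℝ) (u : ℕ → Ω → Fin m → ℝ) (k : ℕ) :
    s.receivedSigma γ u (k + 1) = s.receivedSigma γ u k ⊔
      MeasurableSpace.comap (fun ω => γ (k + 1) • s.output u (k + 1) ω) inferInstance := by
  apply le_antisymm
  · refine iSup₂_le fun j hj => ?_
    rw [Finset.mem_Icc] at hj
    rcases Nat.lt_or_ge k j with h | h
    · obtain rfl : j = k + 1 := by omega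
      exact le_sup_right
    · exact le_sup_of_le_left (le_iSup₂_of_le j (Finset.mem_Icc.2 ⟨hj.1, h⟩) le_rfl)
  · refine sup_le (iSup₂_le fun j hj => ?_) ?_
    · rw [Finset.mem_Icc] at hj
      exact le_iSup₂_of_le j (Finset.mem_Icc.2 ⟨hj.1, by omega⟩) le_rfl
    · exact le_iSup₂_of_le (k + 1) (Finset.mem_Icc.2 ⟨by omega, le_rfl⟩) le_rfl

theorem receivedSigma_zero (s : System n m q Ω) (γ : ℕ → ℝ) (u : ℕ → Ω → Fin m → ℝ) :
    s.receivedSigma γ u 0 = ⊥ := by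
  simp [receivedSigma]

theorem receivedSigma_mono (s : System n m q Ω) (γ : ℕ → ℝ) (u : ℕ → Ω → Fin m → ℝ) :
    Monotone (s.receivedSigma γ u) :=
  monotone_nat_of_le_succ fun k => by rw [receivedSigma_succ]; exact le_sup_left

variable {s : System n m q Ω} {γ : ℕ → ℝ} {u : ℕ → Ω → Fin m → ℝ}

/-- The driven part at time `k` involves inputs only up to `k - 1`, hence the slack `k ≤ l + 1`: it
is already known one step before the measurement it affects. -/
theorem measurable_forced {k : ℕ}
    (hu : ∀ j < k, Measurable[s.receivedSigma γ 0 j] (u j)) {l : ℕ} (hl : k ≤ l + 1) :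
    Measurable[s.receivedSigma γ 0 l] (s.forced u k) := by
  induction k with
  | zero => exact measurable_const
  | succ k ih =>
    refine Measurable.add (measurable_mulVec (ih (fun j hj => hu j (by omega)) (by omega)) _)
      (measurable_mulVec ?_ _)
    exact (hu k (by omega)).mono (s.receivedSigma_mono γ 0 (by omega)) le_rfl

theorem output_eq_add_forced (s : System n m q Ω) (u : ℕ → Ω → Fin m → ℝ) (k : ℕ) (ω : Ω) :
    s.output u k ω = s.output 0 k ω + s.C *ᵥ s.forced u k ω := by
  simp only [output, state_eq_add_forced s u k ω, mulVec_add]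
  abel

/-- The data received by the server carry the same information as for the uncontrolled system. -/
theorem receivedSigma_eq {k : ℕ} (hu : ∀ j < k, Measurable[s.receivedSigma γ 0 j] (u j)) :
    s.receivedSigma γ u k = s.receivedSigma γ 0 k := by
  induction k with
  | zero => rw [receivedSigma_zero, receivedSigma_zero]
  | succ k ih =>
    -- The effect of the inputs on the measurement at `k + 1` is known at time `k`; adding or
    -- subtracting it leaves the generated σ-algebra unchanged.
    have hf := measurable_forced hu (l := k) le_rfl
    rw [receivedSigma_succ, receivedSigma_succ, ih fun j hj => hu j (by omega)]
    have hfC : Measurable[s.receivedSigma γ 0 k]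
        fun ω => γ (k + 1) • (s.C *ᵥ s.forced u (k + 1) ω) :=
      (measurable_mulVec hf s.C).const_smul (γ (k + 1))
    apply le_antisymm
    · refine sup_le le_sup_left (Measurable.comap_le ?_)
      have h : (fun ω => γ (k + 1) • s.output u (k + 1) ω) = fun ω =>
          γ (k + 1) • s.output 0 (k + 1) ω + γ (k + 1) • (s.C *ᵥ s.forced u (k + 1) ω) := by
        ext1 ω
        rw [output_eq_add_forced, smul_add]
      rw [h]
      exact Measurable.add ((comap_measurable _).mono le_sup_right le_rfl)
        (hfC.mono le_sup_left le_rfl)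
    · refine sup_le le_sup_left (Measurable.comap_le ?_)
      have h : (fun ω => γ (k + 1) • s.output 0 (k + 1) ω) = fun ω =>
          γ (k + 1) • s.output u (k + 1) ω - γ (k + 1) • (s.C *ᵥ s.forced u (k + 1) ω) := by
        ext1 ω
        rw [output_eq_add_forced s u, smul_add, add_sub_cancel_right]
      rw [h]
      exact Measurable.sub ((comap_measurable _).mono le_sup_right le_rfl)
        (hfC.mono le_sup_left le_rfl)

/-- The information set of an input depends on the input itself. Strong induction removes this
circularity and replaces it by a filtration common to all inputs. -/
theorem admissible_iff :
    s.Admissible γ u ↔ ∀ k, Measurable[s.receivedSigma γ 0 k] (u k) := by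
  constructor
  · intro h k
    induction k using Nat.strong_induction_on with
    | _ k ih =>
      refine (h k).mono ?_ le_rfl
      refine sup_le (receivedSigma_eq ih).le (iSup₂_le fun j hj => ?_)
      rw [Finset.mem_range] at hj
      exact ((ih j hj).mono (s.receivedSigma_mono γ 0 hj.le) le_rfl).comap_le
  · intro h k
    refine (h k).mono ?_ le_rfl
    rw [← receivedSigma_eq (u := u) fun j _ => h j]
    exact le_sup_left

/-! ### The Kalman filter -/

/-- The Kalman gain for the predicted error covariance `X`. -/
def filterGain (s : System n m q Ω) (X : Matrix (Fin n) (Fin n) ℝ) : Matrix (Fin n) (Fin q) ℝ :=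
  X * s.Cᵀ * (s.C * X * s.Cᵀ + s.R)⁻¹

/-- The Kalman filter of the uncontrolled system. -/
def filterState (s : System n m q Ω) (γ : ℕ → ℝ) (xbar0 : Fin n → ℝ)
    (Sigma0 : Matrix (Fin n) (Fin n) ℝ) : ℕ → Ω → Fin n → ℝ
  | 0 => fun _ => xbar0
  | k + 1 => fun ω => open scoped Classical in
      s.A *ᵥ s.filterState γ xbar0 Sigma0 k ω +
        if γ (k + 1) = 0 then 0 else s.filterGain (s.h (s.filterCov γ Sigma0 k)) *ᵥ
          (s.output 0 (k + 1) ω - s.C *ᵥ (s.A *ᵥ s.filterState γ xbar0 Sigma0 k ω))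

/-- The estimation error of the Kalman filter. -/
def filterError (s : System n m q Ω) (γ : ℕ → ℝ) (xbar0 : Fin n → ℝ)
    (Sigma0 : Matrix (Fin n) (Fin n) ℝ) (k : ℕ) (ω : Ω) : Fin n → ℝ :=
  s.state 0 k ω - s.filterState γ xbar0 Sigma0 k ω

variable {xbar0 : Fin n → ℝ} {Sigma0 : Matrix (Fin n) (Fin n) ℝ}

theorem filterError_succ_of_zero {k : ℕ} (hγ : γ (k + 1) = 0) :
    s.filterError γ xbar0 Sigma0 (k + 1) =
      fun ω => s.A *ᵥ s.filterError γ xbar0 Sigma0 k ω + s.w k ω := by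
  ext1 ω
  simp only [filterError, state, filterState, hγ, if_true, mulVec_sub, Pi.zero_apply, mulVec_zero]
  abel

/-- The innovation of the Kalman filter. -/
def innovation (s : System n m q Ω) (γ : ℕ → ℝ) (xbar0 : Fin n → ℝ)
    (Sigma0 : Matrix (Fin n) (Fin n) ℝ) (k : ℕ) (ω : Ω) : Fin q → ℝ :=
  s.C *ᵥ (s.A *ᵥ s.filterError γ xbar0 Sigma0 k ω + s.w k ω) + s.v (k + 1) ω

theorem output_succ_eq (k : ℕ) (ω : Ω) :
    s.output 0 (k + 1) ω = s.innovation γ xbar0 Sigma0 k ω +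
      s.C *ᵥ (s.A *ᵥ s.filterState γ xbar0 Sigma0 k ω) := by
  simp only [output, innovation, filterError, state, mulVec_sub, mulVec_add, Pi.zero_apply,
    mulVec_zero]
  abel

theorem filterError_succ {k : ℕ} (hγ : γ (k + 1) ≠ 0) :
    s.filterError γ xbar0 Sigma0 (k + 1) =
      fun ω => (s.A *ᵥ s.filterError γ xbar0 Sigma0 k ω + s.w k ω) +
        (-s.filterGain (s.h (s.filterCov γ Sigma0 k))) *ᵥ s.innovation γ xbar0 Sigma0 k ω := by
  ext1 ω
  simp only [filterError, filterState, if_neg hγ]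
  rw [output_succ_eq (γ := γ) (xbar0 := xbar0) (Sigma0 := Sigma0), add_sub_cancel_right]
  simp only [state, mulVec_sub, neg_mulVec, Pi.zero_apply, mulVec_zero]
  abel

theorem measurable_filterState (s : System n m q Ω) (γ : ℕ → ℝ) (xbar0 : Fin n → ℝ)
    (Sigma0 : Matrix (Fin n) (Fin n) ℝ) (k : ℕ) :
    Measurable[s.receivedSigma γ 0 k] (s.filterState γ xbar0 Sigma0 k) := by
  induction k with
  | zero => exact measurable_const
  | succ k ih =>
    have ih' := measurable_mulVec (ih.mono (s.receivedSigma_mono γ 0 k.le_succ) le_rfl) s.A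
    refine Measurable.add ih' ?_
    by_cases hγ : γ (k + 1) = 0
    · simp only [hγ, if_true]
      exact measurable_const
    · simp only [hγ, if_false]
      refine measurable_mulVec (Measurable.sub ?_ (measurable_mulVec ih' _)) _
      -- A nonzero `γ` can be divided out, so the transmitted value determines the measurement.
      have h : s.output 0 (k + 1) = fun ω => (γ (k + 1))⁻¹ • γ (k + 1) • s.output 0 (k + 1) ω := by
        ext1 ω
        rw [inv_smul_smul₀ hγ]
      rw [h, receivedSigma_succ]
      exact measurable_smul_const ((comap_measurable fun ω =>
        γ (k + 1) • s.output 0 (k + 1) ω).mono le_sup_right le_rfl) _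

/-! ### The noise filtration -/

/-- The σ-algebras of the initial state and of the noise variables. -/
abbrev noiseSigma (s : System n m q Ω) : Unit ⊕ ℕ ⊕ ℕ → MeasurableSpace Ω :=
  Sum.elim (fun _ : Unit => MeasurableSpace.comap s.x0 inferInstance)
    (Sum.elim (fun k : ℕ => MeasurableSpace.comap (s.w k) inferInstance)
      (fun k : ℕ => MeasurableSpace.comap (s.v k) inferInstance))

/-- The noise variables that have acted up to time `k`. -/
def pastIndex (k : ℕ) : Set (Unit ⊕ ℕ ⊕ ℕ) :=
  {i | ∀ j : ℕ, (i = Sum.inr (Sum.inl j) → j < k) ∧ (i = Sum.inr (Sum.inr j) → j ≤ k)}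

/-- The σ-algebra of the noise variables that have acted up to time `k`. -/
abbrev pastSigma (s : System n m q Ω) (k : ℕ) : MeasurableSpace Ω :=
  ⨆ i ∈ pastIndex k, s.noiseSigma i

theorem pastSigma_mono (s : System n m q Ω) : Monotone s.pastSigma := fun _ _ hkl =>
  biSup_mono fun _ hi j => ⟨fun h => ((hi j).1 h).trans_le hkl, fun h => ((hi j).2 h).trans hkl⟩

theorem measurable_pastSigma_x0 (k : ℕ) : Measurable[s.pastSigma k] s.x0 :=
  (comap_measurable s.x0).mono
    (le_iSup₂_of_le (f := fun i _ => s.noiseSigma i) (Sum.inl ()) (by simp [pastIndex]) le_rfl) le_rfl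

theorem measurable_pastSigma_w {j k : ℕ} (h : j < k) : Measurable[s.pastSigma k] (s.w j) :=
  (comap_measurable (s.w j)).mono
    (le_iSup₂_of_le (f := fun i _ => s.noiseSigma i) (Sum.inr (Sum.inl j))
      (by simpa [pastIndex] using h) le_rfl) le_rfl

theorem measurable_pastSigma_v {j k : ℕ} (h : j ≤ k) : Measurable[s.pastSigma k] (s.v j) :=
  (comap_measurable (s.v j)).mono
    (le_iSup₂_of_le (f := fun i _ => s.noiseSigma i) (Sum.inr (Sum.inr j))
      (by simpa [pastIndex] using h) le_rfl) le_rfl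

theorem measurable_pastSigma_state (s : System n m q Ω) (k : ℕ) :
    Measurable[s.pastSigma k] (s.state 0 k) := by
  induction k with
  | zero => exact measurable_pastSigma_x0 0
  | succ k ih =>
    refine Measurable.add (Measurable.add (measurable_mulVec
      (ih.mono (s.pastSigma_mono k.le_succ) le_rfl) _) ?_) (measurable_pastSigma_w k.lt_succ_self)
    exact measurable_mulVec (f := fun _ => 0) measurable_const _

theorem receivedSigma_le_pastSigma (s : System n m q Ω) (γ : ℕ → ℝ) (k : ℕ) :
    s.receivedSigma γ 0 k ≤ s.pastSigma k := by
  refine iSup₂_le fun j hj => Measurable.comap_le ?_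
  rw [Finset.mem_Icc] at hj
  exact measurable_smul_const (Measurable.add (measurable_mulVec
    ((s.measurable_pastSigma_state j).mono (s.pastSigma_mono hj.2) le_rfl) _)
    (measurable_pastSigma_v hj.2)) _

theorem measurable_pastSigma_filterError (s : System n m q Ω) (γ : ℕ → ℝ) (xbar0 : Fin n → ℝ)
    (Sigma0 : Matrix (Fin n) (Fin n) ℝ) (k : ℕ) :
    Measurable[s.pastSigma k] (s.filterError γ xbar0 Sigma0 k) :=
  Measurable.sub (s.measurable_pastSigma_state k)
    ((s.measurable_filterState γ xbar0 Sigma0 k).mono (s.receivedSigma_le_pastSigma γ k) le_rfl)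

variable [mΩ : MeasurableSpace Ω] {μ : Measure Ω} [IsProbabilityMeasure μ]

omit [IsProbabilityMeasure μ] in
theorem GaussianData.noiseSigma_le (hdata : s.GaussianData μ xbar0 Sigma0)
    (i : Unit ⊕ ℕ ⊕ ℕ) : s.noiseSigma i ≤ mΩ := by
  rcases i with _ | k | k
  · exact hdata.measurable_x0.comap_le
  · exact (hdata.measurable_w k).comap_le
  · exact (hdata.measurable_v k).comap_le

omit [IsProbabilityMeasure μ] in
theorem GaussianData.pastSigma_le (hdata : s.GaussianData μ xbar0 Sigma0) (k : ℕ) :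
    s.pastSigma k ≤ mΩ := iSup₂_le fun i _ => hdata.noiseSigma_le i

omit [IsProbabilityMeasure μ] in
theorem GaussianData.receivedSigma_le (hdata : s.GaussianData μ xbar0 Sigma0) (γ : ℕ → ℝ)
    (k : ℕ) : s.receivedSigma γ 0 k ≤ mΩ :=
  (s.receivedSigma_le_pastSigma γ k).trans (hdata.pastSigma_le k)

omit [IsProbabilityMeasure μ] in
theorem GaussianData.indep_past_noise (hdata : s.GaussianData μ xbar0 Sigma0) (k : ℕ) :
    Indep (s.pastSigma k) (MeasurableSpace.comap (s.w k) inferInstance ⊔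
      MeasurableSpace.comap (s.v (k + 1)) inferInstance) μ := by
  have hd : Disjoint (pastIndex k)
      ({Sum.inr (Sum.inl k), Sum.inr (Sum.inr (k + 1))} : Set (Unit ⊕ ℕ ⊕ ℕ)) := by
    rw [Set.disjoint_left]
    rintro i hi (rfl | rfl)
    · exact lt_irrefl _ ((hi k).1 rfl)
    · exact absurd ((hi (k + 1)).2 rfl) (by omega)
  have h := indep_iSup_of_disjoint hdata.noiseSigma_le hdata.indep hd
  rwa [iSup_pair] at h

omit [IsProbabilityMeasure μ] in
theorem GaussianData.indepFun_w_v (hdata : s.GaussianData μ xbar0 Sigma0) (k : ℕ) :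
    IndepFun (s.w k) (s.v (k + 1)) μ := by
  rw [IndepFun_iff_Indep]
  exact hdata.indep.indep (i := Sum.inr (Sum.inl k)) (j := Sum.inr (Sum.inr (k + 1))) (by simp)

theorem GaussianData.centered_w (hdata : s.GaussianData μ xbar0 Sigma0) (hQ : s.Q.PosSemidef)
    (k : ℕ) : HasGaussianLaw (s.w k) μ ∧ (∀ i, ∫ ω, s.w k ω i ∂μ = 0) ∧
      secondMoment μ (s.w k) (s.w k) = s.Q := by
  have := centered_of_hasLaw_multivariateGaussian (X := s.w k) (x := 0) hQ
    (by simpa using hdata.law_w k)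
  simpa using this

theorem GaussianData.centered_v (hdata : s.GaussianData μ xbar0 Sigma0) (hR : s.R.PosDef)
    (k : ℕ) : HasGaussianLaw (s.v k) μ ∧ (∀ i, ∫ ω, s.v k ω i ∂μ = 0) ∧
      secondMoment μ (s.v k) (s.v k) = s.R := by
  have := centered_of_hasLaw_multivariateGaussian (X := s.v k) (x := 0) hR.posSemidef
    (by simpa using hdata.law_v k)
  simpa using this

/-- The error of the Kalman filter is a centred Gaussian vector with covariance `filterCov`, and it
is independent of the received data. -/
theorem GaussianData.filterError_spec (hdata : s.GaussianData μ xbar0 Sigma0)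
    (hS : Sigma0.PosSemidef) (hQ : s.Q.PosSemidef) (hR : s.R.PosDef) (γ : ℕ → ℝ) (k : ℕ) :
    HasGaussianLaw (s.filterError γ xbar0 Sigma0 k) μ ∧
      (∀ i, ∫ ω, s.filterError γ xbar0 Sigma0 k ω i ∂μ = 0) ∧
      secondMoment μ (s.filterError γ xbar0 Sigma0 k) (s.filterError γ xbar0 Sigma0 k) =
        s.filterCov γ Sigma0 k ∧
      Indep (MeasurableSpace.comap (s.filterError γ xbar0 Sigma0 k) inferInstance)
        (s.receivedSigma γ 0 k) μ := by
  induction k with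
  | zero =>
    obtain ⟨h1, h2, h3⟩ := centered_of_hasLaw_multivariateGaussian hS hdata.law_x0
    refine ⟨h1, h2, h3, ?_⟩
    rw [receivedSigma_zero]
    exact indep_bot_right _
  | succ k ih =>
    obtain ⟨ge, e0, e2, hind⟩ := ih
    obtain ⟨gw, w0, w2⟩ := hdata.centered_w hQ k
    obtain ⟨gv, v0, v2⟩ := hdata.centered_v hR (k + 1)
    have hmp := s.measurable_pastSigma_filterError γ xbar0 Sigma0 k
    have he := hmp.mono (hdata.pastSigma_le k) le_rfl
    have hw := hdata.measurable_w k
    have hv := hdata.measurable_v (k + 1)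
    have hm := hdata.receivedSigma_le γ k
    have hwv := hdata.indepFun_w_v k
    have hewv := indep_of_indep_of_le_left (hdata.indep_past_noise k)
      (sup_le hmp.comap_le (s.receivedSigma_le_pastSigma γ k))
    by_cases hγ : γ (k + 1) = 0
    · have h := kalman_predict (A := s.A) hm he hw hv ge gw gv e0 w0 e2 w2 hwv hind hewv
      rw [filterError_succ_of_zero hγ, filterCov, if_pos hγ, receivedSigma_succ, hγ]
      -- Without a transmission the received value is the constant `0` and adds no information.
      simp only [zero_smul, MeasurableSpace.comap_const, sup_bot_eq]
      exact h
    · obtain ⟨h1, h2, h3, h4⟩ := kalman_update (A := s.A) (C := s.C) hR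
        (filterCov_posSemidef hQ hR γ hS k) hQ hm he hw hv ge gw gv e0 w0 v0 e2 w2 v2
        hwv hind hewv (X := s.h (s.filterCov γ Sigma0 k)) rfl rfl rfl
        (ν := s.innovation γ xbar0 Sigma0 k) rfl (filterError_succ hγ)
      rw [filterCov, if_neg hγ]
      -- The new measurement differs from the innovation by a prediction computed from old data, so
      -- independence from the innovation and the old data is enough.
      refine ⟨h1, h2, h3, indep_of_indep_of_le_right h4 ?_⟩
      rw [receivedSigma_succ]
      refine sup_le le_sup_right (Measurable.comap_le (measurable_smul_const ?_ _))
      have h : s.output 0 (k + 1) = fun ω => s.innovation γ xbar0 Sigma0 k ω +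
          s.C *ᵥ (s.A *ᵥ s.filterState γ xbar0 Sigma0 k ω) := by
        ext1 ω
        rw [← output_succ_eq]
      rw [h]
      refine Measurable.add ((comap_measurable _).mono le_sup_left le_rfl)
        (measurable_mulVec (measurable_mulVec ?_ _) _)
      exact (s.measurable_filterState γ xbar0 Sigma0 k).mono le_sup_right le_rfl

end System


/-- Coercivity of `U` bounds each squared component by the input cost. Finite cost thus forces
square integrability, which need not be part of admissibility. -/
theorem memLp_two_of_lintegral_quad_ne_top {Ω : Type*} [MeasurableSpace Ω] {μ : Measure Ω} {m : ℕ}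
    {U : Matrix (Fin m) (Fin m) ℝ} (hU : U.PosDef) {u : Ω → Fin m → ℝ} (hu : Measurable u)
    (h : ∫⁻ ω, ENNReal.ofReal (u ω ⬝ᵥ (U *ᵥ u ω)) ∂μ ≠ ⊤) : MemLp u 2 μ := by
  obtain ⟨c, hc, hcu⟩ := exists_pos_mul_le_quad hU
  refine MemLp.of_eval fun i => ?_
  have hui : Measurable fun ω => u ω i := (measurable_pi_apply i).comp hu
  rw [memLp_two_iff_integrable_sq hui.aestronglyMeasurable]
  refine ⟨(hui.pow_const 2).aestronglyMeasurable, ?_⟩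
  rw [hasFiniteIntegral_iff_ofReal (ae_of_all _ fun ω => sq_nonneg _)]
  have h1 : ∀ ω, ENNReal.ofReal (u ω i ^ 2) ≤
      ENNReal.ofReal c⁻¹ * ENNReal.ofReal (u ω ⬝ᵥ (U *ᵥ u ω)) := fun ω => by
    rw [← ENNReal.ofReal_mul (by positivity)]
    refine ENNReal.ofReal_le_ofReal ?_
    rw [le_inv_mul_iff₀ hc]
    refine le_trans (mul_le_mul_of_nonneg_left ?_ hc.le) (hcu (u ω))
    rw [pow_two]
    exact Finset.single_le_sum (f := fun i => u ω i * u ω i) (fun j _ => mul_self_nonneg _)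
      (Finset.mem_univ i)
  refine (lintegral_mono h1).trans_lt ?_
  rw [lintegral_const_mul' _ _ ENNReal.ofReal_ne_top]
  exact ENNReal.mul_lt_top ENNReal.ofReal_lt_top h.lt_top

namespace System

variable {n m q : ℕ} {Ω : Type*} {s : System n m q Ω} {γ : ℕ → ℝ} {u : ℕ → Ω → Fin m → ℝ}
  {xbar0 : Fin n → ℝ} {Sigma0 : Matrix (Fin n) (Fin n) ℝ}
  [mΩ : MeasurableSpace Ω] {μ : Measure Ω} [IsProbabilityMeasure μ]

/-! ### Square integrability -/

omit [IsProbabilityMeasure μ] in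
theorem memLp_forced {k : ℕ} (hu : ∀ j < k, MemLp (u j) 2 μ) : MemLp (s.forced u k) 2 μ := by
  induction k with
  | zero => exact MemLp.zero'
  | succ k ih =>
    exact (MemLp.mulVec (ih fun j hj => hu j (by omega)) s.A).add
      (MemLp.mulVec (hu k (by omega)) s.B)

theorem GaussianData.memLp_freeState (hdata : s.GaussianData μ xbar0 Sigma0)
    (hS : Sigma0.PosSemidef) (hQ : s.Q.PosSemidef) (k : ℕ) : MemLp (s.state 0 k) 2 μ := by
  induction k with
  | zero =>
    have h := (centered_of_hasLaw_multivariateGaussian hS hdata.law_x0).1.memLp_two.add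
      (memLp_const xbar0)
    refine h.ae_eq (ae_of_all _ fun ω => ?_)
    simp [state]
  | succ k ih =>
    refine MemLp.add (MemLp.add (MemLp.mulVec ih s.A) ?_) (hdata.centered_w hQ k).1.memLp_two
    exact MemLp.mulVec (X := fun _ => 0) MemLp.zero' s.B

theorem GaussianData.memLp_state (hdata : s.GaussianData μ xbar0 Sigma0)
    (hS : Sigma0.PosSemidef) (hQ : s.Q.PosSemidef) {k : ℕ} (hu : ∀ j < k, MemLp (u j) 2 μ) :
    MemLp (s.state u k) 2 μ := by
  have h : s.state u k = fun ω => s.state 0 k ω + s.forced u k ω :=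
    funext fun ω => state_eq_add_forced s u k ω
  rw [h]
  exact (hdata.memLp_freeState hS hQ k).add (memLp_forced hu)

theorem GaussianData.memLp_filterState (hdata : s.GaussianData μ xbar0 Sigma0)
    (hS : Sigma0.PosSemidef) (hQ : s.Q.PosSemidef) (hR : s.R.PosDef) (γ : ℕ → ℝ) (k : ℕ) :
    MemLp (s.filterState γ xbar0 Sigma0 k) 2 μ := by
  refine ((hdata.memLp_freeState hS hQ k).sub
    (hdata.filterError_spec hS hQ hR γ k).1.memLp_two).ae_eq (ae_of_all _ fun ω => ?_)
  simp [filterError]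

/-! ### The conditional mean and the conditional error covariance -/

/-- The conditional mean of the controlled system. -/
def controlledFilter (s : System n m q Ω) (γ : ℕ → ℝ) (xbar0 : Fin n → ℝ)
    (Sigma0 : Matrix (Fin n) (Fin n) ℝ) (u : ℕ → Ω → Fin m → ℝ) (k : ℕ) (ω : Ω) : Fin n → ℝ :=
  s.filterState γ xbar0 Sigma0 k ω + s.forced u k ω

omit mΩ in
theorem state_eq_controlledFilter_add (s : System n m q Ω) (γ : ℕ → ℝ) (xbar0 : Fin n → ℝ)
    (Sigma0 : Matrix (Fin n) (Fin n) ℝ) (u : ℕ → Ω → Fin m → ℝ) (k : ℕ) (ω : Ω) :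
    s.state u k ω =
      s.controlledFilter γ xbar0 Sigma0 u k ω + s.filterError γ xbar0 Sigma0 k ω := by
  rw [state_eq_add_forced, controlledFilter, filterError]
  abel

omit mΩ in
theorem measurable_controlledFilter (hu : ∀ k, Measurable[s.receivedSigma γ 0 k] (u k)) (k : ℕ) :
    Measurable[s.receivedSigma γ 0 k] (s.controlledFilter γ xbar0 Sigma0 u k) :=
  Measurable.add (s.measurable_filterState γ xbar0 Sigma0 k)
    (measurable_forced (fun j _ => hu j) k.le_succ)

theorem GaussianData.memLp_controlledFilter (hdata : s.GaussianData μ xbar0 Sigma0)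
    (hS : Sigma0.PosSemidef) (hQ : s.Q.PosSemidef) (hR : s.R.PosDef) (γ : ℕ → ℝ) {k : ℕ}
    (hu : ∀ j < k, MemLp (u j) 2 μ) : MemLp (s.controlledFilter γ xbar0 Sigma0 u k) 2 μ :=
  (hdata.memLp_filterState hS hQ hR γ k).add (memLp_forced hu)

/-- The state splits into a part measurable for the data and a centred error independent of them. -/
theorem GaussianData.estimate_ae_eq (hdata : s.GaussianData μ xbar0 Sigma0)
    (hS : Sigma0.PosSemidef) (hQ : s.Q.PosSemidef) (hR : s.R.PosDef)
    (hu : ∀ k, Measurable[s.receivedSigma γ 0 k] (u k)) {k : ℕ}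
    (hu2 : ∀ j < k, MemLp (u j) 2 μ) :
    s.estimate μ γ u k =ᵐ[μ] s.controlledFilter γ xbar0 Sigma0 u k := by
  obtain ⟨ge, e0, -, hind⟩ := hdata.filterError_spec hS hQ hR γ k
  have hm := hdata.receivedSigma_le γ k
  have hξ := (hdata.memLp_controlledFilter hS hQ hR γ hu2).integrable one_le_two
  have hmean : ∫ ω, s.filterError γ xbar0 Sigma0 k ω ∂μ = 0 := by
    ext i
    rw [eval_integral fun i => ge.integrable.eval i]
    exact e0 i
  rw [estimate, receivedSigma_eq fun j _ => hu j]
  have hx : s.state u k =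
      s.controlledFilter γ xbar0 Sigma0 u k + s.filterError γ xbar0 Sigma0 k :=
    funext fun ω => state_eq_controlledFilter_add s γ xbar0 Sigma0 u k ω
  rw [hx]
  have h1 := condExp_add hξ ge.integrable (s.receivedSigma γ 0 k)
  rw [condExp_of_stronglyMeasurable hm (measurable_controlledFilter hu k).stronglyMeasurable hξ] at h1
  have he := (s.measurable_pastSigma_filterError γ xbar0 Sigma0 k).mono
    (hdata.pastSigma_le k) le_rfl
  have h2 := condExp_indep_eq he.comap_le hm
    (comap_measurable (s.filterError γ xbar0 Sigma0 k)).stronglyMeasurable hind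
  filter_upwards [h1, h2] with ω h1 h2
  rw [h1, Pi.add_apply, h2, hmean, add_zero]

/-- The estimation error is almost surely the filter error, whose products are independent of the
data; conditioning therefore returns their plain expectation. -/
theorem GaussianData.errorCov_ae_eq (hdata : s.GaussianData μ xbar0 Sigma0)
    (hS : Sigma0.PosSemidef) (hQ : s.Q.PosSemidef) (hR : s.R.PosDef)
    (hu : ∀ k, Measurable[s.receivedSigma γ 0 k] (u k)) {k : ℕ}
    (hu2 : ∀ j < k, MemLp (u j) 2 μ) :
    ∀ᵐ ω ∂μ, s.errorCov μ γ u k ω = s.filterCov γ Sigma0 k := by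
  obtain ⟨ge, e0, e2, hind⟩ := hdata.filterError_spec hS hQ hR γ k
  have hm := hdata.receivedSigma_le γ k
  have he := (s.measurable_pastSigma_filterError γ xbar0 Sigma0 k).mono
    (hdata.pastSigma_le k) le_rfl
  have hest := hdata.estimate_ae_eq hS hQ hR hu hu2
  have h : ∀ i j, ∀ᵐ ω ∂μ, s.errorCov μ γ u k ω i j = s.filterCov γ Sigma0 k i j := by
    intro i j
    have h1 : (fun ω' => (s.state u k ω' i - s.estimate μ γ u k ω' i)
        * (s.state u k ω' j - s.estimate μ γ u k ω' j)) =ᵐ[μ]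
        fun ω' => s.filterError γ xbar0 Sigma0 k ω' i * s.filterError γ xbar0 Sigma0 k ω' j := by
      filter_upwards [hest] with ω hω
      rw [hω, state_eq_controlledFilter_add s γ xbar0 Sigma0 u k ω]
      simp
    have h2 := condExp_indep_eq (μ := μ)
      (f := fun ω' => s.filterError γ xbar0 Sigma0 k ω' i * s.filterError γ xbar0 Sigma0 k ω' j)
      he.comap_le hm (Measurable.stronglyMeasurable (Measurable.mul
        ((measurable_pi_apply i).comp (comap_measurable _))
        ((measurable_pi_apply j).comp (comap_measurable _)))) hind
    rw [← e2]
    simp only [errorCov, of_apply]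
    rw [receivedSigma_eq fun j _ => hu j]
    filter_upwards [condExp_congr_ae (m := s.receivedSigma γ 0 k) h1, h2] with ω h3 h4
    rw [h3, h4]
    rfl
  filter_upwards [ae_all_iff.2 fun i => ae_all_iff.2 (h i)] with ω hω
  ext i j
  exact hω i j

/-! ### The expected cost -/

omit mΩ in
theorem stageCost_nonneg (hW : s.W.PosSemidef) (hU : s.U.PosDef) (u : ℕ → Ω → Fin m → ℝ)
    (k : ℕ) (ω : Ω) : 0 ≤ s.stageCost u k ω :=
  add_nonneg (PosSemidef.quad_nonneg hW _) (PosSemidef.quad_nonneg hU.posSemidef _)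

/-- The excess cost of the input over the optimal feedback, for the continuation cost `X`. -/
def excess (s : System n m q Ω) (γ : ℕ → ℝ) (xbar0 : Fin n → ℝ)
    (Sigma0 : Matrix (Fin n) (Fin n) ℝ) (u : ℕ → Ω → Fin m → ℝ) (X : Matrix (Fin n) (Fin n) ℝ)
    (k : ℕ) (ω : Ω) : ℝ :=
  (u k ω - s.gain X *ᵥ s.controlledFilter γ xbar0 Sigma0 u k ω) ⬝ᵥ
    ((s.Bᵀ * X * s.B + s.U) *ᵥ (u k ω - s.gain X *ᵥ s.controlledFilter γ xbar0 Sigma0 u k ω))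

omit mΩ in
theorem excess_nonneg (hU : s.U.PosDef) {X : Matrix (Fin n) (Fin n) ℝ} (hX : X.PosSemidef)
    (u : ℕ → Ω → Fin m → ℝ) (k : ℕ) (ω : Ω) : 0 ≤ s.excess γ xbar0 Sigma0 u X k ω :=
  PosSemidef.quad_nonneg (posDef_congr_add s.B hU hX).posSemidef _

omit mΩ in
-- Identifies `Φ` as the weight on the estimation error: acting on the estimate instead of the state
-- perturbs the optimal input by the gain times that error.
theorem gain_transpose_mul_mul_gain (hU : s.U.PosDef) {X : Matrix (Fin n) (Fin n) ℝ}
    (hX : X.PosSemidef) :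
    (s.gain X)ᵀ * (s.Bᵀ * X * s.B + s.U) * s.gain X = s.Phi X := by
  have hM := posDef_congr_add s.B hU hX
  set M := s.Bᵀ * X * s.B + s.U with hMdef
  have hMs : Mᵀ = M := PosSemidef.transpose_eq hM.posSemidef
  have hMi : M * M⁻¹ = 1 := mul_nonsing_inv _ ((isUnit_iff_isUnit_det _).1 hM.isUnit)
  have hPhi : s.Phi X = s.Aᵀ * X * s.B * M⁻¹ * s.Bᵀ * X * s.A := by
    rw [Phi, hMdef, add_comm]
  rw [gain, ← hMdef, hPhi]
  simp only [transpose_neg, transpose_mul, transpose_transpose, transpose_nonsing_inv, hMs,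
    PosSemidef.transpose_eq hX, Matrix.neg_mul, Matrix.mul_neg, neg_neg]
  simp only [Matrix.mul_assoc]
  rw [← Matrix.mul_assoc M M⁻¹, hMi, Matrix.one_mul]

theorem GaussianData.integrable_stageCost (hdata : s.GaussianData μ xbar0 Sigma0)
    (hS : Sigma0.PosSemidef) (hQ : s.Q.PosSemidef) {k : ℕ} (hu2 : ∀ j < k + 1, MemLp (u j) 2 μ) :
    Integrable (s.stageCost u k) μ := by
  have hx := hdata.memLp_state hS hQ (u := u) (k := k) fun j hj => hu2 j (by omega)
  exact (integrable_dotProduct_mulVec hx hx s.W).add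
    (integrable_dotProduct_mulVec (hu2 k (by omega)) (hu2 k (by omega)) s.U)

/-- One step of the dynamic programming recursion. -/
theorem GaussianData.integral_step (hdata : s.GaussianData μ xbar0 Sigma0)
    (hS : Sigma0.PosSemidef) (hQ : s.Q.PosSemidef) (hR : s.R.PosDef) (hU : s.U.PosDef)
    (hu : ∀ k, Measurable[s.receivedSigma γ 0 k] (u k)) {k : ℕ}
    (hu2 : ∀ j < k + 1, MemLp (u j) 2 μ) {X : Matrix (Fin n) (Fin n) ℝ} (hX : X.PosSemidef) :
    ∫ ω, s.stageCost u k ω ∂μ + ∫ ω, s.state u (k + 1) ω ⬝ᵥ (X *ᵥ s.state u (k + 1) ω) ∂μ =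
      ∫ ω, s.state u k ω ⬝ᵥ (s.riccati X *ᵥ s.state u k ω) ∂μ + (X * s.Q).trace +
        (s.Phi X * s.filterCov γ Sigma0 k).trace +
        ∫ ω, s.excess γ xbar0 Sigma0 u X k ω ∂μ := by
  obtain ⟨ge, e0, e2, hind⟩ := hdata.filterError_spec hS hQ hR γ k
  obtain ⟨gw, w0, w2⟩ := hdata.centered_w hQ k
  have lx := hdata.memLp_state hS hQ (u := u) (k := k) fun j hj => hu2 j (by omega)
  have lx' := hdata.memLp_state hS hQ hu2
  have lu := hu2 k (by omega)
  have lξ := hdata.memLp_controlledFilter hS hQ hR γ (u := u) (k := k) fun j hj => hu2 j (by omega)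
  have le := ge.memLp_two
  have lw := gw.memLp_two
  set L := s.gain X with hL
  set M := s.Bᵀ * X * s.B + s.U with hM
  let z : Ω → Fin n → ℝ := fun ω => s.A *ᵥ s.state u k ω + s.B *ᵥ u k ω
  let d : Ω → Fin m → ℝ := fun ω => u k ω - L *ᵥ s.controlledFilter γ xbar0 Sigma0 u k ω
  have lz : MemLp z 2 μ := (MemLp.mulVec lx s.A).add (MemLp.mulVec lu s.B)
  have ld : MemLp d 2 μ := lu.sub (MemLp.mulVec lξ L)
  have lLe := MemLp.mulVec le L
  have hXs := PosSemidef.transpose_eq hX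
  have hMs : Mᵀ = M := PosSemidef.transpose_eq (posDef_congr_add s.B hU hX).posSemidef
  have hpw : ∀ ω, s.stageCost u k ω + s.state u (k + 1) ω ⬝ᵥ (X *ᵥ s.state u (k + 1) ω) =
      s.state u k ω ⬝ᵥ (s.riccati X *ᵥ s.state u k ω) + d ω ⬝ᵥ (M *ᵥ d ω)
        + -2 * (d ω ⬝ᵥ (M *ᵥ (L *ᵥ s.filterError γ xbar0 Sigma0 k ω)))
        + (L *ᵥ s.filterError γ xbar0 Sigma0 k ω) ⬝ᵥ (M *ᵥ (L *ᵥ s.filterError γ xbar0 Sigma0 k ω))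
        + 2 * (z ω ⬝ᵥ (X *ᵥ s.w k ω)) + s.w k ω ⬝ᵥ (X *ᵥ s.w k ω) := by
    intro ω
    have h1 := complete_square s.A s.B s.W hU hX (s.state u k ω) (u k ω)
    -- The deviation from full-state feedback splits into a part `d` known to the server and the
    -- gain applied to the estimation error.
    have h2 : u k ω - dareGain s.A s.B s.U X *ᵥ s.state u k ω =
        d ω + -(L *ᵥ s.filterError γ xbar0 Sigma0 k ω) := by
      have : dareGain s.A s.B s.U X = L := rfl
      simp only [d]
      rw [this, state_eq_controlledFilter_add s γ xbar0 Sigma0 u k ω, mulVec_add]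
      abel
    rw [h2, quad_add hMs] at h1
    have h3 : s.state u (k + 1) ω = z ω + s.w k ω := rfl
    rw [h3, quad_add hXs, stageCost]
    simp only [mulVec_neg, dotProduct_neg, neg_dotProduct, neg_neg] at h1
    have h4 : dare s.A s.B s.W s.U X = s.riccati X := rfl
    rw [h4] at h1
    linear_combination h1
  -- The state and input at time `k` depend only on noises that act before `w k`.
  have hwz : secondMoment μ (s.w k) z = 0 := by
    refine secondMoment_eq_zero_of_indepFun lw lz ?_ w0
    rw [IndepFun_iff_Indep]
    refine (indep_of_indep_of_le (hdata.indep_past_noise k) ?_ le_sup_left).symm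
    refine Measurable.comap_le ?_
    have hu' : ∀ j, Measurable[s.pastSigma j] (u j) := fun j =>
      (hu j).mono (s.receivedSigma_le_pastSigma γ j) le_rfl
    have hx : Measurable[s.pastSigma k] (s.state u k) := by
      have h : s.state u k = fun ω => s.state 0 k ω + s.forced u k ω :=
        funext fun ω => state_eq_add_forced s u k ω
      rw [h]
      exact Measurable.add (s.measurable_pastSigma_state k)
        ((measurable_forced (fun j _ => hu j) k.le_succ).mono
          (s.receivedSigma_le_pastSigma γ k) le_rfl)
    exact Measurable.add (measurable_mulVec hx _) (measurable_mulVec (hu' k) _)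
  -- `d` is a function of the data and the error is centred and independent of them: no cross term
  -- couples estimation and control.
  have hed : secondMoment μ (s.filterError γ xbar0 Sigma0 k) d = 0 := by
    refine secondMoment_eq_zero_of_indepFun le ld ?_ e0
    rw [IndepFun_iff_Indep]
    refine indep_of_indep_of_le_right hind (Measurable.comap_le ?_)
    exact Measurable.sub (hu k) (measurable_mulVec (measurable_controlledFilter hu k) _)
  have i1 := integrable_dotProduct_mulVec lx lx (s.riccati X)
  have i2 := integrable_dotProduct_mulVec ld ld M
  have i3 := (integrable_dotProduct_mulVec ld lLe M).const_mul (-2)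
  have i4 := integrable_dotProduct_mulVec lLe lLe M
  have i5 := (integrable_dotProduct_mulVec lz lw X).const_mul 2
  have i6 := integrable_dotProduct_mulVec lw lw X
  rw [← integral_add (hdata.integrable_stageCost hS hQ hu2)
    (integrable_dotProduct_mulVec lx' lx' X)]
  simp_rw [hpw]
  have j2 := i1.fun_add i2
  have j3 := j2.fun_add i3
  have j4 := j3.fun_add i4
  rw [integral_add (j4.fun_add i5) i6, integral_add j4 i5, integral_add j3 i4,
    integral_add j2 i3, integral_add i1 i2, integral_const_mul, integral_const_mul,
    integral_dotProduct_mulVec ld lLe, integral_dotProduct_mulVec lLe lLe,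
    integral_dotProduct_mulVec lz lw, integral_dotProduct_mulVec lw lw, hwz, w2,
    secondMoment_mulVec_left le ld, hed, secondMoment_mulVec_left le lLe,
    secondMoment_mulVec_right le le, e2]
  have h5 : (M * (L * (s.filterCov γ Sigma0 k * Lᵀ))).trace =
      (s.Phi X * s.filterCov γ Sigma0 k).trace := by
    rw [← gain_transpose_mul_mul_gain hU hX, ← Matrix.mul_assoc, ← Matrix.mul_assoc, trace_mul_comm]
    simp only [Matrix.mul_assoc, hL, hM]
  rw [h5]
  simp only [excess, Matrix.mul_zero, trace_zero, mul_zero, add_zero]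
  ring

/-- The expected cost of an input in terms of a solution of the Riccati recursion. -/
theorem GaussianData.integral_cost (hdata : s.GaussianData μ xbar0 Sigma0)
    (hS : Sigma0.PosSemidef) (hQ : s.Q.PosSemidef) (hR : s.R.PosDef) (hU : s.U.PosDef)
    (hu : ∀ k, Measurable[s.receivedSigma γ 0 k] (u k)) {N : ℕ}
    (hu2 : ∀ j < N, MemLp (u j) 2 μ) {X : ℕ → Matrix (Fin n) (Fin n) ℝ}
    (hX : ∀ k, (X k).PosSemidef) (hrec : ∀ k < N, X k = s.riccati (X (k + 1))) :
    ∑ k ∈ Finset.range N, ∫ ω, s.stageCost u k ω ∂μ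
        + ∫ ω, s.state u N ω ⬝ᵥ (X N *ᵥ s.state u N ω) ∂μ =
      ∫ ω, s.x0 ω ⬝ᵥ (X 0 *ᵥ s.x0 ω) ∂μ +
        ∑ k ∈ Finset.range N, ((X (k + 1) * s.Q).trace +
          (s.Phi (X (k + 1)) * s.filterCov γ Sigma0 k).trace) +
        ∑ k ∈ Finset.range N, ∫ ω, s.excess γ xbar0 Sigma0 u (X (k + 1)) k ω ∂μ := by
  induction N with
  | zero => simp [state]
  | succ N ih =>
    have h1 := ih (fun j hj => hu2 j (by omega)) fun k hk => hrec k (by omega)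
    have h2 := hdata.integral_step hS hQ hR hU hu (k := N) hu2 (hX (N + 1))
    rw [← hrec N (by omega)] at h2
    rw [Finset.sum_range_succ, Finset.sum_range_succ, Finset.sum_range_succ]
    linear_combination h1 + h2

theorem GaussianData.runningCost_eq (hdata : s.GaussianData μ xbar0 Sigma0)
    (hS : Sigma0.PosSemidef) (hQ : s.Q.PosSemidef) (hW : s.W.PosSemidef) (hU : s.U.PosDef) {N : ℕ}
    (hu2 : ∀ j < N, MemLp (u j) 2 μ) :
    s.runningCost μ u N = ENNReal.ofReal (∑ k ∈ Finset.range N, ∫ ω, s.stageCost u k ω ∂μ) := by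
  have hi : ∀ k ∈ Finset.range N, Integrable (s.stageCost u k) μ := fun k hk =>
    hdata.integrable_stageCost hS hQ fun j hj => hu2 j (by
      have := Finset.mem_range.1 hk
      omega)
  rw [runningCost, ← integral_finsetSum _ hi, ofReal_integral_eq_lintegral_ofReal
    (integrable_finsetSum _ hi)
    (ae_of_all _ fun ω => Finset.sum_nonneg fun k _ => stageCost_nonneg hW hU u k ω)]

theorem GaussianData.horizonCost_eq (hdata : s.GaussianData μ xbar0 Sigma0)
    (hS : Sigma0.PosSemidef) (hQ : s.Q.PosSemidef) (hW : s.W.PosSemidef) (hU : s.U.PosDef) {N : ℕ}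
    (hu2 : ∀ j < N, MemLp (u j) 2 μ) :
    s.horizonCost μ u N = ENNReal.ofReal (∑ k ∈ Finset.range N, ∫ ω, s.stageCost u k ω ∂μ
      + ∫ ω, s.state u N ω ⬝ᵥ (s.W *ᵥ s.state u N ω) ∂μ) := by
  have hi : ∀ k ∈ Finset.range N, Integrable (s.stageCost u k) μ := fun k hk =>
    hdata.integrable_stageCost hS hQ fun j hj => hu2 j (by
      have := Finset.mem_range.1 hk
      omega)
  have lx := hdata.memLp_state hS hQ hu2
  have hx := integrable_dotProduct_mulVec lx lx s.W
  rw [horizonCost, ← integral_finsetSum _ hi, ← integral_add (integrable_finsetSum _ hi) hx,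
    ofReal_integral_eq_lintegral_ofReal ((integrable_finsetSum _ hi).fun_add hx)]
  exact ae_of_all _ fun ω => add_nonneg (Finset.sum_nonneg fun k _ => stageCost_nonneg hW hU u k ω)
    (PosSemidef.quad_nonneg hW _)

omit [IsProbabilityMeasure μ] in
-- The terminal weight is the stage weight `W`, so the terminal cost is part of stage `N`. This
-- carries finite-horizon lower bounds over to the average cost.
theorem horizonCost_le_runningCost (hU : s.U.PosDef) (u : ℕ → Ω → Fin m → ℝ) (N : ℕ) :
    s.horizonCost μ u N ≤ s.runningCost μ u (N + 1) := by
  refine lintegral_mono fun ω => ENNReal.ofReal_le_ofReal ?_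
  rw [Finset.sum_range_succ]
  refine add_le_add_right ?_ _
  exact le_add_of_nonneg_right (PosSemidef.quad_nonneg hU.posSemidef _)

omit [IsProbabilityMeasure μ] in
theorem memLp_of_horizonCost_ne_top (hW : s.W.PosSemidef) (hU : s.U.PosDef)
    (hu : ∀ k, Measurable (u k)) {N : ℕ} (h : s.horizonCost μ u N ≠ ⊤) :
    ∀ j < N, MemLp (u j) 2 μ := by
  intro j hj
  refine memLp_two_of_lintegral_quad_ne_top hU (hu j) (ne_top_of_le_ne_top h ?_)
  refine lintegral_mono fun ω => ENNReal.ofReal_le_ofReal ?_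
  calc u j ω ⬝ᵥ (s.U *ᵥ u j ω) ≤ s.stageCost u j ω :=
        le_add_of_nonneg_left (PosSemidef.quad_nonneg hW _)
    _ ≤ ∑ k ∈ Finset.range N, s.stageCost u k ω :=
        Finset.single_le_sum (f := fun k => s.stageCost u k ω)
          (fun k _ => stageCost_nonneg hW hU u k ω) (Finset.mem_range.2 hj)
    _ ≤ _ := le_add_of_nonneg_right (PosSemidef.quad_nonneg hW _)

/-- For every gain sequence there is an admissible input that feeds back the conditional mean. -/
theorem GaussianData.exists_feedback (hdata : s.GaussianData μ xbar0 Sigma0)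
    (hS : Sigma0.PosSemidef) (hQ : s.Q.PosSemidef) (hR : s.R.PosDef) (γ : ℕ → ℝ)
    (L : ℕ → Matrix (Fin m) (Fin n) ℝ) :
    ∃ u : ℕ → Ω → Fin m → ℝ, (∀ k, Measurable[s.receivedSigma γ 0 k] (u k)) ∧
      (∀ k, MemLp (u k) 2 μ) ∧
      ∀ k ω, u k ω = L k *ᵥ s.controlledFilter γ xbar0 Sigma0 u k ω := by
  -- The input is to feed back a filter that itself contains the driven part; the closed-loop driven
  -- part is therefore defined first by its own recursion.
  let f : ℕ → Ω → Fin n → ℝ := fun k => Nat.rec (fun _ => 0) (fun k g ω =>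
    s.A *ᵥ g ω + s.B *ᵥ (L k *ᵥ (s.filterState γ xbar0 Sigma0 k ω + g ω))) k
  let u : ℕ → Ω → Fin m → ℝ := fun k ω => L k *ᵥ (s.filterState γ xbar0 Sigma0 k ω + f k ω)
  have hf : ∀ k, s.forced u k = f k := by
    intro k
    induction k with
    | zero => rfl
    | succ k ih => rw [forced, ih]
  have huf : ∀ k ω, u k ω = L k *ᵥ s.controlledFilter γ xbar0 Sigma0 u k ω := fun k ω => by
    rw [controlledFilter, hf]
  have huf' : ∀ k, u k = fun ω => L k *ᵥ s.controlledFilter γ xbar0 Sigma0 u k ω := fun k =>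
    funext (huf k)
  refine ⟨u, fun k => ?_, fun k => ?_, huf⟩
  · induction k using Nat.strong_induction_on with
    | _ k ih =>
      rw [huf']
      exact measurable_mulVec (Measurable.add (s.measurable_filterState γ xbar0 Sigma0 k)
        (measurable_forced ih k.le_succ)) _
  · induction k using Nat.strong_induction_on with
    | _ k ih =>
      rw [huf']
      exact MemLp.mulVec (hdata.memLp_controlledFilter hS hQ hR γ ih) _

end System


namespace System

variable {n m q : ℕ} {Ω : Type*} {s : System n m q Ω} {γ : ℕ → ℝ}

/-! ### Dependence on the schedule -/

theorem receivedSigma_congr {γ γ' : ℕ → ℝ} (h : ∀ k, 1 ≤ k → γ k = γ' k) :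
    s.receivedSigma γ = s.receivedSigma γ' := by
  ext1 u
  ext1 k
  refine iSup_congr fun j => iSup_congr fun hj => ?_
  rw [h j (Finset.mem_Icc.1 hj).1]

/-- The schedules differ at time `0`, which the received data never involve. -/
theorem periodicSchedule_one_eq (k : ℕ) (hk : 1 ≤ k) : fullSchedule k = periodicSchedule 1 k := by
  have : ∃ l : ℕ, k = l * 1 + 1 := ⟨k - 1, by omega⟩
  simp only [fullSchedule, periodicSchedule, if_pos this]

theorem admissible_fullSchedule_iff {u : ℕ → Ω → Fin m → ℝ} :
    s.Admissible fullSchedule u ↔ s.Admissible (periodicSchedule 1) u := by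
  rw [admissible_iff, admissible_iff, receivedSigma_congr (s := s) periodicSchedule_one_eq]

/-! ### The control Riccati recursion -/

theorem riccatiIter_succ (s : System n m q Ω) (j : ℕ) :
    s.riccatiIter (j + 1) = s.riccati (s.riccatiIter j) := by
  rw [riccatiIter, Function.iterate_succ_apply', riccatiIter]

theorem riccatiIter_posSemidef (hW : s.W.PosSemidef) (hU : s.U.PosDef) (j : ℕ) :
    (s.riccatiIter j).PosSemidef :=
  dare_iterate_posSemidef s.A s.B hW hU hW j

theorem exists_control_steadyState (hW : s.W.PosSemidef) (hU : s.U.PosDef)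
    (hctrl : Controllable s.A s.B) :
    ∃ S : Matrix (Fin n) (Fin n) ℝ, S.PosSemidef ∧ Tendsto s.riccatiIter atTop (𝓝 S) ∧
      S = s.riccati S := by
  obtain ⟨S, hS, hlim, hfix, -⟩ :=
    exists_tendsto_dare_iterate_zero hW hU (hctrl.finiteCost s.W s.U)
  refine ⟨S, hS, ((tendsto_add_atTop_iff_nat 1).2 hlim).congr fun j => ?_, hfix⟩
  -- `W` is the first iterate from `0`, so the recursion started at `W` is a shift of the monotone
  -- one and needs no detectability of the state cost.
  have h0 : dare s.A s.B s.W s.U 0 = s.W := by simp [dare]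
  rw [Function.iterate_succ_apply, h0]
  rfl

theorem tendsto_Phi (hU : s.U.PosDef) {X : ℕ → Matrix (Fin n) (Fin n) ℝ}
    {S : Matrix (Fin n) (Fin n) ℝ} (hS : S.PosSemidef) (h : Tendsto X atTop (𝓝 S)) :
    Tendsto (fun k => s.Phi (X k)) atTop (𝓝 (s.Phi S)) := by
  have hc {a b : ℕ} (M : Matrix (Fin a) (Fin b) ℝ) : Tendsto (fun _ : ℕ => M) atTop (𝓝 M) :=
    tendsto_const_nhds
  have hM : Tendsto (fun k => (s.U + s.Bᵀ * X k * s.B)⁻¹) atTop (𝓝 (s.U + s.Bᵀ * S * s.B)⁻¹) := by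
    refine tendsto_matrix_inv ?_ ((tendsto_matrix_mul (tendsto_matrix_mul (hc _) h) (hc _)).const_add _)
    rw [add_comm]
    exact (posDef_congr_add s.B hU hS).isUnit
  have h1 := tendsto_matrix_mul (hc s.Aᵀ) h
  exact tendsto_matrix_mul (tendsto_matrix_mul (tendsto_matrix_mul (tendsto_matrix_mul
      (tendsto_matrix_mul h1 (hc s.B)) hM) (hc s.Bᵀ)) h) (hc s.A)

end System

/-! ### Averages of traces -/

section Average

variable {n : ℕ}

theorem tendsto_trace_mul {M : ℕ → Matrix (Fin n) (Fin n) ℝ} {N Y : Matrix (Fin n) (Fin n) ℝ}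
    (h : Tendsto M atTop (𝓝 N)) : Tendsto (fun k => (M k * Y).trace) atTop (𝓝 (N * Y).trace) :=
  ((by fun_prop : Continuous fun X : Matrix (Fin n) (Fin n) ℝ => (X * Y).trace).tendsto N).comp h

theorem abs_trace_mul_le {M P : Matrix (Fin n) (Fin n) ℝ} {D : ℝ} (hD : ∀ i j, |P i j| ≤ D) :
    |(M * P).trace| ≤ (∑ i, ∑ j, |M i j|) * D := by
  simp only [Matrix.trace, diag_apply, Matrix.mul_apply, Finset.sum_mul]
  refine (Finset.abs_sum_le_sum_abs _ _).trans (Finset.sum_le_sum fun i _ => ?_)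
  refine (Finset.abs_sum_le_sum_abs _ _).trans (Finset.sum_le_sum fun j _ => ?_)
  rw [abs_mul]
  exact mul_le_mul_of_nonneg_left (hD j i) (abs_nonneg _)

theorem cesaro_reflect {f : ℕ → ℝ} {a : ℝ} (h : Tendsto f atTop (𝓝 a)) :
    Tendsto (fun N : ℕ => (N : ℝ)⁻¹ * ∑ k ∈ Finset.range N, f (N - (k + 1))) atTop (𝓝 a) := by
  refine h.cesaro.congr fun N => ?_
  rw [← Finset.sum_range_reflect]
  congr 1
  refine Finset.sum_congr rfl fun k _ => ?_
  rw [Nat.sub_sub, add_comm 1 k]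

/-- Averages of `tr (M (N - 1 - k) P k)` for convergent `M` and bounded `P`. -/
theorem cesaro_trace_reflect {M P : ℕ → Matrix (Fin n) (Fin n) ℝ} {M' : Matrix (Fin n) (Fin n) ℝ}
    (hM : Tendsto M atTop (𝓝 M')) {D : ℝ} (hD : ∀ k i j, |P k i j| ≤ D) {a : ℝ}
    (ha : Tendsto (fun N : ℕ => (N : ℝ)⁻¹ * ∑ k ∈ Finset.range N, (M' * P k).trace) atTop (𝓝 a)) :
    Tendsto (fun N : ℕ => (N : ℝ)⁻¹ * ∑ k ∈ Finset.range N, (M (N - (k + 1)) * P k).trace) atTop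
      (𝓝 a) := by
  have hδ : Tendsto (fun j => (∑ i, ∑ l, |(M j - M') i l|) * D) atTop (𝓝 0) := by
    have hc : Continuous fun X : Matrix (Fin n) (Fin n) ℝ => (∑ i, ∑ l, |(X - M') i l|) * D := by
      simp only [Matrix.sub_apply]
      fun_prop
    exact (hc.tendsto' M' 0 (by simp)).comp hM
  -- With bounded `P`, replacing `M` by its limit costs at most the Cesàro mean, in reversed order,
  -- of a null sequence.
  have h0 : Tendsto (fun N : ℕ => (N : ℝ)⁻¹ *
      ∑ k ∈ Finset.range N, ((M (N - (k + 1)) - M') * P k).trace) atTop (𝓝 0) := by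
    refine squeeze_zero_norm (fun N => ?_) (cesaro_reflect hδ)
    rw [norm_mul, Real.norm_of_nonneg (by positivity : (0 : ℝ) ≤ (N : ℝ)⁻¹)]
    refine mul_le_mul_of_nonneg_left ?_ (by positivity)
    exact (Finset.abs_sum_le_sum_abs _ _).trans (Finset.sum_le_sum fun k _ => abs_trace_mul_le (hD k))
  have h1 := h0.add ha
  rw [zero_add] at h1
  refine h1.congr fun N => ?_
  rw [← mul_add, ← Finset.sum_add_distrib]
  congr 1
  refine Finset.sum_congr rfl fun k _ => ?_
  rw [Matrix.sub_mul, trace_sub, sub_add_cancel]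

end Average

namespace System

variable {n m q : ℕ} {Ω : Type*} {s : System n m q Ω} {γ : ℕ → ℝ}
  {xbar0 : Fin n → ℝ} {Sigma0 : Matrix (Fin n) (Fin n) ℝ}
  [mΩ : MeasurableSpace Ω] {μ : Measure Ω} [IsProbabilityMeasure μ]

/-! ### The finite horizon problem -/

/-- The optimal cost of the problem with horizon `N`. -/
def horizonValue (s : System n m q Ω) (μ : Measure Ω) (γ : ℕ → ℝ)
    (Sigma0 : Matrix (Fin n) (Fin n) ℝ) (N : ℕ) : ℝ :=
  ∫ ω, s.x0 ω ⬝ᵥ (s.riccatiIter N *ᵥ s.x0 ω) ∂μ +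
    ∑ k ∈ Finset.range N, ((s.riccatiIter (N - (k + 1)) * s.Q).trace +
      (s.Phi (s.riccatiIter (N - (k + 1))) * s.filterCov γ Sigma0 k).trace)

theorem GaussianData.horizonCost_eq_add_excess (hdata : s.GaussianData μ xbar0 Sigma0)
    (hS : Sigma0.PosSemidef) (hQ : s.Q.PosSemidef) (hR : s.R.PosDef) (hW : s.W.PosSemidef)
    (hU : s.U.PosDef) {u : ℕ → Ω → Fin m → ℝ}
    (hu : ∀ k, Measurable[s.receivedSigma γ 0 k] (u k)) {N : ℕ} (hu2 : ∀ j < N, MemLp (u j) 2 μ) :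
    s.horizonCost μ u N = ENNReal.ofReal (s.horizonValue μ γ Sigma0 N +
      ∑ k ∈ Finset.range N,
        ∫ ω, s.excess γ xbar0 Sigma0 u (s.riccatiIter (N - (k + 1))) k ω ∂μ) := by
  -- `S_k` is `riccatiIter (N - k)`, so stage `k` involves `S_{k+1}`, that is `riccatiIter (N - (k +
  -- 1))`.
  have h := hdata.integral_cost hS hQ hR hU hu hu2 (X := fun k => s.riccatiIter (N - k))
    (fun k => riccatiIter_posSemidef hW hU _) fun k hk => by
      rw [← riccatiIter_succ]
      congr 1
      omega
  have h0 : s.riccatiIter (N - N) = s.W := by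
    rw [Nat.sub_self]
    rfl
  simp only [h0, Nat.sub_zero] at h
  rw [hdata.horizonCost_eq hS hQ hW hU hu2, h, horizonValue]

theorem GaussianData.horizonValue_le (hdata : s.GaussianData μ xbar0 Sigma0)
    (hS : Sigma0.PosSemidef) (hQ : s.Q.PosSemidef) (hR : s.R.PosDef) (hW : s.W.PosSemidef)
    (hU : s.U.PosDef) {u : ℕ → Ω → Fin m → ℝ} (hu : s.Admissible γ u) (N : ℕ) :
    ENNReal.ofReal (s.horizonValue μ γ Sigma0 N) ≤ s.horizonCost μ u N := by
  rw [admissible_iff] at hu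
  by_cases h : s.horizonCost μ u N = ⊤
  · rw [h]
    exact le_top
  have hu2 := memLp_of_horizonCost_ne_top hW hU
    (fun k => (hu k).mono (hdata.receivedSigma_le γ k) le_rfl) h
  rw [hdata.horizonCost_eq_add_excess hS hQ hR hW hU hu hu2]
  refine ENNReal.ofReal_le_ofReal (le_add_of_nonneg_right (Finset.sum_nonneg fun k _ => ?_))
  exact integral_nonneg fun ω => excess_nonneg hU (riccatiIter_posSemidef hW hU _) u k ω

omit mΩ in
theorem excess_eq_zero {u : ℕ → Ω → Fin m → ℝ} {X : Matrix (Fin n) (Fin n) ℝ} {k : ℕ}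
    (h : ∀ ω, u k ω = s.gain X *ᵥ s.controlledFilter γ xbar0 Sigma0 u k ω) (ω : Ω) :
    s.excess γ xbar0 Sigma0 u X k ω = 0 := by
  rw [excess, ← h, sub_self]
  simp

theorem GaussianData.exists_horizon_optimal (hdata : s.GaussianData μ xbar0 Sigma0)
    (hS : Sigma0.PosSemidef) (hQ : s.Q.PosSemidef) (hR : s.R.PosDef) (hW : s.W.PosSemidef)
    (hU : s.U.PosDef) (γ : ℕ → ℝ) (N : ℕ) :
    0 ≤ s.horizonValue μ γ Sigma0 N ∧
    ∃ u : ℕ → Ω → Fin m → ℝ, s.Admissible γ u ∧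
      (∀ k, u k =ᵐ[μ] fun ω => s.gain (s.riccatiIter (N - (k + 1))) *ᵥ s.estimate μ γ u k ω) ∧
      s.horizonCost μ u N = ENNReal.ofReal (s.horizonValue μ γ Sigma0 N) := by
  obtain ⟨u, hu, hu2, huL⟩ := hdata.exists_feedback hS hQ hR γ
    fun k => s.gain (s.riccatiIter (N - (k + 1)))
  have hsum : ∑ k ∈ Finset.range N,
      ∫ ω, s.excess γ xbar0 Sigma0 u (s.riccatiIter (N - (k + 1))) k ω ∂μ = 0 :=
    Finset.sum_eq_zero fun k _ => by simp [excess_eq_zero (huL k)]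
  refine ⟨?_, u, admissible_iff.2 hu, fun k => ?_, ?_⟩
  -- The value equals the cost of an actual input, hence is nonnegative; this makes passing through
  -- `ENNReal.ofReal` lossless.
  · have h := hdata.integral_cost hS hQ hR hU hu (N := N) (fun j _ => hu2 j)
      (X := fun k => s.riccatiIter (N - k))
      (fun k => riccatiIter_posSemidef hW hU _) fun k hk => by
        rw [← riccatiIter_succ]
        congr 1
        omega
    simp only [Nat.sub_zero] at h
    rw [hsum, add_zero] at h
    rw [horizonValue, ← h]
    exact add_nonneg (Finset.sum_nonneg fun k _ => integral_nonneg fun ω =>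
      stageCost_nonneg hW hU u k ω) (integral_nonneg fun ω =>
        PosSemidef.quad_nonneg (riccatiIter_posSemidef hW hU _) _)
  · filter_upwards [hdata.estimate_ae_eq hS hQ hR hu (k := k) fun j _ => hu2 j] with ω hω
    rw [hω, ← huL]
  · rw [hdata.horizonCost_eq_add_excess hS hQ hR hW hU hu fun j _ => hu2 j, hsum, add_zero]

theorem GaussianData.optimalHorizonCost_eq (hdata : s.GaussianData μ xbar0 Sigma0)
    (hS : Sigma0.PosSemidef) (hQ : s.Q.PosSemidef) (hR : s.R.PosDef) (hW : s.W.PosSemidef)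
    (hU : s.U.PosDef) (γ : ℕ → ℝ) (N : ℕ) :
    s.optimalHorizonCost μ γ N = ENNReal.ofReal (s.horizonValue μ γ Sigma0 N) := by
  obtain ⟨-, u, hu, -, huN⟩ := hdata.exists_horizon_optimal hS hQ hR hW hU γ N
  refine le_antisymm ?_ (le_iInf₂ fun v hv => hdata.horizonValue_le hS hQ hR hW hU hv N)
  rw [← huN]
  exact iInf₂_le u hu

/-! ### Asymptotics -/

theorem GaussianData.tendsto_horizonValue (hdata : s.GaussianData μ xbar0 Sigma0)
    (hS : Sigma0.PosSemidef) (hQ : s.Q.PosSemidef) (hU : s.U.PosDef)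
    {S : Matrix (Fin n) (Fin n) ℝ} (hSp : S.PosSemidef) (hlim : Tendsto s.riccatiIter atTop (𝓝 S))
    {D : ℝ} (hD : ∀ k i j, |s.filterCov γ Sigma0 k i j| ≤ D) {a : ℝ}
    (ha : Tendsto (fun N : ℕ => (N : ℝ)⁻¹ *
      ∑ k ∈ Finset.range N, (s.Phi S * s.filterCov γ Sigma0 k).trace) atTop (𝓝 a)) :
    Tendsto (fun N : ℕ => (N : ℝ)⁻¹ * s.horizonValue μ γ Sigma0 N) atTop
      (𝓝 ((S * s.Q).trace + a)) := by
  have lx := hdata.memLp_freeState hS hQ 0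
  have h1 : Tendsto (fun N : ℕ => ∫ ω, s.x0 ω ⬝ᵥ (s.riccatiIter N *ᵥ s.x0 ω) ∂μ) atTop
      (𝓝 (S * secondMoment μ s.x0 s.x0).trace) := by
    simp_rw [fun N => integral_dotProduct_mulVec (X := s.x0) (Y := s.x0) lx lx (s.riccatiIter N)]
    exact tendsto_trace_mul hlim
  have h2 := (tendsto_inv_atTop_nhds_zero_nat (𝕜 := ℝ)).mul h1
  have h3 := cesaro_reflect (tendsto_trace_mul (Y := s.Q) hlim)
  have h4 := cesaro_trace_reflect (tendsto_Phi hU hSp hlim) hD ha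
  have h5 := h2.add (h3.add h4)
  rw [zero_mul, zero_add] at h5
  refine h5.congr fun N => ?_
  rw [horizonValue, Finset.sum_add_distrib]
  ring

/-- Every admissible input is bounded below by the averaged finite-horizon values, and the
stationary feedback is bounded above by the cost identity with constant `S`. The common limit also
makes the `limsup` of the optimal input a limit. -/
theorem GaussianData.average_optimal (hdata : s.GaussianData μ xbar0 Sigma0)
    (hS : Sigma0.PosSemidef) (hQ : s.Q.PosSemidef) (hR : s.R.PosDef) (hW : s.W.PosSemidef)
    (hU : s.U.PosDef) {S : Matrix (Fin n) (Fin n) ℝ} (hSp : S.PosSemidef)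
    (hlim : Tendsto s.riccatiIter atTop (𝓝 S)) (hfix : S = s.riccati S)
    {D : ℝ} (hD : ∀ k i j, |s.filterCov γ Sigma0 k i j| ≤ D) {a : ℝ}
    (ha : Tendsto (fun N : ℕ => (N : ℝ)⁻¹ *
      ∑ k ∈ Finset.range N, (s.Phi S * s.filterCov γ Sigma0 k).trace) atTop (𝓝 a)) :
    0 ≤ (S * s.Q).trace + a ∧
    s.optimalAverageCost μ γ = ENNReal.ofReal ((S * s.Q).trace + a) ∧
    ∃ u : ℕ → Ω → Fin m → ℝ, s.Admissible γ u ∧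
      (∀ k, u k =ᵐ[μ] fun ω => s.gain S *ᵥ s.estimate μ γ u k ω) ∧
      Tendsto (fun N : ℕ => s.runningCost μ u N / N) atTop
        (𝓝 (ENNReal.ofReal ((S * s.Q).trace + a))) := by
  set V := (S * s.Q).trace + a
  have hJ := hdata.tendsto_horizonValue hS hQ hU hSp hlim hD ha
  have hJ0 : ∀ N, 0 ≤ s.horizonValue μ γ Sigma0 N := fun N =>
    (hdata.exists_horizon_optimal hS hQ hR hW hU γ N).1
  have hV : 0 ≤ V := ge_of_tendsto' hJ fun N => mul_nonneg (by positivity) (hJ0 N)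
  -- The `N`-horizon value bounds the running cost of `N + 1` stages, hence the divisor `N + 1`; the
  -- factor `N / (N + 1)` tends to one.
  have hlow : Tendsto (fun N : ℕ =>
      ENNReal.ofReal (s.horizonValue μ γ Sigma0 N) / ((N + 1 : ℕ) : ℝ≥0∞)) atTop
      (𝓝 (ENNReal.ofReal V)) := by
    have h1 := hJ.mul (tendsto_natCast_div_add_atTop (1 : ℝ))
    rw [mul_one] at h1
    refine (ENNReal.tendsto_ofReal h1).congr' ?_
    filter_upwards [eventually_gt_atTop 0] with N hN
    have hN' : (0 : ℝ) < N := by exact_mod_cast hN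
    have h2 : (N : ℝ)⁻¹ * s.horizonValue μ γ Sigma0 N * (N / (N + 1)) =
        s.horizonValue μ γ Sigma0 N / ((N + 1 : ℕ) : ℝ) := by
      push_cast
      field_simp
    rw [h2, ENNReal.ofReal_div_of_pos (by positivity), ENNReal.ofReal_natCast]
  have hle : ∀ u : ℕ → Ω → Fin m → ℝ, s.Admissible γ u → ∀ N : ℕ,
      ENNReal.ofReal (s.horizonValue μ γ Sigma0 N) / ((N + 1 : ℕ) : ℝ≥0∞) ≤
        s.runningCost μ u (N + 1) / ((N + 1 : ℕ) : ℝ≥0∞) := fun u hu N =>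
    ENNReal.div_le_div_right ((hdata.horizonValue_le hS hQ hR hW hU hu N).trans
      (horizonCost_le_runningCost hU u N)) _
  have hlower : ∀ u : ℕ → Ω → Fin m → ℝ, s.Admissible γ u →
      ENNReal.ofReal V ≤ s.averageCost μ u := by
    intro u hu
    rw [← hlow.limsup_eq, averageCost, ← limsup_nat_add (fun N : ℕ => s.runningCost μ u N / N) 1]
    exact limsup_le_limsup (Eventually.of_forall (hle u hu))
  obtain ⟨u, hu, hu2, huL⟩ := hdata.exists_feedback hS hQ hR γ fun _ => s.gain S
  have hadm : s.Admissible γ u := admissible_iff.2 hu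
  set c := ∫ ω, s.x0 ω ⬝ᵥ (S *ᵥ s.x0 ω) ∂μ with hc
  -- The excess vanishes for this feedback, and the terminal term `x_N' S x_N ≥ 0` is discarded.
  have hrun : ∀ N : ℕ, s.runningCost μ u N ≤ ENNReal.ofReal (c + ∑ k ∈ Finset.range N,
      ((S * s.Q).trace + (s.Phi S * s.filterCov γ Sigma0 k).trace)) := by
    intro N
    rw [hdata.runningCost_eq hS hQ hW hU fun j _ => hu2 j]
    have h := hdata.integral_cost hS hQ hR hU hu (N := N) (fun j _ => hu2 j)
      (X := fun _ => S) (fun _ => hSp) fun _ _ => hfix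
    have hz : ∑ k ∈ Finset.range N, ∫ ω, s.excess γ xbar0 Sigma0 u S k ω ∂μ = 0 :=
      Finset.sum_eq_zero fun k _ => by simp [excess_eq_zero (huL k)]
    rw [hz, add_zero] at h
    rw [hc, ← h]
    exact ENNReal.ofReal_le_ofReal (le_add_of_nonneg_right
      (integral_nonneg fun ω => PosSemidef.quad_nonneg hSp _))
  have hup : Tendsto (fun N : ℕ => ENNReal.ofReal (c + ∑ k ∈ Finset.range (N + 1),
      ((S * s.Q).trace + (s.Phi S * s.filterCov γ Sigma0 k).trace)) / ((N + 1 : ℕ) : ℝ≥0∞)) atTop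
      (𝓝 (ENNReal.ofReal V)) := by
    have h1 : Tendsto (fun N : ℕ => (N : ℝ)⁻¹ * c + ((S * s.Q).trace + (N : ℝ)⁻¹ *
        ∑ k ∈ Finset.range N, (s.Phi S * s.filterCov γ Sigma0 k).trace)) atTop (𝓝 V) := by
      simpa using ((tendsto_inv_atTop_nhds_zero_nat (𝕜 := ℝ)).mul_const c).add
        (ha.const_add (S * s.Q).trace)
    refine (ENNReal.tendsto_ofReal ((tendsto_add_atTop_iff_nat 1).2 h1)).congr fun N => ?_
    have hN : (0 : ℝ) < ((N + 1 : ℕ) : ℝ) := by positivity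
    rw [← ENNReal.ofReal_natCast, ← ENNReal.ofReal_div_of_pos hN, Finset.sum_add_distrib,
      Finset.sum_const, Finset.card_range, nsmul_eq_mul]
    congr 1
    field_simp
  have htend : Tendsto (fun N : ℕ => s.runningCost μ u N / N) atTop (𝓝 (ENNReal.ofReal V)) := by
    rw [← tendsto_add_atTop_iff_nat 1]
    exact tendsto_of_tendsto_of_tendsto_of_le_of_le hlow hup (hle u hadm) fun N =>
      ENNReal.div_le_div_right (hrun (N + 1)) _
  refine ⟨hV, le_antisymm ?_ (le_iInf₂ hlower), u, hadm, fun k => ?_, htend⟩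
  · rw [← htend.limsup_eq]
    exact iInf₂_le u hadm
  · filter_upwards [hdata.estimate_ae_eq hS hQ hR hu (k := k) fun j _ => hu2 j] with ω hω
    rw [hω, ← huL]

/-! ### Averages along the periodic schedule -/

section Periodic

variable {T : ℕ} {P : Matrix (Fin n) (Fin n) ℝ}

omit mΩ in
theorem tendsto_average_filterCov (hT : 0 < T)
    (hP : ∀ i < T, Tendsto (fun l => s.filterCov (periodicSchedule T) Sigma0 (l * T + 1 + i)) atTop
      (𝓝 (s.h^[i] P))) :
    Tendsto (fun N : ℕ => (N : ℝ)⁻¹ •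
      ∑ k ∈ Finset.range N, s.filterCov (periodicSchedule T) Sigma0 k) atTop
      (𝓝 ((T : ℝ)⁻¹ • ∑ i ∈ Finset.range T, s.h^[i] P)) := by
  refine tendsto_pi_nhds.2 fun i => tendsto_pi_nhds.2 fun j => ?_
  have h := cesaro_of_tendsto_periodic (a := fun k => s.filterCov (periodicSchedule T) Sigma0 k i j)
    (b := fun l => (s.h^[l] P) i j) hT fun l hl =>
      tendsto_pi_nhds.1 (tendsto_pi_nhds.1 (hP l hl) i) j
  simpa only [Matrix.smul_apply, Matrix.sum_apply, smul_eq_mul] using h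

omit mΩ in
theorem exists_bound_filterCov (hT : 0 < T)
    (hP : ∀ i < T, Tendsto (fun l => s.filterCov (periodicSchedule T) Sigma0 (l * T + 1 + i)) atTop
      (𝓝 (s.h^[i] P))) :
    ∃ D, ∀ k i j, |s.filterCov (periodicSchedule T) Sigma0 k i j| ≤ D := by
  have h (i j : Fin n) := bounded_of_tendsto_periodic
    (a := fun k => s.filterCov (periodicSchedule T) Sigma0 k i j)
    (b := fun l => (s.h^[l] P) i j) hT fun l hl =>
      tendsto_pi_nhds.1 (tendsto_pi_nhds.1 (hP l hl) i) j
  choose D hD using h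
  have hD0 (i j : Fin n) : 0 ≤ D i j := (abs_nonneg _).trans (hD i j 0)
  refine ⟨∑ i, ∑ j, D i j, fun k i j => (hD i j k).trans ?_⟩
  calc D i j ≤ ∑ j, D i j :=
        Finset.single_le_sum (f := fun j => D i j) (fun j _ => hD0 i j) (Finset.mem_univ j)
    _ ≤ _ := Finset.single_le_sum (f := fun i => ∑ j, D i j)
        (fun i _ => Finset.sum_nonneg fun j _ => hD0 i j) (Finset.mem_univ i)

omit mΩ in
theorem tendsto_average_trace (hT : 0 < T) (M : Matrix (Fin n) (Fin n) ℝ)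
    (hP : ∀ i < T, Tendsto (fun l => s.filterCov (periodicSchedule T) Sigma0 (l * T + 1 + i)) atTop
      (𝓝 (s.h^[i] P))) :
    Tendsto (fun N : ℕ => (N : ℝ)⁻¹ *
      ∑ k ∈ Finset.range N, (M * s.filterCov (periodicSchedule T) Sigma0 k).trace) atTop
      (𝓝 (M * ((T : ℝ)⁻¹ • ∑ i ∈ Finset.range T, s.h^[i] P)).trace) := by
  have hc : Continuous fun X : Matrix (Fin n) (Fin n) ℝ => (M * X).trace := by fun_prop
  refine ((hc.tendsto _).comp (tendsto_average_filterCov hT hP)).congr fun N => ?_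
  simp only [Function.comp_apply, Matrix.mul_smul, trace_smul, Finset.mul_sum, trace_sum,
    smul_eq_mul]

theorem GaussianData.errorCov_periodic_ae_eq (hdata : s.GaussianData μ xbar0 Sigma0)
    (hS : Sigma0.PosSemidef) (hQ : s.Q.PosSemidef) (hR : s.R.PosDef) {u : ℕ → Ω → Fin m → ℝ}
    (hu : s.Admissible γ u) (hu2 : ∀ k, MemLp (u k) 2 μ) :
    ∀ᵐ ω ∂μ, ∀ k, s.errorCov μ γ u k ω = s.filterCov γ Sigma0 k :=
  ae_all_iff.2 fun _ => hdata.errorCov_ae_eq hS hQ hR (admissible_iff.1 hu) fun j _ => hu2 j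

end Periodic

omit [IsProbabilityMeasure μ] in
theorem errorCov_fullSchedule :
    s.errorCov μ fullSchedule = s.errorCov μ (periodicSchedule 1) := by
  have h := receivedSigma_congr (s := s) periodicSchedule_one_eq
  unfold errorCov estimate
  rw [h]

omit [IsProbabilityMeasure μ] in
theorem optimalAverageCost_fullSchedule :
    s.optimalAverageCost μ fullSchedule = s.optimalAverageCost μ (periodicSchedule 1) := by
  simp only [optimalAverageCost, admissible_fullSchedule_iff]

end System

end LQG

end

/-! ### Optimal costs of the two schedules and the loss between them -/

theorem theorem2 {n m q : ℕ} {Ω : Type*} [MeasurableSpace Ω] (μ : Measure Ω)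
    [IsProbabilityMeasure μ] (s : LQG.System n m q Ω)
    (xbar0 : Fin n → ℝ) (Sigma0 : Matrix (Fin n) (Fin n) ℝ)
    (hSigma0 : Sigma0.PosSemidef) (hQ : s.Q.PosSemidef) (hR : s.R.PosDef)
    (hW : s.W.PosSemidef) (hU : s.U.PosDef)
    (hdata : s.GaussianData μ xbar0 Sigma0)
    (hctrl : LQG.Controllable s.A s.B)
    (hstab : LQG.Stabilizable s.A (LQG.psdSqrt s.Q))
    (hdet : LQG.Detectable s.C s.A)
    (T : ℕ) (hT : 1 ≤ T) (hdetT : LQG.Detectable s.C (s.A ^ T)) :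
    ∃ S Ptilde Qpriv : Matrix (Fin n) (Fin n) ℝ,
      -- `S` is the steady value of the control Riccati recursion, and solves the Riccati equation
      (S.PosSemidef ∧ Tendsto s.riccatiIter atTop (𝓝 S) ∧ S = s.riccati S) ∧
      -- `Ptilde` is the unique positive semidefinite fixed point of `g ∘ h^(T-1)`
      (Ptilde.PosSemidef ∧ Ptilde = s.g (s.h^[T - 1] Ptilde) ∧
        ∀ X : Matrix (Fin n) (Fin n) ℝ, X.PosSemidef → X = s.g (s.h^[T - 1] X) → X = Ptilde) ∧
      -- `Qpriv` is the averaged privacy metric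
      (∀ u u' : ℕ → Ω → Fin m → ℝ,
        s.Admissible (LQG.periodicSchedule T) u → (∀ k, MemLp (u k) 2 μ) →
        s.Admissible LQG.fullSchedule u' → (∀ k, MemLp (u' k) 2 μ) →
        ∀ᵐ ω ∂μ, Tendsto (fun N : ℕ => (N : ℝ)⁻¹ • ∑ k ∈ Finset.range N,
          (s.errorCov μ (LQG.periodicSchedule T) u k ω
            - s.errorCov μ LQG.fullSchedule u' k ω)) atTop (𝓝 Qpriv)) ∧
      -- the optimal finite-horizon costs are finite, are attained by `u k = L k x̂ k`, and
      -- their averages converge to the stated value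
      (∀ N : ℕ, s.optimalHorizonCost μ (LQG.periodicSchedule T) N ≠ ⊤ ∧
        ∃ u : ℕ → Ω → Fin m → ℝ, s.Admissible (LQG.periodicSchedule T) u ∧
          (∀ k < N, u k =ᵐ[μ] fun ω => s.gain (s.riccatiIter (N - (k + 1))) *ᵥ
            s.estimate μ (LQG.periodicSchedule T) u k ω) ∧
          s.horizonCost μ u N = s.optimalHorizonCost μ (LQG.periodicSchedule T) N) ∧
      Tendsto (fun N : ℕ => (N : ℝ)⁻¹ *
          (s.optimalHorizonCost μ (LQG.periodicSchedule T) N).toReal) atTop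
        (𝓝 ((S * s.Q).trace +
          (s.Phi S * ((T : ℝ)⁻¹ • ∑ i ∈ Finset.range T, s.h^[i] Ptilde)).trace)) ∧
      -- the optimal infinite-horizon average cost is finite and has the stated value
      s.optimalAverageCost μ (LQG.periodicSchedule T) ≠ ⊤ ∧
      (s.optimalAverageCost μ (LQG.periodicSchedule T)).toReal =
        (S * s.Q).trace +
          (s.Phi S * ((T : ℝ)⁻¹ • ∑ i ∈ Finset.range T, s.h^[i] Ptilde)).trace ∧
      -- it is attained, as a limit, by the steady-state control law `u k = L x̂ k`
      (∃ u : ℕ → Ω → Fin m → ℝ, s.Admissible (LQG.periodicSchedule T) u ∧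
        (∀ k, u k =ᵐ[μ] fun ω => s.gain S *ᵥ s.estimate μ (LQG.periodicSchedule T) u k ω) ∧
        Tendsto (fun N : ℕ => s.runningCost μ u N / N) atTop
          (𝓝 (s.optimalAverageCost μ (LQG.periodicSchedule T)))) ∧
      -- the loss with respect to the ordinary system
      s.optimalAverageCost μ LQG.fullSchedule ≠ ⊤ ∧
      (s.optimalAverageCost μ (LQG.periodicSchedule T)).toReal
          - (s.optimalAverageCost μ LQG.fullSchedule).toReal
        = (s.Phi S * Qpriv).trace := by
  obtain ⟨S, hSp, hlim, hfix⟩ := LQG.System.exists_control_steadyState hW hU hctrl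
  obtain ⟨P, hP, hPfix, hPu, hPlim⟩ :=
    LQG.System.exists_periodic_steadyState hQ hR hstab hT hdetT
  -- The ordinary system is treated as the schedule of period one.
  obtain ⟨P₁, -, -, -, hP₁lim⟩ :=
    LQG.System.exists_periodic_steadyState hQ hR hstab le_rfl ((pow_one s.A).symm ▸ hdet)
  have hlimT := hPlim Sigma0 hSigma0
  have hlim₁ := hP₁lim Sigma0 hSigma0
  obtain ⟨D, hD⟩ := LQG.System.exists_bound_filterCov hT hlimT
  obtain ⟨D₁, hD₁⟩ := LQG.System.exists_bound_filterCov one_pos hlim₁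
  have ha := LQG.System.tendsto_average_trace hT (s.Phi S) hlimT
  obtain ⟨hV, hopt, hatt⟩ := hdata.average_optimal hSigma0 hQ hR hW hU hSp hlim hfix hD ha
  obtain ⟨hV₁, hopt₁, -⟩ := hdata.average_optimal hSigma0 hQ hR hW hU hSp hlim hfix hD₁
    (LQG.System.tendsto_average_trace one_pos (s.Phi S) hlim₁)
  -- The privacy matrix is the difference of the limiting mean covariances; the second is kept as a
  -- mean over period one, in the form the general lemma gives.
  refine ⟨S, P, (T : ℝ)⁻¹ • ∑ i ∈ Finset.range T, s.h^[i] P -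
    ((1 : ℕ) : ℝ)⁻¹ • ∑ i ∈ Finset.range 1, s.h^[i] P₁, ⟨hSp, hlim, hfix⟩, ⟨hP, hPfix, hPu⟩,
    fun u u' hu hu2 hu' hu2' => ?_, fun N => ?_, ?_, ?_, ?_, ?_, ?_, ?_⟩
  · filter_upwards [hdata.errorCov_periodic_ae_eq hSigma0 hQ hR hu hu2,
      hdata.errorCov_periodic_ae_eq hSigma0 hQ hR
        (LQG.System.admissible_fullSchedule_iff.1 hu') hu2'] with ω hω hω'
    refine ((LQG.System.tendsto_average_filterCov hT hlimT).sub
      (LQG.System.tendsto_average_filterCov one_pos hlim₁)).congr fun N => ?_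
    simp only [LQG.System.errorCov_fullSchedule, hω, hω', Finset.sum_sub_distrib, smul_sub]
  · obtain ⟨-, u, hu, huL, huN⟩ :=
      hdata.exists_horizon_optimal hSigma0 hQ hR hW hU (LQG.periodicSchedule T) N
    rw [hdata.optimalHorizonCost_eq hSigma0 hQ hR hW hU]
    exact ⟨ENNReal.ofReal_ne_top, u, hu, fun k _ => huL k, huN⟩
  · refine (hdata.tendsto_horizonValue hSigma0 hQ hU hSp hlim hD ha).congr fun N => ?_
    rw [hdata.optimalHorizonCost_eq hSigma0 hQ hR hW hU, ENNReal.toReal_ofReal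
      (hdata.exists_horizon_optimal hSigma0 hQ hR hW hU _ N).1]
  · rw [hopt]
    exact ENNReal.ofReal_ne_top
  · rw [hopt, ENNReal.toReal_ofReal hV]
  · rw [hopt]
    exact hatt
  · rw [LQG.System.optimalAverageCost_fullSchedule, hopt₁]
    exact ENNReal.ofReal_ne_top
  -- Both optima share the term `tr (S Q)`, which cancels; linearity of the trace gives the rest.
  · rw [LQG.System.optimalAverageCost_fullSchedule, hopt, hopt₁, ENNReal.toReal_ofReal hV,
      ENNReal.toReal_ofReal hV₁, add_sub_add_left_eq_sub, Matrix.mul_sub, trace_sub]
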